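/- Let $X=(X_k)_{k\in\mathbb Z^d}$ be a stationary ergodic process with values in $\{0,1\}$ and let $U$ be uniform on $[0,1[^d$, independent of $X$. Let $\varphi=s(U,X)=U+\{k\in\mathbb Z^d : X_k=1\}$, a stationary point process on $\mathbb R^d$. Let $S$ be the set of the vectors $v\in S^{d-1}$ such that $\varphi$ is not ergodic under the translations along $\mathbb R v$. Then $S$ is negligible for the surface measure of $S^{d-1}$, and it is countable if $d=2$. Moreover $X$ has a spectral measure, that is, a finite measure $\mu$ on $\mathbb R^d$ such that $\widehat\mu(k)=\int e^{-2\pi i\langle k,x\rangle}\mu(dx)=E X_0X_k$ for all $k\in\mathbb Z^d$. Let $E,F$ be linear subspaces of $\mathbb R^d$ with $\mathbb R^d=E\oplus F$, and let $x=x_E+x_F$ be the corresponding decomposition of $x$; let $x_E^\perp$, $x_F^\perp$ be the orthogonal projections of $x$ on $E$ and $F$. Let $W$ be a bounded Borel subset of $F$, write $E\times W=\{x : x_F\in W\}$, and let $\chi=\pi(\varphi)=\{x_E : x\in\varphi\cap(E\times W)\}$. Assume that $E$ contains a vector of $S^{d-1}\setminus S$, and that almost surely two different points of $\varphi\cap(E\times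 W)$ have different images under $x\mapsto x_E$. Then $\chi$ is a stationary, ergodic (under the translations of $E$) and square integrable point process on $E$. Let $C_E\subset E$ and $C_F\subset F$ be Borel sets of Lebesgue measure $1$ (in $E$ and in $F$ respectively), let $\alpha$ be the Lebesgue measure of $C_E+C_F$ in $\mathbb R^d$, and let $\psi=1_W*1_{-W}$ on $F$, with Fourier transform $\widehat\psi(\xi)=\int_F e^{-2\pi i\langle x,\xi\rangle}\psi(x)\,dx$. Let $\mu$ be a spectral measure of $X$ and $\mu_p(A)=\sum_{k\in\mathbb Z^d}\mu(A-k)$. The numbers $\widehat\mu(k)$ and the function $\widehat\psi$ are real and nonnegative. Almost surely, the measures $\gamma_R=\frac1{|B_R|}\sum_{x,y\in\chi\cap B_R}\delta_{y-x}$, where $B_R$ is the ball of $E$ with centre $0$ and radius $R$, converge vaguely as $R\to\infty$ to the locally finite measure $$\gamma(C)=\alpha\sum_{k\in\mathbb Z^d}\widehat\mu(k)\,\psi(k_F)\,1_C(k_E),\qquad C\in\mathcal B(E),$$ the autocorrelation of $\chi$, and its Fourier transform in the sense of tempered distributions, the diffraction measure of $\chi$, is the measure $$\widehat\gamma(C)=\alpha^2\int_{\mathbb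 R^d}\widehat\psi(x_F^\perp)\,1_C(x_E^\perp)\,\mu_p(dx),\qquad C\in\mathcal B(E).$$ If $X\equiv1$ almost surely, then $S$ is contained in the set of the unit vectors whose coordinates are linearly dependent over $\mathbb Q$, and the formulas become $\gamma(C)=\alpha\sum_{k}\psi(k_F)1_C(k_E)$ and $\widehat\gamma(C)=\alpha^2\sum_{k}\widehat\psi(k_F^\perp)1_C(k_E^\perp)$. -/

import Mathlib

open MeasureTheory ProbabilityTheory Filter Topology
open scoped ENNReal FourierTransform

noncomputable section

namespace PointProc

section Abstract

variable {G α : Type*} [MeasurableSpace α]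

/-- The measure `m` is invariant under all the maps `T g`. -/
def StationaryUnder (T : G → α → α) (m : Measure α) : Prop :=
  ∀ g, MeasurePreserving (T g) m m

/-- Every event that is invariant under all the maps `T g` is trivial for `m`. -/
def ErgodicUnder (T : G → α → α) (m : Measure α) : Prop :=
  ∀ A : Set α, MeasurableSet A → (∀ g, T g ⁻¹' A = A) → m A = 0 ∨ m Aᶜ = 0

end Abstract

section Configurations

variable (V : Type*) [NormedAddCommGroup V]

/-- The locally finite subsets of `V`. -/
def LocFin : Type _ := {s : Set V // ∀ B : Set V, Bornology.IsBounded B → (s ∩ B).Finite}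

variable {V}

/-- The number `N_A(φ)` of points of `φ` in `A`. -/
def count (A : Set V) (φ : LocFin V) : ℕ := (φ.1 ∩ A).ncard

/-- The σ-algebra generated by the counting maps `N_A`, `A` a bounded Borel set. -/
instance [MeasurableSpace V] : MeasurableSpace (LocFin V) :=
  ⨆ A : {A : Set V // MeasurableSet A ∧ Bornology.IsBounded A},
    MeasurableSpace.comap (count A.1) ⊤

/-- The translation `φ ↦ φ - t`. -/
def translate (t : V) (φ : LocFin V) : LocFin V :=
  ⟨(fun x => x - t) '' φ.1, by
    intro B hB
    have hB' : Bornology.IsBounded ((fun x => x + t) '' B) := by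
      obtain ⟨R, hR⟩ := hB.exists_norm_le
      refine isBounded_iff_forall_norm_le.2 ⟨R + ‖t‖, ?_⟩
      rintro _ ⟨x, hx, rfl⟩
      exact (norm_add_le _ _).trans (by gcongr; exact hR x hx)
    refine ((φ.2 _ hB').image (fun x => x - t)).subset ?_
    rintro _ ⟨⟨x, hx, rfl⟩, hxB⟩
    exact ⟨x, ⟨hx, x - t, hxB, by simp⟩, rfl⟩⟩

/-- The counts in compact sets are square integrable. -/
def SquareIntegrable {Ω : Type*} [MeasurableSpace Ω] (P : Measure Ω) (χ : Ω → LocFin V) : Prop :=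
  ∀ K : Set V, IsCompact K → MemLp (fun ω => (count K (χ ω) : ℝ)) 2 P

end Configurations

section Diffraction

variable {V : Type*} [NormedAddCommGroup V] [InnerProductSpace ℝ V] [FiniteDimensional ℝ V]
  [MeasurableSpace V] [BorelSpace V]

/-- The autocorrelation `γ_R = |B_R|⁻¹ ∑_{x, y ∈ φ ∩ B_R} δ_{y - x}`. -/
def autocorrelationBall (φ : LocFin V) (R : ℝ) : Measure V :=
  (volume (Metric.closedBall (0 : V) R))⁻¹ •
    Measure.sum fun p : ((φ.1 ∩ Metric.closedBall 0 R) ×ˢ (φ.1 ∩ Metric.closedBall 0 R) :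
      Set (V × V)) => Measure.dirac (p.1.2 - p.1.1)

/-- The Radon measure `γ` is the vague limit of `γ_R` as `R → ∞`. -/
def IsAutocorrelation (φ : LocFin V) (γ : Measure V) : Prop :=
  IsLocallyFiniteMeasure γ ∧
    ∀ f : V → ℝ, Continuous f → HasCompactSupport f →
      Tendsto (fun R : ℝ => ∫ x, f x ∂(autocorrelationBall φ R)) atTop (𝓝 (∫ x, f x ∂γ))

/-- The measure `ν` is the Fourier transform of the measure `γ` as a tempered distribution. -/
def IsFourierTransform (γ ν : Measure V) : Prop :=
  ∃ (_ : γ.HasTemperateGrowth) (_ : ν.HasTemperateGrowth),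
    𝓕 γ.toTemperedDistribution = ν.toTemperedDistribution

/-- The measure `ν` is the Fourier transform of the autocorrelation of `φ`. -/
def IsDiffraction (φ : LocFin V) (ν : Measure V) : Prop :=
  ∃ γ : Measure V, IsAutocorrelation φ γ ∧ IsFourierTransform γ ν

/-- The function `ψ = 1_W * 1_{-W}`. -/
def psi (W : Set V) : V → ℝ :=
  convolution (W.indicator fun _ => (1 : ℝ)) ({x | -x ∈ W}.indicator fun _ => (1 : ℝ))
    (ContinuousLinearMap.mul ℝ ℝ) volume

/-- The Fourier transform `ψ̂(ξ) = ∫ e^{-2πi⟨x, ξ⟩} ψ(x) dx`. -/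
def psiHat (W : Set V) : V → ℂ := 𝓕 fun x : V => (psi W x : ℂ)

/-- For the law `m` of a point process, the unit vectors `v` such that the process is not
ergodic under the translations along the line `ℝ v`. -/
def exceptionalSet (m : Measure (LocFin V)) : Set (Metric.sphere (0 : V) 1) :=
  {v | ¬ ErgodicUnder (fun r : ℝ => translate (r • (v : V))) m}

end Diffraction

section Lattice

variable {d : ℕ}

/-- The shifts of `{0,1}^{ℤ^d}`. -/
def shift (j : Fin d → ℤ) (x : (Fin d → ℤ) → Bool) : (Fin d → ℤ) → Bool := fun k => x (k + j)

/-- The inclusion of `ℤ^d` in `ℝ^d`. -/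
def latticePoint (k : Fin d → ℤ) : EuclideanSpace ℝ (Fin d) := WithLp.toLp 2 fun i => (k i : ℝ)

/-- The cube `[0,1[^d`. -/
def unitCube (d : ℕ) : Set (EuclideanSpace ℝ (Fin d)) := {x | ∀ i, 0 ≤ x i ∧ x i < 1}

/-- The set `s(u, x) = u + {k ∈ ℤ^d : x_k = 1}`. -/
def suspension (u : EuclideanSpace ℝ (Fin d)) (x : (Fin d → ℤ) → Bool) :
    LocFin (EuclideanSpace ℝ (Fin d)) :=
  ⟨(fun k => u + latticePoint k) '' {k | x k = true}, by
    intro B hB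
    obtain ⟨R, hR⟩ := hB.exists_norm_le
    obtain ⟨N, hN⟩ := exists_nat_ge (R + ‖u‖)
    refine ((Set.finite_Icc (fun _ : Fin d => -(N : ℤ)) fun _ => (N : ℤ)).image
      fun k => u + latticePoint k).subset ?_
    rintro _ ⟨⟨k, -, rfl⟩, hk⟩
    refine ⟨k, ?_, rfl⟩
    have h1 : ‖latticePoint k‖ ≤ N := by
      have := norm_sub_le (u + latticePoint k) u
      rw [add_sub_cancel_left] at this
      linarith [hR _ hk]
    have h2 : ∀ i, |(k i : ℝ)| ≤ N := fun i =>
      (PiLp.norm_apply_le (latticePoint k) i).trans h1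
    have h3 : ∀ i, |k i| ≤ (N : ℤ) := fun i => by exact_mod_cast h2 i
    exact ⟨fun i => (abs_le.1 (h3 i)).1, fun i => (abs_le.1 (h3 i)).2⟩⟩

/-- The Fourier coefficient `μ̂(k) = ∫ e^{-2πi⟨k, x⟩} μ(dx)`. -/
def fourierCoef (μ : Measure (EuclideanSpace ℝ (Fin d))) (k : Fin d → ℤ) : ℂ :=
  ∫ x, Complex.exp (-(2 * Real.pi * inner ℝ (latticePoint k) x : ℝ) * Complex.I) ∂μ

/-- The finite measure `μ` on `ℝ^d` is a spectral measure of the stationary process `X`: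
`μ̂(k) = E X_0 X_k`. -/
def IsSpectralMeasure {Ω : Type*} [MeasurableSpace Ω] (P : Measure Ω)
    (X : Ω → (Fin d → ℤ) → Bool) (μ : Measure (EuclideanSpace ℝ (Fin d))) : Prop :=
  IsFiniteMeasure μ ∧ ∀ k, fourierCoef μ k =
    ((∫ ω, ((X ω 0).toNat : ℝ) * ((X ω k).toNat : ℝ) ∂P : ℝ) : ℂ)

/-- The `ℤ^d`-periodic measure `μ_p(A) = ∑_k μ(A - k)`. -/
def periodization (μ : Measure (EuclideanSpace ℝ (Fin d))) : Measure (EuclideanSpace ℝ (Fin d)) :=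
  Measure.sum fun k : Fin d → ℤ => μ.map fun x => x + latticePoint k

end Lattice

section CutProject

variable {V : Type*} [NormedAddCommGroup V] [InnerProductSpace ℝ V]
  {E F : Submodule ℝ V}

/-- The points of `φ ∩ (E × W)`, that is, the points of `φ` whose component in `F` is in `W`. -/
def strip (h : IsCompl E F) (W : Set F) (φ : LocFin V) : Set V :=
  {x | x ∈ φ.1 ∧ F.projectionOnto E h.symm x ∈ W}

/-- The set `π(φ) = p_E(φ ∩ (E × W))`, for a bounded `W`. -/
def cutProject (h : IsCompl E F) (W : Set F) (hW : Bornology.IsBounded W) (φ : LocFin V) :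
    LocFin E :=
  ⟨E.projectionOnto F h '' strip h W φ, by
    intro B hB
    obtain ⟨R, hR⟩ := hB.exists_norm_le
    obtain ⟨R', hR'⟩ := hW.exists_norm_le
    refine ((φ.2 (Metric.closedBall 0 (R + R')) Metric.isBounded_closedBall).image
      (E.projectionOnto F h)).subset ?_
    rintro _ ⟨⟨x, ⟨hx, hxW⟩, rfl⟩, hxB⟩
    refine ⟨x, ⟨hx, ?_⟩, rfl⟩
    rw [mem_closedBall_zero_iff, ← Submodule.projection_add_projection_eq_self h x]
    exact (norm_add_le _ _).trans (add_le_add (hR _ hxB) (hR' _ hxW))⟩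

end CutProject

end PointProc

end

open MeasureTheory ProbabilityTheory Filter Topology
open scoped ENNReal FourierTransform
set_option linter.unusedSectionVars false

namespace PointProc

/-! ### Measurability of counts and of translations -/

section Measurability

variable {V : Type*} [NormedAddCommGroup V] [MeasurableSpace V]

theorem measurable_count {A : Set V} (hA : MeasurableSet A) (hb : Bornology.IsBounded A) :
    Measurable (count A) := by
  have h : MeasurableSpace.comap (count A) ⊤ ≤ (inferInstance : MeasurableSpace (LocFin V)) :=
    le_iSup (fun A : {A : Set V // MeasurableSet A ∧ Bornology.IsBounded A} =>
      MeasurableSpace.comap (count A.1) ⊤) ⟨A, hA, hb⟩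
  exact fun s hs => h _ ⟨s, trivial, rfl⟩

theorem measurable_of_count {α : Type*} [MeasurableSpace α] {f : α → LocFin V}
    (h : ∀ A : Set V, MeasurableSet A → Bornology.IsBounded A →
      Measurable fun a => count A (f a)) : Measurable f := by
  rw [measurable_iff_comap_le]
  change MeasurableSpace.comap f (⨆ A : {A : Set V // MeasurableSet A ∧ Bornology.IsBounded A},
    MeasurableSpace.comap (count A.1) ⊤) ≤ _
  rw [MeasurableSpace.comap_iSup]
  refine iSup_le fun A => ?_
  rw [MeasurableSpace.comap_comp]
  exact measurable_iff_comap_le.1 (h A.1 A.2.1 A.2.2)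

theorem measurable_nat_of_cast {α : Type*} [MeasurableSpace α] {f : α → ℕ}
    (h : Measurable fun a => (f a : ℝ≥0∞)) : Measurable f := by
  refine measurable_to_countable' fun n => ?_
  have : f ⁻¹' {n} = (fun a => (f a : ℝ≥0∞)) ⁻¹' {(n : ℝ≥0∞)} := by ext a; simp
  rw [this]
  exact h (measurableSet_singleton _)

theorem natCast_ncard_eq_tsum {α : Type*} {s : Set α} (hs : s.Finite) :
    (s.ncard : ℝ≥0∞) = ∑' k, s.indicator 1 k := by
  rw [tsum_eq_sum (s := hs.toFinset) fun k hk => Set.indicator_of_notMem (by simpa using hk) _,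
    Set.ncard_eq_toFinset_card _ hs, Finset.card_eq_sum_ones, Nat.cast_sum]
  refine Finset.sum_congr rfl fun k hk => ?_
  rw [Set.indicator_of_mem (by simpa using hk)]
  simp

theorem measurableSet_count_ne_zero {α : Type*} [MeasurableSpace α] {f : α → ℕ}
    (h : Measurable f) : MeasurableSet {a | f a ≠ 0} :=
  h (MeasurableSet.of_discrete (s := {0}ᶜ))

variable [MeasurableSingletonClass V]

/-- Counting points of `φ` in the sections of a measurable set is jointly measurable. -/
theorem measurable_ncard_section {S : Type*} [MeasurableSpace S] {B : Set V}
    (hB : MeasurableSet B) (hBb : Bornology.IsBounded B) {D : Set (S × V)}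
    (hD : MeasurableSet D) :
    Measurable fun p : S × LocFin V => (p.2.1 ∩ B ∩ {x | (p.1, x) ∈ D}).ncard := by
  refine measurable_nat_of_cast ?_
  have hfin : ∀ p : S × LocFin V, (p.2.1 ∩ B).Finite := fun p => p.2.2 B hBb
  have hcount : ∀ (p : S × LocFin V) (D : Set (S × V)),
      ((p.2.1 ∩ B ∩ {x | (p.1, x) ∈ D}).ncard : ℝ≥0∞) =
        (Measure.count.restrict (p.2.1 ∩ B)) {x | (p.1, x) ∈ D} := by
    intro p D
    have h1 : (p.2.1 ∩ B ∩ {x | (p.1, x) ∈ D}).Finite := (hfin p).inter_of_left _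
    rw [Measure.restrict_apply' (hfin p).measurableSet, Set.inter_comm {x | (p.1, x) ∈ D},
      Measure.count_apply_finite _ h1, Set.ncard_eq_toFinset_card _ h1]
  simp_rw [hcount]
  have : ∀ p : S × LocFin V, IsFiniteMeasure (Measure.count.restrict (p.2.1 ∩ B)) := fun p =>
    ⟨by rw [Measure.restrict_apply_univ]; exact Measure.count_apply_lt_top.2 (hfin p)⟩
  have hsec : ∀ (p : S × LocFin V) {D : Set (S × V)}, MeasurableSet D →
      MeasurableSet {x | (p.1, x) ∈ D} := fun p D hD => measurable_prodMk_left hD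
  -- A π-λ argument. On rectangles the count factors into an indicator and a count of `φ` alone;
  -- since `B` is bounded the counts are finite, which makes the step for complements a genuine
  -- subtraction.
  induction D, hD using MeasurableSpace.induction_on_inter generateFrom_prod.symm
    isPiSystem_prod with
  | empty => simp
  | basic t ht =>
    obtain ⟨s, hs, u, hu, rfl⟩ := ht
    have : (fun p : S × LocFin V => (Measure.count.restrict (p.2.1 ∩ B)) {x | (p.1, x) ∈ s ×ˢ u}) =
        fun p => s.indicator 1 p.1 * (count (B ∩ u) p.2 : ℝ≥0∞) := by
      funext p
      by_cases hp : p.1 ∈ s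
      · have := hcount p (s ×ˢ u)
        rw [← this]
        simp [hp, count, Set.inter_assoc, Set.ofPred_mem_eq]
      · simp [hp]
    rw [this]
    exact ((measurable_one.indicator hs).comp measurable_fst).mul
      (measurable_from_top.comp ((measurable_count (hB.inter hu)
        (hBb.subset Set.inter_subset_left)).comp measurable_snd))
  | compl t ht ih =>
    have : (fun p : S × LocFin V => (Measure.count.restrict (p.2.1 ∩ B)) {x | (p.1, x) ∈ tᶜ}) =
        fun p => (count B p.2 : ℝ≥0∞) -
          (Measure.count.restrict (p.2.1 ∩ B)) {x | (p.1, x) ∈ t} := by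
      funext p
      have h1 : {x | (p.1, x) ∈ tᶜ} = {x | (p.1, x) ∈ t}ᶜ := rfl
      rw [h1, measure_compl (hsec p ht) (measure_ne_top _ _)]
      congr 1
      have := hcount p Set.univ
      simp only [Set.mem_univ, Set.ofPred_true, Set.inter_univ] at this
      rw [← this]; rfl
    rw [this]
    exact (measurable_from_top.comp ((measurable_count hB hBb).comp measurable_snd)).sub ih
  | iUnion f hd hf ih =>
    have : (fun p : S × LocFin V => (Measure.count.restrict (p.2.1 ∩ B)) {x | (p.1, x) ∈ ⋃ i, f i})
        = fun p => ∑' i, (Measure.count.restrict (p.2.1 ∩ B)) {x | (p.1, x) ∈ f i} := by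
      funext p
      rw [← measure_iUnion]
      · congr 1; ext x; simp
      · intro i j hij
        exact (hd hij).preimage _
      · exact fun i => hsec p (hf i)
    rw [this]
    exact Measurable.tsum ih

theorem count_translate (A : Set V) (t : V) (φ : LocFin V) :
    count A (translate t φ) = count ((fun x => x - t) ⁻¹' A) φ := by
  have h : (translate t φ).1 ∩ A = (fun x => x - t) '' (φ.1 ∩ (fun x => x - t) ⁻¹' A) := by
    rw [Set.image_inter_preimage]; rfl
  rw [count, h, Set.ncard_image_of_injective _ (sub_left_injective)]; rfl

variable [BorelSpace V] [SecondCountableTopology V]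

/-- The translations of a configuration are jointly measurable. -/
theorem measurable_translate : Measurable fun p : V × LocFin V => translate p.1 p.2 := by
  refine measurable_of_count fun A hA hAb => ?_
  simp_rw [count_translate]
  have hD : MeasurableSet {q : V × V | q.2 - q.1 ∈ A} :=
    (measurable_snd.sub measurable_fst) hA
  -- The sections `A + t` are bounded, but not uniformly in `t`. Cutting with balls restores a fixed
  -- bounded set, and for each `(t, φ)` the cut counts are eventually constant.
  have key : ∀ n : ℕ, Measurable fun p : V × LocFin V =>
      (p.2.1 ∩ Metric.closedBall 0 n ∩ {x | (p.1, x) ∈ {q : V × V | q.2 - q.1 ∈ A}}).ncard :=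
    fun n => measurable_ncard_section Metric.isClosed_closedBall.measurableSet
      Metric.isBounded_closedBall hD
  refine measurable_of_tendsto_metrizable key (tendsto_pi_nhds.2 fun p => ?_)
  obtain ⟨R, hR⟩ := hAb.exists_norm_le
  obtain ⟨N, hN⟩ := exists_nat_ge (R + ‖p.1‖)
  refine tendsto_const_nhds.congr' ?_
  filter_upwards [eventually_ge_atTop N] with n hn
  rw [count]
  congr 1
  ext x
  simp only [Set.mem_inter_iff, Set.mem_preimage, mem_closedBall_zero_iff, Set.mem_ofPred_eq]
  constructor
  · rintro ⟨h1, h2⟩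
    refine ⟨⟨h1, ?_⟩, h2⟩
    have := norm_add_le (x - p.1) p.1
    rw [sub_add_cancel] at this
    have h3 : (N : ℝ) ≤ n := by exact_mod_cast hn
    linarith [hR _ h2]
  · rintro ⟨⟨h1, _⟩, h2⟩
    exact ⟨h1, h2⟩

end Measurability

theorem translate_zero {V : Type*} [NormedAddCommGroup V] (φ : LocFin V) :
    translate 0 φ = φ := Subtype.ext (by simp [translate])

theorem translate_add {V : Type*} [NormedAddCommGroup V] (s t : V) (φ : LocFin V) :
    translate (s + t) φ = translate s (translate t φ) := by
  refine Subtype.ext ?_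
  simp only [translate, Set.image_image]
  refine Set.image_congr fun x _ => by abel

/-! ### Counting common points from hitting events -/

section Separation

variable {α : Type*} [MeasurableSpace α] [MeasurableSpace.CountablyGenerated α]

/-- The first `n` bits of a point, for a countable separating family of measurable sets. -/
noncomputable def bitCode (α : Type*) [MeasurableSpace α] [MeasurableSpace.CountablyGenerated α]
    (n : ℕ) (x : α) : Fin n → Bool :=
  fun i => MeasurableSpace.mapNatBool α x i

theorem measurable_bitCode (n : ℕ) : Measurable (bitCode α n) :=
  measurable_pi_lambda _ fun i =>
    (measurable_pi_apply (i : ℕ)).comp (MeasurableSpace.measurable_mapNatBool α)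

theorem eventually_injOn_bitCode [MeasurableSpace.SeparatesPoints α] {s : Set α} (hs : s.Finite) :
    ∀ᶠ n in atTop, Set.InjOn (bitCode α n) s := by
  have h : ∀ x ∈ s, ∀ᶠ n in atTop, ∀ y ∈ s, bitCode α n x = bitCode α n y → x = y := by
    intro x _
    refine (Filter.eventually_all_finite hs).2 fun y _ => ?_
    by_cases hxy : x = y
    · simp [hxy]
    · have : MeasurableSpace.mapNatBool α x ≠ MeasurableSpace.mapNatBool α y :=
        fun h => hxy (MeasurableSpace.injective_mapNatBool α h)
      obtain ⟨i, hi⟩ := Function.ne_iff.1 this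
      filter_upwards [eventually_gt_atTop i] with n hn h
      exact absurd (congrFun h ⟨i, hn⟩) hi
  filter_upwards [(Filter.eventually_all_finite hs).2 h] with n hn x hx y hy hxy
  exact hn x hx y hy hxy

/-- The number of common points of two random finite sets is measurable as soon as the events
that they meet a given measurable set are measurable. -/
theorem measurable_ncard_inter [MeasurableSpace.SeparatesPoints α] {S : Type*} [MeasurableSpace S]
    {s t : S → Set α} (hs : ∀ ω, (s ω).Finite) (ht : ∀ ω, (t ω).Finite)
    (hsm : ∀ q, MeasurableSet q → MeasurableSet {ω | (s ω ∩ q).Nonempty})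
    (htm : ∀ q, MeasurableSet q → MeasurableSet {ω | (t ω ∩ q).Nonempty}) :
    Measurable fun ω => (s ω ∩ t ω).ncard := by
  classical
  -- Coded by `n` bits, both sets live in a finite alphabet, and a common code is detected by two
  -- hitting events. For large `n` the code is injective on the finite union, so the number of
  -- common codes is the number of common points.
  have key : ∀ n : ℕ, Measurable fun ω => (bitCode α n '' s ω ∩ bitCode α n '' t ω).ncard := by
    intro n
    have h1 : (fun ω => (bitCode α n '' s ω ∩ bitCode α n '' t ω).ncard) = fun ω =>
        ∑ c : Fin n → Bool, ({ω | (s ω ∩ bitCode α n ⁻¹' {c}).Nonempty} ∩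
          {ω | (t ω ∩ bitCode α n ⁻¹' {c}).Nonempty}).indicator 1 ω := by
      funext ω
      rw [Set.ncard_eq_toFinset_card', Finset.card_eq_sum_ones,
        ← Finset.sum_filter_add_sum_filter_not Finset.univ
          (fun c => c ∈ (bitCode α n '' s ω ∩ bitCode α n '' t ω).toFinset)]
      have h2 : ∀ c, (c ∈ (bitCode α n '' s ω ∩ bitCode α n '' t ω).toFinset) ↔
          ω ∈ ({ω | (s ω ∩ bitCode α n ⁻¹' {c}).Nonempty} ∩
          {ω | (t ω ∩ bitCode α n ⁻¹' {c}).Nonempty}) := by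
        intro c
        simp only [Set.mem_toFinset, Set.mem_inter_iff, Set.mem_image, Set.mem_ofPred_eq]
        exact Iff.rfl
      rw [Finset.filter_univ_mem, Finset.sum_eq_zero (s := Finset.filter _ _), add_zero]
      · refine Finset.sum_congr rfl fun c hc => ?_
        rw [Set.indicator_of_mem ((h2 c).1 hc)]; rfl
      · intro c hc
        rw [Set.indicator_of_notMem]
        rw [← h2]; exact (Finset.mem_filter.1 hc).2
    rw [h1]
    refine Finset.measurable_fun_sum _ fun c _ => measurable_one.indicator
      ((hsm _ ?_).inter (htm _ ?_)) <;>
    exact measurable_bitCode n (measurableSet_singleton c)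
  refine measurable_of_tendsto_metrizable key (tendsto_pi_nhds.2 fun ω => ?_)
  refine tendsto_const_nhds.congr' ?_
  filter_upwards [eventually_injOn_bitCode ((hs ω).union (ht ω))] with n hn
  rw [← hn.image_inter Set.subset_union_left Set.subset_union_right,
    (hn.mono (Set.inter_subset_left.trans Set.subset_union_left)).ncard_image]

end Separation

/-! ### Measurability and equivariance of the cut and projection -/

section Maps

variable {V : Type*} [NormedAddCommGroup V] [MeasurableSpace V]

theorem nonempty_inter_iff_count_ne_zero (φ : LocFin V) {B : Set V}
    (hB : Bornology.IsBounded B) : (φ.1 ∩ B).Nonempty ↔ count B φ ≠ 0 := by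
  rw [count, Ne, Set.ncard_eq_zero (φ.2 B hB), Set.nonempty_iff_ne_empty]

theorem measurableSet_nonempty_inter {B : Set V} (hB : MeasurableSet B)
    (hb : Bornology.IsBounded B) : MeasurableSet {φ : LocFin V | (φ.1 ∩ B).Nonempty} := by
  simp_rw [nonempty_inter_iff_count_ne_zero _ hb]
  exact measurableSet_count_ne_zero (measurable_count hB hb)

/-- The number of points `x` of `φ ∩ D` such that `x + k` is a point of `φ`. -/
theorem measurable_ncard_inter_translate [BorelSpace V] [SecondCountableTopology V] (k : V)
    {D : Set V} (hD : MeasurableSet D) (hDb : Bornology.IsBounded D) :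
    Measurable fun φ : LocFin V => {x | x ∈ φ.1 ∧ x + k ∈ φ.1 ∧ x ∈ D}.ncard := by
  have h : ∀ φ : LocFin V, {x | x ∈ φ.1 ∧ x + k ∈ φ.1 ∧ x ∈ D} =
      (φ.1 ∩ D) ∩ ((translate k φ).1 ∩ D) := by
    intro φ
    ext x
    simp only [translate, Set.mem_ofPred_eq, Set.mem_inter_iff, Set.mem_image]
    constructor
    · rintro ⟨h1, h2, h3⟩
      exact ⟨⟨h1, h3⟩, ⟨x + k, h2, by simp⟩, h3⟩
    · rintro ⟨⟨h1, h3⟩, ⟨y, hy, rfl⟩, -⟩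
      exact ⟨h1, by simpa using hy, h3⟩
  simp_rw [h]
  have hq : ∀ q, MeasurableSet q → MeasurableSet {φ : LocFin V | (φ.1 ∩ D ∩ q).Nonempty} := by
    intro q hq
    simp_rw [Set.inter_assoc]
    exact measurableSet_nonempty_inter (hD.inter hq) (hDb.subset Set.inter_subset_left)
  exact measurable_ncard_inter (fun φ => φ.2 D hDb) (fun φ => (translate k φ).2 D hDb) hq
    fun q hqm => (measurable_translate.comp measurable_prodMk_left) (hq q hqm)

variable {W : Type*} [NormedAddCommGroup W] [InnerProductSpace ℝ W] [FiniteDimensional ℝ W]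
  [MeasurableSpace W] [BorelSpace W]

theorem isBounded_projectionOnto_preimage {E F : Submodule ℝ W} (h : IsCompl E F) {A : Set E}
    {B : Set F} (hA : Bornology.IsBounded A) (hB : Bornology.IsBounded B) :
    Bornology.IsBounded {x : W | E.projectionOnto F h x ∈ A ∧ F.projectionOnto E h.symm x ∈ B} := by
  obtain ⟨R, hR⟩ := hA.exists_norm_le
  obtain ⟨R', hR'⟩ := hB.exists_norm_le
  refine isBounded_iff_forall_norm_le.2 ⟨R + R', ?_⟩
  rintro x ⟨hxA, hxB⟩
  rw [← Submodule.projection_add_projection_eq_self h x]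
  exact (norm_add_le _ _).trans (add_le_add (hR _ hxA) (hR' _ hxB))

theorem measurable_projectionOnto {E F : Submodule ℝ W} (h : IsCompl E F) :
    Measurable (E.projectionOnto F h) :=
  (LinearMap.continuous_of_finiteDimensional _).measurable

/-- The projection may merge points, so counts of the image are not counts of `φ`. The events that
the image meets a set are events about `φ`, and `measurable_ncard_inter`, applied to the image and
itself, recovers the counts from them. -/
theorem measurable_cutProject {E F : Submodule ℝ W} (h : IsCompl E F) {B : Set F}
    (hBm : MeasurableSet B) (hB : Bornology.IsBounded B) : Measurable (cutProject h B hB) := by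
  refine measurable_of_count fun A hA hAb => ?_
  have h1 : (fun φ : LocFin W => count A (cutProject h B hB φ)) = fun φ =>
      (((cutProject h B hB φ).1 ∩ A) ∩ ((cutProject h B hB φ).1 ∩ A)).ncard := by
    funext φ
    rw [Set.inter_self, count]
  have hq : ∀ q, MeasurableSet q →
      MeasurableSet {φ : LocFin W | ((cutProject h B hB φ).1 ∩ A ∩ q).Nonempty} := by
    intro q hq
    have h2 : {φ : LocFin W | ((cutProject h B hB φ).1 ∩ A ∩ q).Nonempty} = {φ : LocFin W |
        (φ.1 ∩ {x : W | E.projectionOnto F h x ∈ A ∩ q ∧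
          F.projectionOnto E h.symm x ∈ B}).Nonempty} := by
      ext φ
      constructor
      · rintro ⟨_, ⟨⟨x, ⟨hx, hxB⟩, rfl⟩, hxA⟩, hxq⟩
        exact ⟨x, hx, ⟨hxA, hxq⟩, hxB⟩
      · rintro ⟨x, hx, ⟨hxA, hxq⟩, hxB⟩
        exact ⟨_, ⟨⟨x, ⟨hx, hxB⟩, rfl⟩, hxA⟩, hxq⟩
    rw [h2]
    exact measurableSet_nonempty_inter
      ((measurable_projectionOnto h (hA.inter hq)).inter (measurable_projectionOnto h.symm hBm))
      (isBounded_projectionOnto_preimage h (hAb.subset Set.inter_subset_left) hB)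
  rw [h1]
  exact measurable_ncard_inter (fun φ => (cutProject h B hB φ).2 A hAb)
    (fun φ => (cutProject h B hB φ).2 A hAb) hq hq

theorem cutProject_translate {E F : Submodule ℝ W} (h : IsCompl E F) {B : Set F}
    (hB : Bornology.IsBounded B) (t : E) (φ : LocFin W) :
    cutProject h B hB (translate (t : W) φ) = translate t (cutProject h B hB φ) := by
  have h1 : ∀ x : W, E.projectionOnto F h (x - t) = E.projectionOnto F h x - t := by
    intro x
    rw [map_sub, Submodule.projectionOnto_apply_left]
  have h2 : ∀ x : W, F.projectionOnto E h.symm (x - t) = F.projectionOnto E h.symm x := by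
    intro x
    rw [map_sub, Submodule.projectionOnto_apply_right, sub_zero]
  refine Subtype.ext (Set.ext fun y => ?_)
  constructor
  · rintro ⟨_, ⟨⟨x, hx, rfl⟩, hxB⟩, rfl⟩
    rw [h2] at hxB
    exact ⟨_, ⟨x, ⟨hx, hxB⟩, rfl⟩, (h1 x).symm⟩
  · rintro ⟨_, ⟨x, ⟨hx, hxB⟩, rfl⟩, rfl⟩
    refine ⟨x - t, ⟨⟨x, hx, rfl⟩, ?_⟩, h1 x⟩
    rw [h2]
    exact hxB

end Maps

/-! ### The suspension map -/

section Suspension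

variable {d : ℕ}

theorem latticePoint_add (j k : Fin d → ℤ) :
    latticePoint (j + k) = latticePoint j + latticePoint k := by
  ext i; simp [latticePoint]

theorem latticePoint_neg (j : Fin d → ℤ) : latticePoint (-j) = -latticePoint j := by
  ext i; simp [latticePoint]

theorem latticePoint_sub (j k : Fin d → ℤ) :
    latticePoint (j - k) = latticePoint j - latticePoint k := by
  rw [sub_eq_add_neg, latticePoint_add, latticePoint_neg, sub_eq_add_neg]

theorem latticePoint_injective : Function.Injective (latticePoint : (Fin d → ℤ) → _) := by
  intro j k h
  funext i
  have := congrArg (fun x : EuclideanSpace ℝ (Fin d) => x i) h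
  simpa [latticePoint] using this

theorem suspension_injective (u : EuclideanSpace ℝ (Fin d)) :
    Function.Injective fun k : Fin d → ℤ => u + latticePoint k :=
  fun _ _ h => latticePoint_injective (add_left_cancel h)

theorem finite_latticePoint_mem {B : Set (EuclideanSpace ℝ (Fin d))}
    (hB : Bornology.IsBounded B) (u : EuclideanSpace ℝ (Fin d)) :
    {k : Fin d → ℤ | u + latticePoint k ∈ B}.Finite := by
  have h := (suspension u fun _ => true).2 B hB
  refine (h.preimage (suspension_injective u).injOn).subset fun k hk => ?_
  exact ⟨⟨k, rfl, rfl⟩, hk⟩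

theorem measurable_suspension : Measurable fun p : EuclideanSpace ℝ (Fin d) × ((Fin d → ℤ) → Bool) =>
    suspension p.1 p.2 := by
  refine measurable_of_count fun A hA hAb => measurable_nat_of_cast ?_
  have h : (fun p : EuclideanSpace ℝ (Fin d) × ((Fin d → ℤ) → Bool) =>
      ((count A (suspension p.1 p.2) : ℕ) : ℝ≥0∞)) = fun p => ∑' k : Fin d → ℤ,
        {p : EuclideanSpace ℝ (Fin d) × ((Fin d → ℤ) → Bool) |
          p.1 + latticePoint k ∈ A ∧ p.2 k = true}.indicator 1 p := by
    funext p
    have h1 : (suspension p.1 p.2).1 ∩ A = (fun k => p.1 + latticePoint k) ''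
        {k | p.1 + latticePoint k ∈ A ∧ p.2 k = true} := by
      ext x
      constructor
      · rintro ⟨⟨k, hk, rfl⟩, hA⟩
        exact ⟨k, ⟨hA, hk⟩, rfl⟩
      · rintro ⟨k, ⟨hA, hk⟩, rfl⟩
        exact ⟨⟨k, hk, rfl⟩, hA⟩
    have h2 : {k | p.1 + latticePoint k ∈ A ∧ p.2 k = true}.Finite :=
      (finite_latticePoint_mem hAb p.1).subset fun k hk => hk.1
    rw [count, h1, Set.ncard_image_of_injective _ (suspension_injective p.1),
      natCast_ncard_eq_tsum h2]
    rfl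
  rw [h]
  refine Measurable.tsum fun k => measurable_one.indicator ?_
  refine ((measurable_fst.add_const _) hA).inter ?_
  exact measurableSet_eq_fun ((measurable_pi_apply k).comp measurable_snd) measurable_const

theorem suspension_add (u t : EuclideanSpace ℝ (Fin d)) (x : (Fin d → ℤ) → Bool) :
    suspension (u + t) x = translate (-t) (suspension u x) := by
  refine Subtype.ext ?_
  simp only [translate, suspension, Set.image_image]
  refine Set.image_congr fun k _ => by abel

/-- The gluing relation of the suspension. It turns invariance under shifts into periodicity in the
base point. -/
theorem suspension_add_latticePoint (u : EuclideanSpace ℝ (Fin d)) (j : Fin d → ℤ)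
    (x : (Fin d → ℤ) → Bool) :
    suspension (u + latticePoint j) x = suspension u (shift (-j) x) := by
  refine Subtype.ext (Set.ext fun y => ?_)
  constructor
  · rintro ⟨k, hk, rfl⟩
    refine ⟨k + j, ?_, ?_⟩
    · simpa [shift] using hk
    · simp only [latticePoint_add]; abel
  · rintro ⟨k, hk, rfl⟩
    refine ⟨k - j, ?_, ?_⟩
    · simpa [shift, sub_eq_add_neg] using hk
    · simp only [latticePoint_sub]; abel

end Suspension

/-! ### The unit cube as a fundamental domain -/

section UnitCube

variable {d : ℕ}

theorem unitCube_eq_preimage : unitCube d =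
    WithLp.ofLp ⁻¹' (Set.univ.pi fun _ => Set.Ico (0 : ℝ) 1) := by
  ext x
  simp [unitCube, Set.mem_pi]

theorem measurableSet_unitCube : MeasurableSet (unitCube d) := by
  rw [unitCube_eq_preimage]
  exact (PiLp.volume_preserving_ofLp (Fin d)).measurable
    (MeasurableSet.univ_pi fun _ => measurableSet_Ico)

theorem volume_unitCube : volume (unitCube d) = 1 := by
  rw [unitCube_eq_preimage, (PiLp.volume_preserving_ofLp (Fin d)).measure_preimage
    (MeasurableSet.univ_pi fun _ => measurableSet_Ico).nullMeasurableSet, volume_pi, Measure.pi_pi]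
  simp

instance : IsProbabilityMeasure (volume.restrict (unitCube d)) :=
  ⟨by rw [Measure.restrict_apply_univ, volume_unitCube]⟩

/-- The integer part of a vector. -/
noncomputable def floorVec (x : EuclideanSpace ℝ (Fin d)) : Fin d → ℤ := fun i => ⌊x i⌋

theorem sub_latticePoint_mem_unitCube (x : EuclideanSpace ℝ (Fin d)) (k : Fin d → ℤ) :
    x - latticePoint k ∈ unitCube d ↔ k = floorVec x := by
  constructor
  · intro h
    funext i
    have := h i
    simp only [latticePoint, PiLp.sub_apply] at this
    exact (Int.floor_eq_iff.2 ⟨by linarith, by linarith⟩).symm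
  · rintro rfl i
    simp only [latticePoint, PiLp.sub_apply, floorVec]
    exact ⟨by linarith [Int.floor_le (x i)], by linarith [Int.lt_floor_add_one (x i)]⟩

/-- The integral over the space as an integral over the unit cube. -/
theorem lintegral_eq_unitCube_tsum {g : EuclideanSpace ℝ (Fin d) → ℝ≥0∞} (hg : Measurable g) :
    ∫⁻ x, g x = ∫⁻ u in unitCube d, ∑' k, g (u + latticePoint k) := by
  have hU : (⋃ k : Fin d → ℤ, (fun x => x - latticePoint k) ⁻¹' unitCube d) = Set.univ := by
    refine Set.eq_univ_of_forall fun x => Set.mem_iUnion.2 ⟨floorVec x, ?_⟩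
    exact (sub_latticePoint_mem_unitCube x _).2 rfl
  have hd : Pairwise (Function.onFun Disjoint
      fun k : Fin d → ℤ => (fun x => x - latticePoint k) ⁻¹' unitCube d) := by
    intro j k hjk
    refine Set.disjoint_left.2 fun x hx hx' => hjk ?_
    rw [(sub_latticePoint_mem_unitCube x j).1 hx, (sub_latticePoint_mem_unitCube x k).1 hx']
  have hm : ∀ k : Fin d → ℤ, MeasurableSet ((fun x => x - latticePoint k) ⁻¹' unitCube d) :=
    fun k => (measurable_id.sub_const _) measurableSet_unitCube
  rw [← setLIntegral_univ, ← hU, lintegral_iUnion hm hd, lintegral_tsum]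
  · refine tsum_congr fun k => ?_
    rw [← lintegral_indicator (hm k), ← lintegral_indicator measurableSet_unitCube,
      ← lintegral_add_right_eq_self _ (latticePoint k)]
    refine lintegral_congr fun u => ?_
    have h1 : u + latticePoint k ∈ (fun x => x - latticePoint k) ⁻¹' unitCube d ↔
        u ∈ unitCube d := by rw [Set.mem_preimage, add_sub_cancel_right]
    by_cases hu : u ∈ unitCube d
    · rw [Set.indicator_of_mem (h1.2 hu), Set.indicator_of_mem hu]
    · rw [Set.indicator_of_notMem (mt h1.1 hu), Set.indicator_of_notMem hu]
  · exact fun k => (hg.comp (measurable_id.add_const _)).aemeasurable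

/-- Integrals of periodic functions over the unit cube are translation invariant. -/
theorem setLIntegral_unitCube_sub {h : EuclideanSpace ℝ (Fin d) → ℝ≥0∞} (hh : Measurable h)
    (hper : ∀ u k, h (u + latticePoint k) = h u) (t : EuclideanSpace ℝ (Fin d)) :
    ∫⁻ u in unitCube d, h (u - t) = ∫⁻ u in unitCube d, h u := by
  have h1 : ∫⁻ u in unitCube d, h (u - t) =
      ∫⁻ u, ((fun x => x + t) ⁻¹' unitCube d).indicator h u := by
    rw [← lintegral_indicator measurableSet_unitCube, ← lintegral_add_right_eq_self _ t]
    refine lintegral_congr fun u => ?_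
    simp only [Set.indicator, add_sub_cancel_right]
    rfl
  have hm : MeasurableSet ((fun x => x + t) ⁻¹' unitCube d) :=
    (measurable_id.add_const t) measurableSet_unitCube
  rw [h1, lintegral_eq_unitCube_tsum (hh.indicator hm)]
  refine lintegral_congr fun u => ?_
  -- Exactly one lattice translate of `u` lies in the cube moved by `-t`.
  rw [tsum_eq_single (-floorVec (u + t))]
  · rw [Set.indicator_of_mem, hper]
    have := (sub_latticePoint_mem_unitCube (u + t) _).2 rfl
    rw [Set.mem_preimage, latticePoint_neg]
    convert this using 1
    abel
  · intro k hk
    rw [Set.indicator_of_notMem]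
    intro h2
    rw [Set.mem_preimage] at h2
    refine hk ?_
    rw [← (sub_latticePoint_mem_unitCube (u + t) (-k)).1, neg_neg]
    rw [latticePoint_neg]
    convert h2 using 1
    abel

end UnitCube

/-! ### Stationarity and ergodicity of the suspension -/

section Law

variable {d : ℕ}

/-- The law of the suspension of a process with law `ξ`. -/
noncomputable def suspensionLaw (ξ : Measure ((Fin d → ℤ) → Bool)) :
    Measure (LocFin (EuclideanSpace ℝ (Fin d))) :=
  ((volume.restrict (unitCube d)).prod ξ).map fun p => suspension p.1 p.2

variable {ξ : Measure ((Fin d → ℤ) → Bool)} [IsProbabilityMeasure ξ]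

instance : IsProbabilityMeasure (suspensionLaw ξ) :=
  Measure.isProbabilityMeasure_map measurable_suspension.aemeasurable

theorem lintegral_suspensionLaw {f : LocFin (EuclideanSpace ℝ (Fin d)) → ℝ≥0∞}
    (hf : Measurable f) :
    ∫⁻ φ, f φ ∂(suspensionLaw ξ) = ∫⁻ u in unitCube d, ∫⁻ x, f (suspension u x) ∂ξ := by
  rw [suspensionLaw, lintegral_map hf measurable_suspension,
    lintegral_prod (fun p : EuclideanSpace ℝ (Fin d) × ((Fin d → ℤ) → Bool) =>
      f (suspension p.1 p.2)) (hf.comp measurable_suspension).aemeasurable]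

theorem map_suspension_eq {Ω : Type*} [MeasurableSpace Ω] {P : Measure Ω} [IsProbabilityMeasure P]
    {X : Ω → (Fin d → ℤ) → Bool} (hX : Measurable X) {U : Ω → EuclideanSpace ℝ (Fin d)}
    (hU : Measurable U) (hUunif : pdf.IsUniform U (unitCube d) P volume) (hUX : IndepFun U X P) :
    P.map (fun ω => suspension (U ω) (X ω)) = suspensionLaw (P.map X) := by
  have h1 : P.map U = volume.restrict (unitCube d) := by
    rw [hUunif, ProbabilityTheory.cond, volume_unitCube, inv_one, one_smul]
  rw [suspensionLaw, ← h1, ← (indepFun_iff_map_prod_eq_prod_map_map hU.aemeasurable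
    hX.aemeasurable).1 hUX, Measure.map_map measurable_suspension (hU.prodMk hX)]
  rfl

theorem lintegral_suspension_add_latticePoint (hs : StationaryUnder shift ξ)
    {f : LocFin (EuclideanSpace ℝ (Fin d)) → ℝ≥0∞} (hf : Measurable f)
    (u : EuclideanSpace ℝ (Fin d)) (k : Fin d → ℤ) :
    ∫⁻ x, f (suspension (u + latticePoint k) x) ∂ξ = ∫⁻ x, f (suspension u x) ∂ξ := by
  simp_rw [suspension_add_latticePoint]
  exact (hs (-k)).lintegral_comp (f := fun x => f (suspension u x))
    (hf.comp (measurable_suspension.comp measurable_prodMk_left))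

/-- For a fixed base point `u`, the mean over `x` is periodic in `u` because `ξ` is shift invariant,
and the integral of a periodic function over the cube does not change under translations. -/
theorem stationaryUnder_suspensionLaw (hs : StationaryUnder shift ξ) :
    StationaryUnder translate (suspensionLaw ξ) := by
  intro t
  have ht : Measurable (translate t : LocFin (EuclideanSpace ℝ (Fin d)) → _) :=
    measurable_translate.comp measurable_prodMk_left
  refine ⟨ht, Measure.ext_of_lintegral _ fun f hf => ?_⟩
  rw [lintegral_map hf ht, lintegral_suspensionLaw (f := fun φ => f (translate t φ)) (hf.comp ht), lintegral_suspensionLaw hf,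
    ← setLIntegral_unitCube_sub (h := fun u => ∫⁻ x, f (suspension u x) ∂ξ) _ _ t]
  · refine lintegral_congr fun u => lintegral_congr fun x => ?_
    rw [sub_eq_add_neg, suspension_add, neg_neg]
  · exact (hf.comp measurable_suspension).lintegral_prod_right'
  · exact fun u k => lintegral_suspension_add_latticePoint hs hf u k

/-- An event invariant under all translations does not see the base point, so it is an event about
`x` alone; translations by lattice vectors make this event invariant under the shifts. -/
theorem ergodicUnder_suspensionLaw (he : ErgodicUnder shift ξ) :
    ErgodicUnder translate (suspensionLaw ξ) := by
  intro A hA hinv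
  have h0 : ∀ u x, suspension u x ∈ A ↔ suspension 0 x ∈ A := by
    intro u x
    have := Set.ext_iff.1 (hinv (-u)) (suspension 0 x)
    rwa [Set.mem_preimage, ← suspension_add, zero_add] at this
  have hm0 : Measurable fun x => suspension (0 : EuclideanSpace ℝ (Fin d)) x :=
    measurable_suspension.comp measurable_prodMk_left
  have hlaw : ∀ B : Set (LocFin (EuclideanSpace ℝ (Fin d))), MeasurableSet B →
      (∀ u x, suspension u x ∈ B ↔ suspension 0 x ∈ B) →
      suspensionLaw ξ B = ξ {x | suspension 0 x ∈ B} := by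
    intro B hB h
    rw [suspensionLaw, Measure.map_apply measurable_suspension hB]
    have : (fun p : EuclideanSpace ℝ (Fin d) × ((Fin d → ℤ) → Bool) => suspension p.1 p.2) ⁻¹' B =
        Set.univ ×ˢ {x | suspension 0 x ∈ B} := by
      ext p
      simpa using h p.1 p.2
    rw [this, Measure.prod_prod, measure_univ, one_mul]
  have hAc : ∀ u x, suspension u x ∈ Aᶜ ↔ suspension 0 x ∈ Aᶜ := fun u x => not_congr (h0 u x)
  rw [hlaw A hA h0, hlaw Aᶜ hA.compl hAc]
  refine he {x | suspension 0 x ∈ A} (hm0 hA) fun j => ?_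
  ext x
  have := suspension_add_latticePoint 0 (-j) x
  rw [neg_neg] at this
  rw [Set.mem_preimage, Set.mem_ofPred_eq, ← this, h0]
  rfl

end Law

/-! ### Measurable flows and almost invariant events -/

section Flow

/-- A jointly measurable action of an additive group by measure preserving maps. -/
structure MeasurableFlow {V α : Type*} [AddCommGroup V] [MeasurableSpace V] [MeasurableSpace α]
    (T : V → α → α) (m : Measure α) : Prop where
  measurable : Measurable fun p : V × α => T p.1 p.2
  add_apply : ∀ s t y, T (s + t) y = T s (T t y)
  zero_apply : ∀ y, T 0 y = y
  measurePreserving : ∀ t, MeasurePreserving (T t) m m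

theorem measurableFlow_translate {V : Type*} [NormedAddCommGroup V] [MeasurableSpace V]
    [BorelSpace V] [SecondCountableTopology V] {m : Measure (LocFin V)}
    (hs : StationaryUnder translate m) : MeasurableFlow translate m where
  measurable := measurable_translate
  add_apply := translate_add
  zero_apply := translate_zero
  measurePreserving := hs

namespace MeasurableFlow

theorem comp_linear {V V' α : Type*} [AddCommGroup V] [MeasurableSpace V] [AddCommGroup V']
    [MeasurableSpace V'] [MeasurableSpace α] {T : V → α → α} {m : Measure α}
    (h : MeasurableFlow T m) (L : V' →+ V) (hL : Measurable L) :
    MeasurableFlow (fun t => T (L t)) m where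
  measurable := h.measurable.comp ((hL.comp measurable_fst).prodMk measurable_snd)
  add_apply s t y := by rw [map_add, h.add_apply]
  zero_apply y := by rw [map_zero, h.zero_apply]
  measurePreserving t := h.measurePreserving _

variable {V : Type*} [NormedAddCommGroup V] [NormedSpace ℝ V] [FiniteDimensional ℝ V]
  [MeasureSpace V] [BorelSpace V] [(volume : Measure V).IsAddHaarMeasure]
  {α : Type*} [MeasurableSpace α] {T : V → α → α} {m : Measure α} [IsProbabilityMeasure m]

theorem measurable_map (h : MeasurableFlow T m) (t : V) : Measurable (T t) :=
  (h.measurePreserving t).measurable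

/-- An almost sure property holds almost surely along almost all points of the orbits. -/
theorem ae_ae (h : MeasurableFlow T m) {p : α → Prop} (hp : ∀ᵐ y ∂m, p y) :
    ∀ᵐ y ∂m, ∀ᵐ t : V, p (T t y) := by
  obtain ⟨N, hN, hNm, hN0⟩ := exists_measurable_superset_of_null (ae_iff.1 hp)
  have h1 : ∀ᵐ t : V, ∀ᵐ y ∂m, T t y ∈ Nᶜ := Eventually.of_forall fun t =>
    (h.measurePreserving t).quasiMeasurePreserving.ae (measure_eq_zero_iff_ae_notMem.1 hN0)
  have h3 : MeasurableSet {q : V × α | T q.1 q.2 ∈ Nᶜ} := h.measurable hNm.compl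
  have h2 := (Measure.ae_ae_comm h3).1 h1
  filter_upwards [h2] with y hy
  filter_upwards [hy] with t ht
  by_contra h4
  exact ht (hN h4)

/-- Events that are almost surely invariant under an ergodic flow are trivial. -/
theorem measure_eq_zero_of_ae_invariant (h : MeasurableFlow T m) (he : ErgodicUnder T m)
    {A : Set α} (hA : MeasurableSet A) (hinv : ∀ t, ∀ᵐ y ∂m, T t y ∈ A ↔ y ∈ A) :
    m A = 0 ∨ m Aᶜ = 0 := by
  -- Ergodicity speaks of strictly invariant events only. The points whose orbit lies in `A` for
  -- almost every time form such an event, and by Fubini it coincides with `A` up to a null set.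
  set A' : Set α := {y | ∀ᵐ t : V, T t y ∈ A} with hA'
  have hm : MeasurableSet A' := by
    have : MeasurableSet {q : α × V | T q.2 q.1 ∈ Aᶜ} := (h.measurable.comp measurable_swap) hA.compl
    exact measurable_measure_prodMk_left this (measurableSet_singleton 0)
  have hstrict : ∀ s, T s ⁻¹' A' = A' := by
    intro s
    ext y
    simp only [hA', Set.mem_preimage, Set.mem_ofPred_eq, ← h.add_apply]
    exact eventually_add_right_iff (p := fun t => T t y ∈ A) volume s
  have hae : ∀ᵐ y ∂m, y ∈ A' ↔ y ∈ A := by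
    have h1 : ∀ᵐ t : V, ∀ᵐ y ∂m, T t y ∈ A ↔ y ∈ A := Eventually.of_forall hinv
    have h3 : MeasurableSet {q : V × α | T q.1 q.2 ∈ A ↔ q.2 ∈ A} := by
      have h4 : MeasurableSet {q : V × α | T q.1 q.2 ∈ A} := h.measurable hA
      have h5 : MeasurableSet {q : V × α | q.2 ∈ A} := measurable_snd hA
      exact h4.iff h5
    filter_upwards [(Measure.ae_ae_comm h3).1 h1] with y hy
    constructor
    · intro hy'
      obtain ⟨t, ht, ht'⟩ := (hy.and hy').exists
      exact ht.1 ht'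
    · intro hyA
      filter_upwards [hy] with t ht
      exact ht.2 hyA
  have hA1 : A' =ᵐ[m] A := by
    filter_upwards [hae] with y hy
    exact propext hy
  rw [← measure_congr hA1, ← measure_congr hA1.compl]
  exact he A' hm hstrict

/-- Functions that are almost surely invariant under an ergodic flow are constant. -/
theorem ae_eq_const_of_ae_invariant (h : MeasurableFlow T m) (he : ErgodicUnder T m)
    {f : α → ℝ} (hf : Measurable f) (hinv : ∀ t, ∀ᵐ y ∂m, f (T t y) = f y) :
    ∃ c, ∀ᵐ y ∂m, f y = c := by
  refine Filter.exists_eventuallyEq_const_of_forall_separating MeasurableSet fun U hU => ?_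
  have := h.measure_eq_zero_of_ae_invariant he (hf hU) fun t => by
    filter_upwards [hinv t] with y hy
    rw [Set.mem_preimage, hy, Set.mem_preimage]
  rcases this with h0 | h0
  · exact Or.inr (measure_eq_zero_iff_ae_notMem.1 h0)
  · refine Or.inl ?_
    filter_upwards [measure_eq_zero_iff_ae_notMem.1 h0] with y hy
    exact not_not.1 hy

end MeasurableFlow

end Flow

/-! ### Fixed vectors of commuting isometries -/

section Hilbert

variable {V : Type*} [AddCommGroup V] [Module ℝ V] {H : Type*} [NormedAddCommGroup H]
  [InnerProductSpace ℝ H] [CompleteSpace H] {K : V → H →ₗᵢ[ℝ] H} {e : H}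

/-- The vectors orthogonal to `e` that are fixed by the isometries `K x`, `x ∈ L`. -/
def fixedVectors (K : V → H →ₗᵢ[ℝ] H) (e : H) (L : Submodule ℝ V) : Submodule ℝ H where
  carrier := {f | inner ℝ e f = 0 ∧ ∀ x ∈ L, K x f = f}
  add_mem' := by
    rintro f g ⟨hf, hf'⟩ ⟨hg, hg'⟩
    exact ⟨by rw [inner_add_right, hf, hg, add_zero],
      fun x hx => by rw [map_add, hf' x hx, hg' x hx]⟩
  zero_mem' := ⟨inner_zero_right _, fun x _ => map_zero _⟩
  smul_mem' := by
    rintro c f ⟨hf, hf'⟩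
    exact ⟨by rw [inner_smul_right, hf, mul_zero], fun x hx => by rw [map_smul, hf' x hx]⟩

theorem isClosed_fixedVectors (L : Submodule ℝ V) : IsClosed (fixedVectors K e L : Set H) := by
  have : (fixedVectors K e L : Set H) =
      {f | inner ℝ e f = 0} ∩ ⋂ x ∈ L, {f | K x f = f} := by
    ext f
    simp [fixedVectors]
  rw [this]
  refine (isClosed_eq (by fun_prop) continuous_const).inter
    (isClosed_biInter fun x _ => isClosed_eq (K x).continuous continuous_id)

variable (hadd : ∀ x y f, K (x + y) f = K x (K y f)) (h0 : ∀ f, K 0 f = f)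
  (he : ∀ x, K x e = e)

include hadd h0 he

theorem map_mem_fixedVectors {L : Submodule ℝ V} {f : H} (hf : f ∈ fixedVectors K e L) (x : V) :
    K x f ∈ fixedVectors K e L := by
  refine ⟨?_, fun y hy => ?_⟩
  · rw [← he x, LinearIsometry.inner_map_map, hf.1]
  · rw [← hadd, add_comm, hadd, hf.2 y hy]

/-- Let `q` be the projection of `f` on the vectors fixed by `L'`. Every `K x` maps these vectors
onto themselves, by commutation, so for `x ∈ L` the vector `K x q` is the projection of `K x f = f`,
that is, `q`. Thus `q` is fixed by `L ⊔ L'` and vanishes. -/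
theorem inner_eq_zero_of_fixedVectors_sup {L L' : Submodule ℝ V}
    (hL : fixedVectors K e (L ⊔ L') = ⊥) {f g : H} (hf : f ∈ fixedVectors K e L)
    (hg : g ∈ fixedVectors K e L') : inner ℝ f g = 0 := by
  have : CompleteSpace (fixedVectors K e L') := (isClosed_fixedVectors L').completeSpace_coe
  set q := (fixedVectors K e L').starProjection f with hq
  have hqm : q ∈ fixedVectors K e L' := Submodule.starProjection_apply_mem _ _
  have horth : ∀ w ∈ fixedVectors K e L', inner ℝ (f - q) w = 0 := fun w hw =>
    Submodule.starProjection_inner_eq_zero f w hw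
  have hfix : ∀ x ∈ L, K x q = q := by
    intro x hx
    refine (Submodule.eq_starProjection_of_mem_of_inner_eq_zero
      (map_mem_fixedVectors hadd h0 he hqm x) fun w hw => ?_).symm
    have h1 : w = K x (K (-x) w) := by rw [← hadd, add_neg_cancel, h0]
    rw [h1, ← hf.2 x hx, ← map_sub, LinearIsometry.inner_map_map]
    exact horth _ (map_mem_fixedVectors hadd h0 he hw _)
  have hq0 : q ∈ fixedVectors K e (L ⊔ L') := by
    refine ⟨hqm.1, fun z hz => ?_⟩
    obtain ⟨x, hx, y, hy, rfl⟩ := Submodule.mem_sup.1 hz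
    rw [hadd, hqm.2 y hy, hfix x hx]
  rw [hL, Submodule.mem_bot] at hq0
  simpa [hq0] using horth g hg

/-- The family consists of the maximal subspaces with a nonzero fixed vector; finite dimension puts
one above every subspace of this kind. Unit fixed vectors of different maximal subspaces are
orthogonal, hence far apart, and a separable space has room for only countably many disjoint balls
around them. -/
theorem exists_countable_subspaces_of_fixedVectors [FiniteDimensional ℝ V]
    [TopologicalSpace.SeparableSpace H] (htop : fixedVectors K e ⊤ = ⊥) :
    ∃ S : Set (Submodule ℝ V), S.Countable ∧ (∀ L ∈ S, L ≠ ⊤) ∧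
      ∀ L₀, fixedVectors K e L₀ ≠ ⊥ → ∃ L ∈ S, L₀ ≤ L := by
  refine ⟨{L | fixedVectors K e L ≠ ⊥ ∧ ∀ L', L < L' → fixedVectors K e L' = ⊥}, ?_, ?_, ?_⟩
  · have hex : ∀ L : {L | fixedVectors K e L ≠ ⊥ ∧ ∀ L', L < L' → fixedVectors K e L' = ⊥},
        ∃ f ∈ fixedVectors K e L.1, ‖f‖ = 1 := by
      intro L
      obtain ⟨f, hf, hf0⟩ := Submodule.exists_mem_ne_zero_of_ne_bot L.2.1
      exact ⟨‖f‖⁻¹ • f, Submodule.smul_mem _ _ hf, norm_smul_inv_norm hf0⟩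
    choose f hf hf1 using hex
    have hlt : ∀ L L' : Submodule ℝ V, ¬ L' ≤ L → L < L ⊔ L' := fun L L' h =>
      left_lt_sup.2 h
    have hdist : ∀ L L', L ≠ L' → 1 ≤ ‖f L - f L'‖ := by
      intro L L' hne
      have hsup : fixedVectors K e (L.1 ⊔ L'.1) = ⊥ := by
        by_cases hle : L'.1 ≤ L.1
        · refine L'.2.2 _ (lt_of_lt_of_le (lt_of_le_of_ne hle ?_) le_sup_left)
          exact fun h => hne (Subtype.ext h.symm)
        · exact L.2.2 _ (hlt _ _ hle)
      have := inner_eq_zero_of_fixedVectors_sup hadd h0 he hsup (hf L) (hf L')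
      have h2 := norm_sub_sq_real (f L) (f L')
      rw [this, hf1, hf1] at h2
      nlinarith [norm_nonneg (f L - f L')]
    rw [← Set.countable_coe_iff]
    refine Pairwise.countable_of_isOpen_disjoint (s := fun L => Metric.ball (f L) (1 / 2)) ?_
      (fun L => Metric.isOpen_ball) (fun L => Metric.nonempty_ball.2 (by norm_num))
    intro L L' hne
    refine Metric.ball_disjoint_ball ?_
    rw [dist_eq_norm]
    linarith [hdist L L' hne]
  · rintro L ⟨hL, -⟩ rfl
    exact hL htop
  · intro L₀ hL₀
    obtain ⟨L, ⟨hL1, hL2⟩, hmax⟩ := wellFounded_gt.has_min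
      {L | L₀ ≤ L ∧ fixedVectors K e L ≠ ⊥} ⟨L₀, le_rfl, hL₀⟩
    refine ⟨L, ⟨hL2, fun L' hL' => ?_⟩, hL1⟩
    by_contra h
    exact hmax L' ⟨hL1.trans hL'.le, h⟩ hL'

end Hilbert

/-! ### The isometries of `L²` and the directions of nonergodicity -/

section Exceptional

variable {V : Type*} [NormedAddCommGroup V] [NormedSpace ℝ V] [FiniteDimensional ℝ V]
  [MeasureSpace V] [BorelSpace V] [(volume : Measure V).IsAddHaarMeasure]
  {α : Type*} [MeasurableSpace α] {T : V → α → α} {m : Measure α} [IsProbabilityMeasure m]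

namespace MeasurableFlow

/-- The isometries of `L²` induced by a flow. -/
noncomputable def koopman (h : MeasurableFlow T m) (t : V) : Lp ℝ 2 m →ₗᵢ[ℝ] Lp ℝ 2 m :=
  Lp.compMeasurePreservingₗᵢ ℝ (T t) (h.measurePreserving t)

theorem koopman_ae_eq (h : MeasurableFlow T m) (t : V) (f : Lp ℝ 2 m) :
    h.koopman t f =ᵐ[m] fun y => f (T t y) :=
  Lp.coeFn_compMeasurePreserving f (h.measurePreserving t)

theorem koopman_add (h : MeasurableFlow T m) (s t : V) (f : Lp ℝ 2 m) :
    h.koopman (s + t) f = h.koopman s (h.koopman t f) := by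
  refine Lp.ext ?_
  have h1 := (h.measurePreserving s).quasiMeasurePreserving.ae (h.koopman_ae_eq t f)
  filter_upwards [h.koopman_ae_eq (s + t) f, h.koopman_ae_eq s (h.koopman t f), h1] with y e1 e2 e3
  rw [e1, e2, e3, ← h.add_apply, add_comm]

theorem koopman_zero (h : MeasurableFlow T m) (f : Lp ℝ 2 m) : h.koopman 0 f = f := by
  refine Lp.ext ?_
  filter_upwards [h.koopman_ae_eq 0 f] with y e1
  rw [e1, h.zero_apply]

theorem koopman_indicatorConstLp (h : MeasurableFlow T m) (t : V) {A : Set α}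
    (hA : MeasurableSet A) :
    h.koopman t (indicatorConstLp 2 hA (measure_ne_top m A) (1 : ℝ)) =
      indicatorConstLp 2 (h.measurable_map t hA) (measure_ne_top m _) (1 : ℝ) :=
  Lp.indicatorConstLp_compMeasurePreserving hA (measure_ne_top m A) 1 (h.measurePreserving t)

/-- The constant function `1`. -/
noncomputable def oneLp (m : Measure α) [IsProbabilityMeasure m] : Lp ℝ 2 m :=
  indicatorConstLp 2 MeasurableSet.univ (measure_ne_top m _) (1 : ℝ)

theorem oneLp_ae_eq : oneLp m =ᵐ[m] fun _ => 1 := by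
  filter_upwards [indicatorConstLp_coeFn (p := 2) (hs := MeasurableSet.univ)
    (hμs := measure_ne_top m _) (c := (1 : ℝ))] with y hy
  rw [oneLp, hy, Set.indicator_univ]

theorem inner_oneLp (f : Lp ℝ 2 m) : inner ℝ (oneLp m) f = ∫ y, f y ∂m := by
  rw [L2.inner_def]
  refine integral_congr_ae ?_
  filter_upwards [oneLp_ae_eq (m := m)] with y hy
  rw [hy]; simp

theorem koopman_oneLp (h : MeasurableFlow T m) (t : V) : h.koopman t (oneLp m) = oneLp m := by
  rw [oneLp, koopman_indicatorConstLp]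
  rfl

theorem fixedVectors_top (h : MeasurableFlow T m) (he : ErgodicUnder T m) :
    fixedVectors h.koopman (oneLp m) ⊤ = ⊥ := by
  rw [eq_bot_iff]
  rintro f ⟨hf1, hf2⟩
  obtain ⟨c, hc⟩ := h.ae_eq_const_of_ae_invariant he (Lp.stronglyMeasurable f).measurable
    fun t => by
      filter_upwards [h.koopman_ae_eq t f] with y hy
      rw [← hy, hf2 t trivial]
  rw [inner_oneLp, integral_congr_ae hc, integral_const] at hf1
  simp only [probReal_univ, smul_eq_mul, one_mul] at hf1
  rw [Submodule.mem_bot]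
  refine Lp.ext ?_
  filter_upwards [hc, Lp.coeFn_zero ℝ 2 m] with y h1 h2
  rw [h1, h2, hf1]; rfl

/-- The directions along which an ergodic flow is not ergodic lie in countably many proper
subspaces. -/
theorem exists_countable_subspaces [TopologicalSpace.SeparableSpace (Lp ℝ 2 m)]
    (h : MeasurableFlow T m) (he : ErgodicUnder T m) :
    ∃ S : Set (Submodule ℝ V), S.Countable ∧ (∀ L ∈ S, L ≠ ⊤) ∧
      ∀ v, ¬ ErgodicUnder (fun r : ℝ => T (r • v)) m → ∃ L ∈ S, v ∈ L := by
  obtain ⟨S, hS, hS1, hS2⟩ := exists_countable_subspaces_of_fixedVectors h.koopman_add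
    h.koopman_zero h.koopman_oneLp (h.fixedVectors_top he)
  refine ⟨S, hS, hS1, fun v hv => ?_⟩
  suffices hne : fixedVectors h.koopman (oneLp m) (Submodule.span ℝ {v}) ≠ ⊥ by
    obtain ⟨L, hL, hL'⟩ := hS2 _ hne
    exact ⟨L, hL, hL' (Submodule.mem_span_singleton_self v)⟩
  unfold ErgodicUnder at hv
  push Not at hv
  obtain ⟨A, hA, hinv, hA0, hA1⟩ := hv
  intro hbot
  set g := indicatorConstLp 2 hA (measure_ne_top m A) (1 : ℝ) with hg
  have hoo : inner ℝ (oneLp m) (oneLp m) = 1 := by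
    rw [inner_oneLp, integral_congr_ae oneLp_ae_eq]; simp
  -- The centred indicator of a nontrivial invariant event is a fixed vector. If it were zero, the
  -- indicator would be almost surely constant and the event trivial.
  have hmem : g - inner ℝ (oneLp m) g • oneLp m ∈
      fixedVectors h.koopman (oneLp m) (Submodule.span ℝ {v}) := by
    refine ⟨?_, fun x hx => ?_⟩
    · rw [inner_sub_right, inner_smul_right, hoo, mul_one, sub_self]
    · obtain ⟨r, rfl⟩ := Submodule.mem_span_singleton.1 hx
      rw [map_sub, map_smul, koopman_oneLp, hg, koopman_indicatorConstLp]
      simp_rw [hinv r]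
  rw [hbot, Submodule.mem_bot, sub_eq_zero] at hmem
  set c := inner ℝ (oneLp m) g
  have hae : ∀ᵐ y ∂m, A.indicator (fun _ => (1 : ℝ)) y = c := by
    have h1 : g =ᵐ[m] _ := indicatorConstLp_coeFn
    have h2 := Lp.coeFn_smul c (oneLp m)
    rw [← hmem] at h2
    filter_upwards [h1, h2, oneLp_ae_eq (m := m)] with y e1 e2 e3
    rw [← e1, e2, Pi.smul_apply, e3, smul_eq_mul, mul_one]
  by_cases hc : c = 0
  · refine hA0 (measure_eq_zero_iff_ae_notMem.2 ?_)
    filter_upwards [hae] with y hy hyA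
    rw [Set.indicator_of_mem hyA, hc] at hy
    exact one_ne_zero hy
  · refine hA1 (measure_eq_zero_iff_ae_notMem.2 ?_)
    filter_upwards [hae] with y hy hyA
    rw [Set.indicator_of_notMem hyA] at hy
    exact hc hy.symm

end MeasurableFlow

end Exceptional

/-! ### Subspaces on the sphere -/

section Sphere

/-- The surface measure of a set is read off from the volume of the cone over it, and here the cone
stays inside the null set `L`. -/
theorem toSphere_submodule_eq_zero {V : Type*} [NormedAddCommGroup V] [NormedSpace ℝ V]
    [FiniteDimensional ℝ V] [MeasurableSpace V] [BorelSpace V] (μ : Measure V)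
    [μ.IsAddHaarMeasure] {L : Submodule ℝ V} (hL : L ≠ ⊤) :
    μ.toSphere {v : Metric.sphere (0 : V) 1 | (v : V) ∈ L} = 0 := by
  have hm : MeasurableSet {v : Metric.sphere (0 : V) 1 | (v : V) ∈ L} :=
    measurable_subtype_coe L.closed_of_finiteDimensional.measurableSet
  rw [Measure.toSphere_apply' _ hm]
  refine mul_eq_zero_of_right _ (measure_mono_null ?_ (Measure.addHaar_submodule μ L hL))
  rintro _ ⟨r, -, _, ⟨v, hv, rfl⟩, rfl⟩
  exact L.smul_mem r hv

theorem finite_sphere_inter_submodule {V : Type*} [NormedAddCommGroup V] [NormedSpace ℝ V]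
    [FiniteDimensional ℝ V] (hV : Module.finrank ℝ V = 2) {L : Submodule ℝ V} (hL : L ≠ ⊤) :
    {v : Metric.sphere (0 : V) 1 | (v : V) ∈ L}.Finite := by
  have h1 : Module.finrank ℝ L ≤ 1 := by
    have := Submodule.finrank_lt hL
    omega
  obtain ⟨w, hw⟩ := finrank_le_one_iff.1 h1
  refine Set.Finite.of_finite_image (f := Subtype.val) ?_ Subtype.val_injective.injOn
  refine ((Set.toFinite {‖(w : V)‖⁻¹, -‖(w : V)‖⁻¹}).image fun c : ℝ => c • (w : V)).subset ?_
  rintro _ ⟨v, hv, rfl⟩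
  obtain ⟨c, hc⟩ := hw ⟨v, hv⟩
  have hc' : c • (w : V) = v := congrArg Subtype.val hc
  refine ⟨c, ?_, hc'⟩
  have hv1 : ‖(v : V)‖ = 1 := mem_sphere_zero_iff_norm.1 v.2
  rw [← hc', norm_smul, Real.norm_eq_abs] at hv1
  have h2 : |c| = ‖(w : V)‖⁻¹ := eq_inv_of_mul_eq_one_left hv1
  rw [Set.mem_insert_iff, Set.mem_singleton_iff]
  exact eq_or_eq_neg_of_abs_eq h2

end Sphere

/-! ### The exceptional set of the suspension -/

section Exceptional

variable {d : ℕ} {ξ : Measure ((Fin d → ℤ) → Bool)} [IsProbabilityMeasure ξ]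

/-- Composition with the suspension map embeds this space isometrically into the `L²` of the pairs
`(u, x)`, which is separable; no countable generation of the σ-algebra of `LocFin` is needed. -/
instance separableSpace_suspensionLaw : TopologicalSpace.SeparableSpace (Lp ℝ 2 (suspensionLaw ξ)) := by
  have hmp : MeasurePreserving (fun p : EuclideanSpace ℝ (Fin d) × ((Fin d → ℤ) → Bool) =>
      suspension p.1 p.2) ((volume.restrict (unitCube d)).prod ξ) (suspensionLaw ξ) :=
    ⟨measurable_suspension, rfl⟩
  have hsep : IsSeparable ((volume.restrict (unitCube d)).prod ξ) := isSeparable_of_sigmaFinite _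
  have h2 : Fact ((2 : ℝ≥0∞) ≠ ∞) := ⟨ENNReal.ofNat_ne_top⟩
  have : SecondCountableTopology (Lp ℝ 2 (suspensionLaw ξ)) :=
    ((Lp.isometry_compMeasurePreserving (E := ℝ) (p := 2) hmp).isEmbedding).secondCountableTopology
  infer_instance

theorem exceptionalSet_subset (hs : StationaryUnder shift ξ) (he : ErgodicUnder shift ξ) :
    ∃ S : Set (Submodule ℝ (EuclideanSpace ℝ (Fin d))), S.Countable ∧ (∀ L ∈ S, L ≠ ⊤) ∧
      exceptionalSet (suspensionLaw ξ) ⊆ ⋃ L ∈ S, {v | (v : EuclideanSpace ℝ (Fin d)) ∈ L} := by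
  obtain ⟨S, h1, h2, h3⟩ := (measurableFlow_translate
    (stationaryUnder_suspensionLaw hs)).exists_countable_subspaces (ergodicUnder_suspensionLaw he)
  refine ⟨S, h1, h2, fun v hv => ?_⟩
  obtain ⟨L, hL, hvL⟩ := h3 v hv
  exact Set.mem_biUnion hL hvL

theorem toSphere_exceptionalSet (hs : StationaryUnder shift ξ) (he : ErgodicUnder shift ξ) :
    (volume : Measure (EuclideanSpace ℝ (Fin d))).toSphere (exceptionalSet (suspensionLaw ξ)) = 0 := by
  obtain ⟨S, h1, h2, h3⟩ := exceptionalSet_subset hs he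
  exact measure_mono_null h3 ((measure_biUnion_null_iff h1).2 fun L hL =>
    toSphere_submodule_eq_zero _ (h2 L hL))

theorem countable_exceptionalSet (hs : StationaryUnder shift ξ) (he : ErgodicUnder shift ξ)
    (hd : d = 2) : (exceptionalSet (suspensionLaw ξ)).Countable := by
  obtain ⟨S, h1, h2, h3⟩ := exceptionalSet_subset hs he
  exact (h1.biUnion fun L hL =>
    (finite_sphere_inter_submodule (by simp [hd]) (h2 L hL)).countable).mono h3

end Exceptional

/-! ### Fourier series on the unit cube -/

section Torus

attribute [local instance] instMeasureSpaceUnitAddCircle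

variable {d : ℕ}

/-- The representatives of the points of the torus in the unit cube. -/
noncomputable def cubeSection (θ : UnitAddTorus (Fin d)) : EuclideanSpace ℝ (Fin d) :=
  WithLp.toLp 2 fun i => (AddCircle.equivIco 1 0 (θ i) : ℝ)

theorem measurable_cubeSection : Measurable (cubeSection (d := d)) := by
  refine (PiLp.volume_preserving_toLp (Fin d)).measurable.comp (measurable_pi_lambda _ fun i => ?_)
  exact measurable_subtype_coe.comp
    ((AddCircle.measurableEquivIco (1 : ℝ) 0).measurable.comp (measurable_pi_apply i))

theorem coe_cubeSection (θ : UnitAddTorus (Fin d)) (i : Fin d) :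
    ((cubeSection θ i : ℝ) : UnitAddCircle) = θ i :=
  AddCircle.coe_equivIco

theorem cubeSection_coe {x : Fin d → ℝ} (hx : ∀ i, x i ∈ Set.Ico (0 : ℝ) 1) :
    cubeSection (fun i => (x i : UnitAddCircle)) = WithLp.toLp 2 x := by
  refine congrArg (WithLp.toLp 2) (funext fun i => ?_)
  have h : x i ∈ Set.Ico (0 : ℝ) (0 + 1) := by simpa using hx i
  exact congrArg Subtype.val (AddCircle.equivIco_coe_eq (p := (1 : ℝ)) (a := 0) h)

theorem measurePreserving_cubeSection :
    MeasurePreserving (cubeSection (d := d)) volume (volume.restrict (unitCube d)) := by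
  refine ⟨measurable_cubeSection, Measure.ext_of_lintegral _ fun f hf => ?_⟩
  rw [lintegral_map hf measurable_cubeSection, UnitAddTorus.lintegral_preimage _ (fun _ => 0)]
  have h1 : {x : Fin d → ℝ | ∀ i, x i ∈ Set.Ioc (0 : ℝ) (0 + 1)} =
      Set.univ.pi fun _ => Set.Ioc (0 : ℝ) 1 := by
    ext x; simp [Set.mem_pi]
  -- Integration over the torus uses cubes open on the left, `unitCube` is open on the right; the
  -- two differ by a null set.
  have h2 : (Set.univ.pi fun _ : Fin d => Set.Ioc (0 : ℝ) 1) =ᵐ[volume]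
      (Set.univ.pi fun _ : Fin d => Set.Ico (0 : ℝ) 1) :=
    Measure.univ_pi_Ioc_ae_eq_Icc.trans Measure.univ_pi_Ico_ae_eq_Icc.symm
  have h3 : MeasurableSet (Set.univ.pi fun _ : Fin d => Set.Ico (0 : ℝ) 1) :=
    MeasurableSet.univ_pi fun _ => measurableSet_Ico
  rw [h1, setLIntegral_congr h2]
  have h4 : ∫⁻ x in (Set.univ.pi fun _ : Fin d => Set.Ico (0 : ℝ) 1),
      f (cubeSection fun i => (x i : UnitAddCircle)) =
      ∫⁻ x in (Set.univ.pi fun _ : Fin d => Set.Ico (0 : ℝ) 1), f (WithLp.toLp 2 x) := by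
    refine setLIntegral_congr_fun h3 fun x hx => ?_
    rw [cubeSection_coe fun i => hx i trivial]
  rw [h4, unitCube_eq_preimage]
  exact ((PiLp.volume_preserving_ofLp (Fin d)).setLIntegral_comp_preimage h3
    (f := fun x => f (WithLp.toLp 2 x)) (hf.comp
      (PiLp.volume_preserving_toLp (Fin d)).measurable)).symm

theorem integral_cubeSection {g : EuclideanSpace ℝ (Fin d) → ℂ}
    (hg : AEStronglyMeasurable g (volume.restrict (unitCube d))) :
    ∫ θ, g (cubeSection θ) = ∫ x in unitCube d, g x := by
  have hmp := measurePreserving_cubeSection (d := d)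
  have := integral_map hmp.aemeasurable (f := g) (by rwa [hmp.map_eq])
  rw [hmp.map_eq] at this
  exact this.symm

/-- The character `x ↦ e^{-2πi⟨k, x⟩}`. -/
noncomputable def latticeChar (k : Fin d → ℤ) (x : EuclideanSpace ℝ (Fin d)) : ℂ :=
  Complex.exp (-(2 * Real.pi * inner ℝ (latticePoint k) x : ℝ) * Complex.I)

theorem continuous_latticeChar (k : Fin d → ℤ) : Continuous (latticeChar k) := by
  unfold latticeChar
  fun_prop

theorem norm_latticeChar (k : Fin d → ℤ) (x : EuclideanSpace ℝ (Fin d)) :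
    ‖latticeChar k x‖ = 1 := by
  rw [latticeChar, ← Complex.ofReal_neg, Complex.norm_exp_ofReal_mul_I]

theorem inner_latticePoint (k : Fin d → ℤ) (x : EuclideanSpace ℝ (Fin d)) :
    inner ℝ (latticePoint k) x = ∑ i, (k i : ℝ) * x i := by
  simp [PiLp.inner_apply, latticePoint, mul_comm]

theorem mFourier_coe (k : Fin d → ℤ) (x : EuclideanSpace ℝ (Fin d)) :
    UnitAddTorus.mFourier (-k) (fun i => (x i : UnitAddCircle)) = latticeChar k x := by
  simp only [UnitAddTorus.mFourier, ContinuousMap.coe_mk, fourier_coe_apply]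
  rw [← Complex.exp_sum, latticeChar, inner_latticePoint]
  congr 1
  push_cast
  rw [Finset.mul_sum, ← Finset.sum_neg_distrib, Finset.sum_mul]
  refine Finset.sum_congr rfl fun i _ => ?_
  simp only [Pi.neg_apply]
  push_cast
  ring

theorem latticeChar_cubeSection (k : Fin d → ℤ) (θ : UnitAddTorus (Fin d)) :
    latticeChar k (cubeSection θ) = UnitAddTorus.mFourier (-k) θ := by
  rw [← mFourier_coe]
  simp_rw [coe_cubeSection]

/-- The Fourier coefficients of a function on the unit cube. -/
noncomputable def cubeCoeff (f : EuclideanSpace ℝ (Fin d) → ℂ) (k : Fin d → ℤ) : ℂ :=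
  ∫ x in unitCube d, latticeChar k x * f x

/-- Parseval's identity of the torus, transported by the measure preserving `cubeSection`. -/
theorem hasSum_cubeCoeff {f g : EuclideanSpace ℝ (Fin d) → ℂ}
    (hf : MemLp f 2 (volume.restrict (unitCube d))) (hg : MemLp g 2 (volume.restrict (unitCube d))) :
    HasSum (fun k => star (cubeCoeff f k) * cubeCoeff g k)
      (∫ x in unitCube d, star (f x) * g x) := by
  have hmp := measurePreserving_cubeSection (d := d)
  have hcoef : ∀ {f : EuclideanSpace ℝ (Fin d) → ℂ} (hf : MemLp f 2 (volume.restrict (unitCube d)))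
      (k : Fin d → ℤ), UnitAddTorus.mFourierCoeff ((hf.comp_measurePreserving hmp).toLp _) k =
        cubeCoeff f k := by
    intro f hf k
    rw [UnitAddTorus.mFourierCoeff, cubeCoeff,
      ← integral_cubeSection (g := fun x => latticeChar k x * f x)
        ((continuous_latticeChar k).aestronglyMeasurable.mul hf.1)]
    refine integral_congr_ae ?_
    filter_upwards [(hf.comp_measurePreserving hmp).coeFn_toLp] with θ hθ
    rw [hθ, latticeChar_cubeSection]; rfl
  have h := UnitAddTorus.hasSum_prod_mFourierCoeff ((hf.comp_measurePreserving hmp).toLp _)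
    ((hg.comp_measurePreserving hmp).toLp _)
  convert h using 1
  · funext k
    rw [hcoef hf, hcoef hg]; rfl
  · rw [← integral_cubeSection (g := fun x => star (f x) * g x)
      ((continuous_star.comp_aestronglyMeasurable hf.1).mul hg.1)]
    refine integral_congr_ae ?_
    filter_upwards [(hf.comp_measurePreserving hmp).coeFn_toLp,
      (hg.comp_measurePreserving hmp).coeFn_toLp] with θ h1 h2
    rw [h1, h2]; rfl

end Torus

/-! ### Directions of nonergodicity for the full lattice -/

section ModelSet

variable {d : ℕ}

theorem measurable_floorVec : Measurable (floorVec (d := d)) := by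
  refine measurable_pi_lambda _ fun i => Int.measurable_floor.comp ?_
  exact (measurable_pi_apply i).comp (PiLp.volume_preserving_ofLp (Fin d)).measurable

/-- The representative of a vector in the unit cube. -/
noncomputable def fractVec (x : EuclideanSpace ℝ (Fin d)) : EuclideanSpace ℝ (Fin d) :=
  x - latticePoint (floorVec x)

theorem measurable_fractVec : Measurable (fractVec (d := d)) :=
  measurable_id.sub ((Measurable.of_discrete (f := latticePoint)).comp measurable_floorVec)

theorem fractVec_add_latticePoint (u : EuclideanSpace ℝ (Fin d)) (k : Fin d → ℤ) :
    fractVec (u + latticePoint k) = fractVec u := by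
  have : floorVec (u + latticePoint k) = floorVec u + k := by
    funext i
    simp [floorVec, latticePoint]
  rw [fractVec, this, latticePoint_add, fractVec]
  abel

theorem fractVec_of_mem {u : EuclideanSpace ℝ (Fin d)} (hu : u ∈ unitCube d) : fractVec u = u := by
  have h0 : latticePoint (0 : Fin d → ℤ) = 0 := by ext i; simp [latticePoint]
  have := (sub_latticePoint_mem_unitCube u 0).1 (by rwa [h0, sub_zero])
  rw [fractVec, ← this, h0, sub_zero]

theorem measurePreserving_fractVec_sub (t : EuclideanSpace ℝ (Fin d)) :
    MeasurePreserving (fun u => fractVec (u - t)) (volume.restrict (unitCube d))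
      (volume.restrict (unitCube d)) := by
  have hm : Measurable fun u => fractVec (u - t) := measurable_fractVec.comp (measurable_id.sub_const t)
  refine ⟨hm, Measure.ext_of_lintegral _ fun f hf => ?_⟩
  rw [lintegral_map hf hm, setLIntegral_unitCube_sub (h := fun u => f (fractVec u))
    (hf.comp measurable_fractVec) (fun u k => by rw [fractVec_add_latticePoint])]
  exact setLIntegral_congr_fun measurableSet_unitCube fun u hu => by rw [fractVec_of_mem hu]

theorem setIntegral_unitCube_sub {g : EuclideanSpace ℝ (Fin d) → ℂ} (hg : Measurable g)
    (hper : ∀ u k, g (u + latticePoint k) = g u) (t : EuclideanSpace ℝ (Fin d)) :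
    ∫ u in unitCube d, g (u - t) = ∫ u in unitCube d, g u := by
  have hmp := measurePreserving_fractVec_sub t
  conv_rhs => rw [← hmp.map_eq, integral_map hmp.aemeasurable hg.aestronglyMeasurable]
  refine integral_congr_ae (Eventually.of_forall fun u => ?_)
  have := hper (fractVec (u - t)) (floorVec (u - t))
  rw [fractVec, sub_add_cancel] at this
  exact this

theorem latticeChar_sub (k : Fin d → ℤ) (x y : EuclideanSpace ℝ (Fin d)) :
    latticeChar k (x - y) = Complex.exp ((2 * Real.pi * inner ℝ (latticePoint k) y : ℝ) * Complex.I)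
      * latticeChar k x := by
  rw [latticeChar, latticeChar, ← Complex.exp_add, inner_sub_right]
  congr 1
  push_cast
  ring

theorem latticeChar_add (k : Fin d → ℤ) (x y : EuclideanSpace ℝ (Fin d)) :
    latticeChar k (x + y) = latticeChar k x * latticeChar k y := by
  rw [latticeChar, latticeChar, latticeChar, ← Complex.exp_add, inner_add_right]
  congr 1
  push_cast
  ring

theorem latticeChar_latticePoint (k j : Fin d → ℤ) : latticeChar k (latticePoint j) = 1 := by
  rw [latticeChar, inner_latticePoint, Complex.exp_eq_one_iff]
  refine ⟨-∑ i, k i * j i, ?_⟩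
  simp only [latticePoint]
  push_cast
  ring

theorem latticeChar_add_latticePoint (k : Fin d → ℤ) (x : EuclideanSpace ℝ (Fin d))
    (j : Fin d → ℤ) : latticeChar k (x + latticePoint j) = latticeChar k x := by
  rw [latticeChar_add, latticeChar_latticePoint, mul_one]

theorem latticeChar_zero (x : EuclideanSpace ℝ (Fin d)) : latticeChar 0 x = 1 := by
  simp [latticeChar, inner_latticePoint]

/-- Kronecker's argument. An event invariant along `v` corresponds to a periodic set `S` of base
points that is invariant under `r • v`. Rational independence gives `⟨k, v⟩ ≠ 0` for `k ≠ 0`, and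
then invariance forces the coefficient of index `k` of the indicator of `S` to vanish. Only the mean
survives, and Parseval's identity becomes `|S|² = |S|`. -/
theorem exceptionalSet_subset_of_ae_eq_true {ξ : Measure ((Fin d → ℤ) → Bool)}
    [IsProbabilityMeasure ξ] (h1 : ∀ᵐ x ∂ξ, x = fun _ => true) :
    exceptionalSet (suspensionLaw ξ) ⊆
      {v | ¬ LinearIndependent ℚ fun i => (v : EuclideanSpace ℝ (Fin d)) i} := by
  intro v hv hind
  refine hv fun A hA hinv => ?_
  set S : Set (EuclideanSpace ℝ (Fin d)) := {u | suspension u (fun _ => true) ∈ A} with hS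
  have hSm : MeasurableSet S := (measurable_suspension.comp measurable_prodMk_right) hA
  have hlaw : suspensionLaw ξ A = volume.restrict (unitCube d) S := by
    rw [← lintegral_indicator_one hA, lintegral_suspensionLaw (measurable_one.indicator hA),
      ← lintegral_indicator_one hSm]
    refine lintegral_congr fun u => ?_
    have : ∀ᵐ x ∂ξ, A.indicator (1 : LocFin _ → ℝ≥0∞) (suspension u x) = S.indicator 1 u := by
      filter_upwards [h1] with x hx
      subst hx; rfl
    rw [lintegral_congr_ae this, lintegral_const, measure_univ, mul_one]
  set f : EuclideanSpace ℝ (Fin d) → ℂ := S.indicator fun _ => 1 with hf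
  have hfm : Measurable f := measurable_const.indicator hSm
  have hSper : ∀ u k, u + latticePoint k ∈ S ↔ u ∈ S := by
    intro u k
    simp only [hS, Set.mem_ofPred_eq, suspension_add_latticePoint]
    rfl
  have hSinv : ∀ u (r : ℝ), u - r • (v : EuclideanSpace ℝ (Fin d)) ∈ S ↔ u ∈ S := by
    intro u r
    simp only [hS, Set.mem_ofPred_eq]
    rw [sub_eq_add_neg, suspension_add, neg_neg]
    exact Set.ext_iff.1 (hinv r) _
  have hind' : ∀ {x y}, (x ∈ S ↔ y ∈ S) → f x = f y := by
    intro x y h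
    by_cases hx : x ∈ S
    · rw [hf, Set.indicator_of_mem hx, Set.indicator_of_mem (h.1 hx)]
    · rw [hf, Set.indicator_of_notMem hx, Set.indicator_of_notMem (mt h.2 hx)]
  have hcoef : ∀ k, k ≠ 0 → cubeCoeff f k = 0 := by
    intro k hk
    have hkv : inner ℝ (latticePoint k) (v : EuclideanSpace ℝ (Fin d)) ≠ 0 := by
      intro h0
      rw [inner_latticePoint] at h0
      refine hk (funext fun i => ?_)
      have := Fintype.linearIndependent_iff.1 hind (fun i => (k i : ℚ)) (by
        simpa [Rat.smul_def] using h0) i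
      exact_mod_cast this
    -- With this `r`, translation by `r • v` multiplies the coefficient by `e^{iπ} = -1`, so the
    -- coefficient equals its negative.
    set r : ℝ := (2 * inner ℝ (latticePoint k) (v : EuclideanSpace ℝ (Fin d)))⁻¹ with hr
    have h2 := setIntegral_unitCube_sub (g := fun u => latticeChar k u * f u)
      ((continuous_latticeChar k).measurable.mul hfm)
      (fun u j => by rw [latticeChar_add_latticePoint, hind' (hSper u j)])
      (r • (v : EuclideanSpace ℝ (Fin d)))
    simp_rw [latticeChar_sub, hind' (hSinv _ r), mul_assoc (Complex.exp _)] at h2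
    rw [integral_const_mul] at h2
    have h3 : (2 * Real.pi * inner ℝ (latticePoint k) (r • (v : EuclideanSpace ℝ (Fin d)))) =
        Real.pi := by
      rw [inner_smul_right, hr]
      field_simp
    rw [h3, Complex.exp_pi_mul_I] at h2
    have h4 : cubeCoeff f k = -cubeCoeff f k := by
      rw [cubeCoeff]; linear_combination -h2
    exact self_eq_neg.1 h4
  have hmem : MemLp f 2 (volume.restrict (unitCube d)) :=
    memLp_indicator_const 2 hSm 1 (Or.inr (measure_ne_top _ _))
  have hsum := hasSum_cubeCoeff hmem hmem
  have hsum0 := (hasSum_single (f := fun k => star (cubeCoeff f k) * cubeCoeff f k) 0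
    fun k hk => by simp [hcoef k hk]).unique hsum
  have hint : ∫ u in unitCube d, f u = ((volume.restrict (unitCube d)).real S : ℂ) := by
    rw [hf, integral_indicator hSm, setIntegral_const]; simp
  have hc0 : cubeCoeff f 0 = ((volume.restrict (unitCube d)).real S : ℂ) := by
    simp_rw [cubeCoeff, latticeChar_zero, one_mul]
    exact hint
  have hsq : ∫ u in unitCube d, star (f u) * f u = ((volume.restrict (unitCube d)).real S : ℂ) := by
    rw [← hint]
    refine integral_congr_ae (Eventually.of_forall fun u => ?_)
    by_cases hu : u ∈ S <;> simp [hf, hu]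
  rw [hsq, hc0] at hsum0
  have h5 : (volume.restrict (unitCube d)).real S * (volume.restrict (unitCube d)).real S =
      (volume.restrict (unitCube d)).real S := by
    have : star (((volume.restrict (unitCube d)).real S : ℂ)) =
      ((volume.restrict (unitCube d)).real S : ℂ) := Complex.conj_ofReal _
    rw [this] at hsum0
    exact_mod_cast hsum0
  have h6 : (volume.restrict (unitCube d)).real S = 0 ∨
      (volume.restrict (unitCube d)).real S = 1 := by
    by_cases h0 : (volume.restrict (unitCube d)).real S = 0
    · exact Or.inl h0
    · exact Or.inr (mul_left_cancel₀ h0 (h5.trans (mul_one _).symm))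
  rcases h6 with h6 | h6
  · left
    rw [hlaw]
    exact (measureReal_eq_zero_iff).1 h6
  · right
    rw [prob_compl_eq_zero_iff hA, hlaw]
    rw [measureReal_def, ENNReal.toReal_eq_one_iff] at h6
    exact h6

end ModelSet

/-! ### Correlations of the process -/

section Correlation

variable {d : ℕ} {ξ : Measure ((Fin d → ℤ) → Bool)} [IsProbabilityMeasure ξ]

/-- The value of the process at `k` as a real number. -/
def siteValue (k : Fin d → ℤ) (x : (Fin d → ℤ) → Bool) : ℝ := ((x k).toNat : ℝ)

theorem measurable_siteValue (k : Fin d → ℤ) : Measurable (siteValue k) :=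
  (Measurable.of_discrete (f := fun b : Bool => (b.toNat : ℝ))).comp (measurable_pi_apply k)

theorem siteValue_nonneg (k : Fin d → ℤ) (x) : 0 ≤ siteValue k x := Nat.cast_nonneg _

theorem siteValue_le_one (k : Fin d → ℤ) (x) : siteValue k x ≤ 1 := by
  unfold siteValue
  exact_mod_cast Bool.toNat_le _

/-- The correlations `E X_0 X_k` of a process with law `ξ`. -/
noncomputable def correlation (ξ : Measure ((Fin d → ℤ) → Bool)) (k : Fin d → ℤ) : ℝ :=
  ∫ x, siteValue 0 x * siteValue k x ∂ξ

theorem integrable_siteValue_mul (j k : Fin d → ℤ) :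
    Integrable (fun x => siteValue j x * siteValue k x) ξ := by
  refine Integrable.of_bound ((measurable_siteValue j).mul
    (measurable_siteValue k)).aestronglyMeasurable 1 (Eventually.of_forall fun x => ?_)
  rw [norm_mul, Real.norm_of_nonneg (siteValue_nonneg _ _),
    Real.norm_of_nonneg (siteValue_nonneg _ _)]
  exact mul_le_one₀ (siteValue_le_one _ _) (siteValue_nonneg _ _) (siteValue_le_one _ _)

theorem integral_siteValue_mul (hs : StationaryUnder shift ξ) (j l : Fin d → ℤ) :
    ∫ x, siteValue j x * siteValue l x ∂ξ = correlation ξ (l - j) := by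
  have hm : Measurable fun x : (Fin d → ℤ) → Bool => siteValue 0 x * siteValue (l - j) x :=
    (measurable_siteValue 0).mul (measurable_siteValue (l - j))
  have := integral_map (hs j).aemeasurable (f := fun x => siteValue 0 x * siteValue (l - j) x)
    hm.aestronglyMeasurable
  rw [(hs j).map_eq] at this
  rw [correlation, this]
  simp [siteValue, shift]

theorem correlation_neg (hs : StationaryUnder shift ξ) (k : Fin d → ℤ) :
    correlation ξ (-k) = correlation ξ k := by
  rw [← zero_sub k, ← integral_siteValue_mul hs k 0, correlation]
  simp_rw [mul_comm]

theorem correlation_nonneg (k : Fin d → ℤ) : 0 ≤ correlation ξ k :=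
  integral_nonneg fun _ => mul_nonneg (siteValue_nonneg _ _) (siteValue_nonneg _ _)

/-- The site values are `0` or `1`, so `X_0 = X_0²` dominates `X_0 X_k`. -/
theorem correlation_le (k : Fin d → ℤ) : correlation ξ k ≤ correlation ξ 0 := by
  refine integral_mono (integrable_siteValue_mul 0 k) (integrable_siteValue_mul 0 0) fun x => ?_
  have h1 := siteValue_nonneg 0 x
  have : siteValue 0 x = siteValue 0 x * siteValue 0 x := by
    unfold siteValue
    cases x 0 <;> simp
  change siteValue 0 x * siteValue k x ≤ siteValue 0 x * siteValue 0 x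
  rw [← this]
  exact mul_le_of_le_one_right h1 (siteValue_le_one k x)

end Correlation

/-! ### Existence of the spectral measure -/

section Herglotz

attribute [local instance] instMeasureSpaceUnitAddCircle

instance isProbabilityMeasure_unitAddCircle :
    IsProbabilityMeasure (volume : Measure UnitAddCircle) :=
  inferInstanceAs (IsProbabilityMeasure AddCircle.haarAddCircle)

variable {d : ℕ} {ξ : Measure ((Fin d → ℤ) → Bool)} [IsProbabilityMeasure ξ]

theorem integral_mFourier (n : Fin d → ℤ) :
    ∫ θ, UnitAddTorus.mFourier n θ = if n = 0 then 1 else 0 := by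
  have h := orthonormal_iff_ite.1 (UnitAddTorus.orthonormal_mFourier (d := Fin d)) 0 n
  simp only [ContinuousMap.inner_toLp, ← UnitAddTorus.mFourier_neg, ← UnitAddTorus.mFourier_add,
    neg_zero, add_zero] at h
  rw [h]
  simp only [eq_comm]

/-- The trigonometric polynomial `∑_{k, l ∈ B} E X_k X_l e_{k - l}`. -/
noncomputable def fejer (ξ : Measure ((Fin d → ℤ) → Bool)) (B : Finset (Fin d → ℤ))
    (θ : UnitAddTorus (Fin d)) : ℂ :=
  ∑ k ∈ B, ∑ l ∈ B, (correlation ξ (l - k) : ℂ) * UnitAddTorus.mFourier (k - l) θ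

theorem continuous_fejer (B : Finset (Fin d → ℤ)) : Continuous (fejer ξ B) := by
  unfold fejer
  fun_prop

/-- Expanding the square of a random trigonometric polynomial and taking means shows that the Fejér
polynomial is real and nonnegative, so that it can serve as a density. -/
theorem fejer_eq (hs : StationaryUnder shift ξ) (B : Finset (Fin d → ℤ))
    (θ : UnitAddTorus (Fin d)) : fejer ξ B θ =
      ((∫ x, ‖∑ k ∈ B, (siteValue k x : ℂ) * UnitAddTorus.mFourier k θ‖ ^ 2 ∂ξ : ℝ) : ℂ) := by
  have h1 : ∀ x : (Fin d → ℤ) → Bool,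
      ((‖∑ k ∈ B, (siteValue k x : ℂ) * UnitAddTorus.mFourier k θ‖ ^ 2 : ℝ) : ℂ) =
      ∑ k ∈ B, ∑ l ∈ B, ((siteValue k x * siteValue l x : ℝ) : ℂ) *
        UnitAddTorus.mFourier (k - l) θ := by
    intro x
    rw [Complex.ofReal_pow, ← Complex.mul_conj', map_sum, Finset.sum_mul_sum]
    refine Finset.sum_congr rfl fun k _ => Finset.sum_congr rfl fun l _ => ?_
    rw [map_mul, Complex.conj_ofReal, ← UnitAddTorus.mFourier_neg, sub_eq_add_neg,
      UnitAddTorus.mFourier_add]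
    push_cast
    ring
  have hint : ∀ k l : Fin d → ℤ, Integrable (fun x =>
      ((siteValue k x * siteValue l x : ℝ) : ℂ) * UnitAddTorus.mFourier (k - l) θ) ξ :=
    fun k l => (integrable_siteValue_mul k l).ofReal.mul_const _
  rw [← integral_complex_ofReal, integral_congr_ae (Eventually.of_forall h1),
    integral_finsetSum _ fun k _ => integrable_finsetSum _ fun l _ => hint k l, fejer]
  refine Finset.sum_congr rfl fun k _ => ?_
  rw [integral_finsetSum _ fun l _ => hint k l]
  refine Finset.sum_congr rfl fun l _ => ?_
  rw [integral_mul_const, integral_complex_ofReal, integral_siteValue_mul hs]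

theorem integral_mFourier_mul_fejer (hs : StationaryUnder shift ξ) (B : Finset (Fin d → ℤ))
    (j : Fin d → ℤ) : ∫ θ, UnitAddTorus.mFourier (-j) θ * fejer ξ B θ =
      (correlation ξ j : ℂ) * ((B.filter fun l => l + j ∈ B).card : ℂ) := by
  have h1 : ∀ θ, UnitAddTorus.mFourier (-j) θ * fejer ξ B θ = ∑ l ∈ B, ∑ k ∈ B,
      (correlation ξ (l - k) : ℂ) * UnitAddTorus.mFourier (-j + (k - l)) θ := by
    intro θ
    rw [fejer, Finset.sum_comm, Finset.mul_sum]
    refine Finset.sum_congr rfl fun k _ => ?_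
    rw [Finset.mul_sum]
    refine Finset.sum_congr rfl fun l _ => ?_
    rw [UnitAddTorus.mFourier_add]
    ring
  have hint : ∀ k l : Fin d → ℤ, Integrable (fun θ : UnitAddTorus (Fin d) =>
      (correlation ξ (l - k) : ℂ) * UnitAddTorus.mFourier (-j + (k - l)) θ) := by
    intro k l
    refine Continuous.integrable_of_hasCompactSupport (by fun_prop) ?_
    exact HasCompactSupport.of_compactSpace _
  simp_rw [h1]
  rw [integral_finsetSum _ fun l _ => integrable_finsetSum _ fun k _ => hint k l,
    Finset.card_filter, Nat.cast_sum, Finset.mul_sum]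
  refine Finset.sum_congr rfl fun l _ => ?_
  rw [integral_finsetSum _ fun k _ => hint k l]
  simp_rw [integral_const_mul, integral_mFourier]
  have h2 : ∀ k, -j + (k - l) = 0 ↔ k = l + j := by
    intro k
    rw [neg_add_eq_zero, eq_sub_iff_add_eq, eq_comm, add_comm]
  simp_rw [h2, mul_ite, mul_one, mul_zero, Finset.sum_ite_eq']
  rw [← correlation_neg hs j]
  split_ifs <;> simp

/-- The cubes `{0, …, N - 1}^d`. -/
noncomputable def latticeBox (d N : ℕ) : Finset (Fin d → ℤ) := Fintype.piFinset fun _ => Finset.Ico 0 (N : ℤ)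

theorem card_latticeBox (N : ℕ) : (latticeBox d N).card = N ^ d := by
  simp [latticeBox]

theorem tendsto_card_latticeBox (j : Fin d → ℤ) : Tendsto (fun N : ℕ =>
    (((latticeBox d N).filter fun l => l + j ∈ latticeBox d N).card : ℝ) / (latticeBox d N).card)
    atTop (𝓝 1) := by
  have h1 : ∀ N : ℕ, ((latticeBox d N).filter fun l => l + j ∈ latticeBox d N) =
      Fintype.piFinset fun i => Finset.Ico (max 0 (-j i)) (min (N : ℤ) (N - j i)) := by
    intro N
    ext l
    simp only [latticeBox, Finset.mem_filter, Fintype.mem_piFinset, Finset.mem_Ico, Pi.add_apply,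
      max_le_iff, lt_min_iff, ← forall_and]
    refine forall_congr' fun i => ?_
    omega
  have h2 : ∀ᶠ N : ℕ in atTop, ∏ i, (1 - (|j i| : ℤ) / (N : ℝ)) =
      (((latticeBox d N).filter fun l => l + j ∈ latticeBox d N).card : ℝ) /
        (latticeBox d N).card := by
    have h3 : ∀ᶠ N : ℕ in atTop, ∀ i, |j i| ≤ (N : ℤ) := by
      refine eventually_all.2 fun i => ?_
      filter_upwards [eventually_ge_atTop (j i).natAbs] with N hN
      rw [Int.abs_eq_natAbs]
      exact_mod_cast hN
    filter_upwards [h3, eventually_gt_atTop 0] with N hN hN0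
    rw [h1, Fintype.card_piFinset, card_latticeBox, Nat.cast_prod]
    have h4 : ((N ^ d : ℕ) : ℝ) = ∏ _i : Fin d, (N : ℝ) := by simp
    rw [h4, ← Finset.prod_div_distrib]
    refine Finset.prod_congr rfl fun i _ => ?_
    have h5 : ((Finset.Ico (max 0 (-j i)) (min (N : ℤ) (N - j i))).card : ℤ) = N - |j i| := by
      rw [Int.card_Ico]
      have := hN i
      rcases abs_cases (j i) with ⟨h, _⟩ | ⟨h, _⟩ <;> omega
    have h6 : ((Finset.Ico (max 0 (-j i)) (min (N : ℤ) (N - j i))).card : ℝ) =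
        N - (|j i| : ℤ) := by exact_mod_cast congrArg (Int.cast : ℤ → ℝ) h5
    have hN' : (N : ℝ) ≠ 0 := by exact_mod_cast hN0.ne'
    rw [h6, sub_div, div_self hN']
  refine Tendsto.congr' h2 ?_
  have h7 : (1 : ℝ) = ∏ _i : Fin d, (1 - 0 : ℝ) := by simp
  have h8 : Tendsto (fun N : ℕ => ∏ i, (1 - (|j i| : ℤ) / (N : ℝ))) atTop
      (𝓝 (∏ _i : Fin d, (1 - 0 : ℝ))) :=
    tendsto_finsetProd _ fun i _ =>
      tendsto_const_nhds.sub (tendsto_const_div_atTop_nhds_zero_nat _)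
  rwa [← h7] at h8

/-- A stationary process has a spectral measure. -/
theorem exists_spectral_measure (hs : StationaryUnder shift ξ) :
    ∃ μ : Measure (EuclideanSpace ℝ (Fin d)), IsFiniteMeasure μ ∧
      ∀ k, fourierCoef μ k = (correlation ξ k : ℂ) := by
  -- The densities below are normalised by `E X_0 X_0`. If this is zero, all correlations vanish and
  -- the zero measure will do.
  rcases (correlation_nonneg (ξ := ξ) 0).eq_or_lt with h0 | h0
  · refine ⟨0, inferInstance, fun k => ?_⟩
    have : correlation ξ k = 0 :=
      le_antisymm ((correlation_le k).trans h0.symm.le) (correlation_nonneg k)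
    rw [this, fourierCoef, integral_zero_measure, Complex.ofReal_zero]
  set p : ℝ := correlation ξ 0
  -- The normalisation gives total mass one; `N + 1` avoids the empty box. The coefficient of index
  -- `j` is the correlation over `p`, times the proportion of sites of the box that stay in it when
  -- moved by `j`, which tends to one.
  set ρ : ℕ → UnitAddTorus (Fin d) → ℝ := fun N θ =>
    (fejer ξ (latticeBox d (N + 1)) θ).re / (p * (latticeBox d (N + 1)).card) with hρ
  have hcard : ∀ N : ℕ, (0 : ℝ) < (latticeBox d (N + 1)).card := fun N => by
    rw [card_latticeBox]; positivity
  have hre : ∀ B θ, (((fejer ξ B θ).re : ℝ) : ℂ) = fejer ξ B θ := fun B θ => by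
    rw [fejer_eq hs, Complex.ofReal_re]
  have hρ0 : ∀ N θ, 0 ≤ ρ N θ := by
    intro N θ
    refine div_nonneg ?_ (mul_nonneg h0.le (hcard N).le)
    rw [fejer_eq hs, Complex.ofReal_re]
    exact integral_nonneg fun x => sq_nonneg _
  have hρc : ∀ N, Continuous (ρ N) := fun N =>
    (Complex.continuous_re.comp (continuous_fejer _)).div_const _
  have hint : ∀ N (f : UnitAddTorus (Fin d) → ℂ), ∫ θ, f θ ∂(volume.withDensity fun θ =>
      ENNReal.ofReal (ρ N θ)) = ∫ θ, (ρ N θ : ℂ) * f θ := by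
    intro N f
    rw [integral_withDensity_eq_integral_toReal_smul (f := fun θ => ENNReal.ofReal (ρ N θ))
      (ENNReal.continuous_ofReal.comp (hρc N)).measurable
      (Eventually.of_forall fun θ => ENNReal.ofReal_lt_top)]
    refine integral_congr_ae (Eventually.of_forall fun θ => ?_)
    change (ENNReal.ofReal (ρ N θ)).toReal • f θ = _
    rw [ENNReal.toReal_ofReal (hρ0 N θ), Complex.real_smul]
  have hfour : ∀ N (j : Fin d → ℤ), ∫ θ, UnitAddTorus.mFourier (-j) θ ∂(volume.withDensity fun θ =>
      ENNReal.ofReal (ρ N θ)) = ((correlation ξ j / p *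
        ((((latticeBox d (N + 1)).filter fun l => l + j ∈ latticeBox d (N + 1)).card : ℝ) /
        (latticeBox d (N + 1)).card) : ℝ) : ℂ) := by
    intro N j
    rw [hint]
    have h2 : ∀ θ, (ρ N θ : ℂ) * UnitAddTorus.mFourier (-j) θ =
        ((p * (latticeBox d (N + 1)).card : ℝ) : ℂ)⁻¹ *
          (UnitAddTorus.mFourier (-j) θ * fejer ξ (latticeBox d (N + 1)) θ) := by
      intro θ
      rw [hρ, Complex.ofReal_div, hre]
      ring
    simp_rw [h2]
    rw [integral_const_mul, integral_mFourier_mul_fejer hs]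
    have h3 : (p : ℂ) ≠ 0 := by exact_mod_cast h0.ne'
    have h4 : ((latticeBox d (N + 1)).card : ℂ) ≠ 0 := by exact_mod_cast (hcard N).ne'
    push_cast
    field_simp
  have hprob : ∀ N, IsProbabilityMeasure ((volume : Measure (UnitAddTorus (Fin d))).withDensity
      fun θ => ENNReal.ofReal (ρ N θ)) := by
    intro N
    have h1 := hfour N 0
    have hp : p ≠ 0 := h0.ne'
    have h5 : ∫ θ, ρ N θ = 1 := by
      have h6 := hint N (fun _ => 1)
      simp only [neg_zero, UnitAddTorus.mFourier_zero, ContinuousMap.one_apply] at h1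
      rw [h1] at h6
      simp only [add_zero, Finset.filter_mem_eq_inter, Finset.inter_self, mul_one] at h6
      rw [div_self (hcard N).ne', mul_one, div_self hp, integral_complex_ofReal] at h6
      exact_mod_cast h6.symm
    constructor
    rw [withDensity_apply _ MeasurableSet.univ, Measure.restrict_univ,
      ← ofReal_integral_eq_lintegral_ofReal _ (Eventually.of_forall (hρ0 N)), h5, ENNReal.ofReal_one]
    exact (hρc N).integrable_of_hasCompactSupport (HasCompactSupport.of_compactSpace _)
  set ν : ℕ → ProbabilityMeasure (UnitAddTorus (Fin d)) := fun N => ⟨_, hprob N⟩ with hν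
  -- The probability measures on the compact torus form a compact space, so the limit along an
  -- ultrafilter exists and no subsequence has to be extracted.
  set m := (Ultrafilter.map ν (hyperfilter ℕ)).lim
  have hlim : Tendsto ν (hyperfilter ℕ) (𝓝 m) := (Ultrafilter.map ν (hyperfilter ℕ)).le_nhds_lim
  have hchar : ∀ j, ∫ θ, UnitAddTorus.mFourier (-j) θ ∂(m : Measure (UnitAddTorus (Fin d))) =
      ((correlation ξ j / p : ℝ) : ℂ) := by
    intro j
    have h1 := (ProbabilityMeasure.tendsto_iff_forall_integral_rclike_tendsto ℂ).1 hlim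
      (BoundedContinuousFunction.mkOfCompact (UnitAddTorus.mFourier (-j)))
    have h2 : Tendsto (fun N : ℕ => ((correlation ξ j / p *
        ((((latticeBox d (N + 1)).filter fun l => l + j ∈ latticeBox d (N + 1)).card : ℝ) /
        (latticeBox d (N + 1)).card) : ℝ) : ℂ)) atTop (𝓝 ((correlation ξ j / p * 1 : ℝ) : ℂ)) :=
      (Complex.continuous_ofReal.tendsto _).comp
        (((tendsto_card_latticeBox j).comp (tendsto_add_atTop_nat 1)).const_mul _)
    rw [mul_one] at h2
    refine tendsto_nhds_unique h1 ?_
    refine (h2.mono_left Nat.hyperfilter_le_atTop).congr fun N => ?_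
    exact (hfour N j).symm
  refine ⟨ENNReal.ofReal p • (m : Measure (UnitAddTorus (Fin d))).map cubeSection, ?_, fun k => ?_⟩
  · have : IsProbabilityMeasure ((m : Measure (UnitAddTorus (Fin d))).map cubeSection) :=
      Measure.isProbabilityMeasure_map measurable_cubeSection.aemeasurable
    exact Measure.smul_finite _ ENNReal.ofReal_ne_top
  · have h1 : fourierCoef (ENNReal.ofReal p • (m : Measure (UnitAddTorus (Fin d))).map cubeSection) k
        = ∫ x, latticeChar k x ∂(ENNReal.ofReal p •
          (m : Measure (UnitAddTorus (Fin d))).map cubeSection) := rfl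
    rw [h1, integral_smul_measure, integral_map measurable_cubeSection.aemeasurable
      (continuous_latticeChar k).aestronglyMeasurable]
    simp_rw [latticeChar_cubeSection]
    rw [hchar, ENNReal.toReal_ofReal h0.le, Complex.real_smul, ← Complex.ofReal_mul,
      mul_div_cancel₀ _ h0.ne']

end Herglotz

/-! ### Maximal inequalities -/

section Maximal

variable {V : Type*} [NormedAddCommGroup V] [NormedSpace ℝ V] [FiniteDimensional ℝ V]
  [MeasureSpace V] [BorelSpace V] [(volume : Measure V).IsAddHaarMeasure]

theorem volume_closedBall_mul (x : V) {r s : ℝ} (hr : 0 ≤ r) (hs : 0 ≤ s) :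
    volume (Metric.closedBall x (s * r)) =
      ENNReal.ofReal (s ^ Module.finrank ℝ V) * volume (Metric.closedBall x r) := by
  rw [Measure.addHaar_closedBall _ _ (mul_nonneg hs hr), Measure.addHaar_closedBall _ _ hr,
    mul_pow, ENNReal.ofReal_mul (pow_nonneg hs _), mul_assoc]

/-- The maximal inequality of Hardy and Littlewood, for balls of bounded radius. -/
theorem mul_volume_le_of_forall_ball {f : V → ℝ≥0∞} {c : ℝ≥0∞} {S : Set V} {M N : ℝ}
    (hS : S ⊆ Metric.closedBall 0 M)
    (h : ∀ x ∈ S, ∃ r, 0 < r ∧ r ≤ N ∧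
      c * volume (Metric.closedBall x r) ≤ ∫⁻ t in Metric.closedBall x r, f t) :
    c * volume S ≤ ENNReal.ofReal (5 ^ Module.finrank ℝ V) *
      ∫⁻ t in Metric.closedBall 0 (M + N), f t := by
  have h' : ∀ x, ∃ r, x ∈ S → 0 < r ∧ r ≤ N ∧
      c * volume (Metric.closedBall x r) ≤ ∫⁻ t in Metric.closedBall x r, f t := fun x => by
    by_cases hx : x ∈ S
    · obtain ⟨r, hr⟩ := h x hx
      exact ⟨r, fun _ => hr⟩
    · exact ⟨0, fun h => absurd h hx⟩
  choose r hr using h'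
  obtain ⟨u, huS, hdisj, hcov⟩ := Vitali.exists_disjoint_subfamily_covering_enlargement_closedBall
    S id r N (fun x hx => (hr x hx).2.1) 5 (by norm_num)
  have hu : u.Countable := by
    refine hdisj.countable_of_nonempty_interior fun x hx => ?_
    exact ⟨x, Metric.ball_subset_interior_closedBall (Metric.mem_ball_self (hr x (huS hx)).1)⟩
  have hsub : S ⊆ ⋃ b ∈ u, Metric.closedBall b (5 * r b) := by
    intro x hx
    obtain ⟨b, hb, hxb⟩ := hcov x hx
    exact Set.mem_biUnion hb (hxb (Metric.mem_closedBall_self (hr x hx).1.le))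
  have hvol : volume S ≤ ENNReal.ofReal (5 ^ Module.finrank ℝ V) *
      ∑' b : u, volume (Metric.closedBall (b : V) (r b)) := by
    refine (measure_mono hsub).trans ((measure_biUnion_le _ hu _).trans ?_)
    rw [← ENNReal.tsum_mul_left]
    refine ENNReal.tsum_le_tsum fun b => ?_
    rw [volume_closedBall_mul _ (hr b (huS b.2)).1.le (by norm_num)]
  calc c * volume S ≤ c * (ENNReal.ofReal (5 ^ Module.finrank ℝ V) *
      ∑' b : u, volume (Metric.closedBall (b : V) (r b))) := by gcongr
    _ = ENNReal.ofReal (5 ^ Module.finrank ℝ V) *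
      ∑' b : u, c * volume (Metric.closedBall (b : V) (r b)) := by
        rw [ENNReal.tsum_mul_left]; ring
    _ ≤ ENNReal.ofReal (5 ^ Module.finrank ℝ V) *
      ∑' b : u, ∫⁻ t in Metric.closedBall (b : V) (r b), f t := by
        gcongr with b
        exact (hr b (huS b.2)).2.2
    _ = ENNReal.ofReal (5 ^ Module.finrank ℝ V) *
      ∫⁻ t in ⋃ b ∈ u, Metric.closedBall (b : V) (r b), f t := by
        rw [lintegral_biUnion (t := u) (s := fun b => Metric.closedBall b (r b)) hu
          (fun b _ => Metric.isClosed_closedBall.measurableSet) hdisj]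
    _ ≤ _ := by
        gcongr
        refine Set.iUnion₂_subset fun b hb x hx => ?_
        rw [mem_closedBall_zero_iff]
        have h1 := mem_closedBall_zero_iff.1 (hS (huS hb))
        have h2 := mem_closedBall_iff_norm.1 hx
        have h3 := norm_add_le b (x - b)
        rw [add_sub_cancel] at h3
        linarith [(hr b (huS hb)).2.1]

theorem volumeReal_closedBall (x : V) {r : ℝ} (hr : 0 ≤ r) :
    volume.real (Metric.closedBall x r) =
      r ^ Module.finrank ℝ V * volume.real (Metric.ball (0 : V) 1) :=
  Measure.addHaar_real_closedBall _ _ hr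

theorem volumeReal_unitBall_pos : 0 < volume.real (Metric.ball (0 : V) 1) :=
  ENNReal.toReal_pos (Metric.measure_ball_pos _ _ one_pos).ne' measure_ball_lt_top.ne

/-- Shells of fixed thickness are negligible in large balls. This Følner property drives the
transference to orbits, the vanishing of averages of coboundaries and all later boundary estimates.
-/
theorem tendsto_volumeReal_ball_div (a : ℝ) : Tendsto (fun r : ℝ =>
    volume.real (Metric.closedBall (0 : V) (r + a)) / volume.real (Metric.closedBall (0 : V) r))
    atTop (𝓝 1) := by
  have h1 : Tendsto (fun r : ℝ => (1 + a / r) ^ Module.finrank ℝ V) atTop (𝓝 1) := by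
    have := ((tendsto_const_nhds (x := a)).div_atTop tendsto_id).const_add (1 : ℝ)
    simpa using this.pow (Module.finrank ℝ V)
  refine h1.congr' ?_
  filter_upwards [eventually_gt_atTop 0, eventually_ge_atTop (-a)] with r hr hra
  rw [volumeReal_closedBall _ hr.le, volumeReal_closedBall _ (by linarith),
    mul_div_mul_right _ _ volumeReal_unitBall_pos.ne', ← div_pow]
  congr 1
  field_simp

variable {α : Type*} [MeasurableSpace α] {T : V → α → α} {m : Measure α} [IsProbabilityMeasure m]

namespace MeasurableFlow

theorem measurable_orbit (h : MeasurableFlow T m) (y : α) : Measurable fun t => T t y :=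
  h.measurable.comp measurable_prodMk_right

theorem lintegral_orbit (h : MeasurableFlow T m) {f : α → ℝ≥0∞} (hf : Measurable f) (B : Set V) :
    ∫⁻ y, (∫⁻ t in B, f (T t y)) ∂m = volume B * ∫⁻ y, f y ∂m := by
  have hm : Measurable fun q : α × V => f (T q.2 q.1) := hf.comp (h.measurable.comp measurable_swap)
  rw [lintegral_lintegral_swap (μ := m) (ν := volume.restrict B) (f := fun y t => f (T t y))
    hm.aemeasurable]
  simp_rw [fun t => (h.measurePreserving t).lintegral_comp hf]
  rw [setLIntegral_const, mul_comm]

theorem measurable_lintegral_orbit (h : MeasurableFlow T m) {f : α → ℝ≥0∞} (hf : Measurable f)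
    (B : Set V) : Measurable fun y => ∫⁻ t in B, f (T t y) := by
  have hm : Measurable fun q : α × V => f (T q.2 q.1) := hf.comp (h.measurable.comp measurable_swap)
  exact hm.lintegral_prod_right'

theorem lintegral_ball_orbit (h : MeasurableFlow T m) (f : α → ℝ≥0∞)
    (x : V) (r : ℝ) (y : α) : ∫⁻ t in Metric.closedBall 0 r, f (T t (T x y)) =
      ∫⁻ t in Metric.closedBall x r, f (T t y) := by
  simp_rw [← h.add_apply]
  rw [← lintegral_indicator Metric.isClosed_closedBall.measurableSet,
    ← lintegral_indicator Metric.isClosed_closedBall.measurableSet,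
    ← lintegral_add_right_eq_self ((Metric.closedBall x r).indicator _) x]
  refine lintegral_congr fun t => ?_
  have : t + x ∈ Metric.closedBall x r ↔ t ∈ Metric.closedBall 0 r := by
    rw [mem_closedBall_iff_norm, mem_closedBall_zero_iff, add_sub_cancel_right]
  by_cases ht : t ∈ Metric.closedBall 0 r
  · rw [Set.indicator_of_mem ht, Set.indicator_of_mem (this.2 ht)]
  · rw [Set.indicator_of_notMem ht, Set.indicator_of_notMem (mt this.1 ht)]

/-- The maximal ergodic inequality. -/
theorem mul_measure_exists_le (h : MeasurableFlow T m) {f : α → ℝ≥0∞} (hf : Measurable f)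
    {c : ℝ≥0∞} (hc : c ≠ ∞) :
    c * m {y | ∃ n : ℕ, 0 < n ∧ c * volume (Metric.closedBall (0 : V) n) ≤
      ∫⁻ t in Metric.closedBall (0 : V) n, f (T t y)} ≤
      ENNReal.ofReal (5 ^ Module.finrank ℝ V) * ∫⁻ y, f y ∂m := by
  set C := ENNReal.ofReal (5 ^ Module.finrank ℝ V)
  set Y : ℕ → Set α := fun N => {y | ∃ n : ℕ, (0 < n ∧ n ≤ N) ∧
    c * volume (Metric.closedBall (0 : V) n) ≤
      ∫⁻ t in Metric.closedBall (0 : V) n, f (T t y)} with hY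
  have hYm : ∀ N, MeasurableSet (Y N) := by
    intro N
    have : Y N = ⋃ n ∈ {n : ℕ | 0 < n ∧ n ≤ N}, {y | c * volume (Metric.closedBall (0 : V) n) ≤
      ∫⁻ t in Metric.closedBall (0 : V) n, f (T t y)} := by
      ext y; simp [hY]
    rw [this]
    exact MeasurableSet.biUnion (Set.to_countable _) fun n _ =>
      measurableSet_le measurable_const (h.measurable_lintegral_orbit hf _)
  have hU : {y | ∃ n : ℕ, 0 < n ∧ c * volume (Metric.closedBall (0 : V) n) ≤
      ∫⁻ t in Metric.closedBall (0 : V) n, f (T t y)} = ⋃ N, Y N := by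
    ext y
    simp only [hY, Set.mem_ofPred_eq, Set.mem_iUnion]
    constructor
    · rintro ⟨n, hn, h1⟩
      exact ⟨n, n, ⟨hn, le_rfl⟩, h1⟩
    · rintro ⟨N, n, ⟨hn, -⟩, h1⟩
      exact ⟨n, hn, h1⟩
  have hmono : Monotone Y := by
    rintro N N' hN y ⟨n, ⟨h1, h2⟩, h3⟩
    exact ⟨n, ⟨h1, h2.trans hN⟩, h3⟩
  suffices hfin : ∀ N, c * m (Y N) ≤ C * ∫⁻ y, f y ∂m by
    rw [hU, hmono.measure_iUnion, ENNReal.mul_iSup]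
    exact iSup_le hfin
  intro N
  by_cases hI : ∫⁻ y, f y ∂m = ∞
  · rw [hI, ENNReal.mul_top]
    · exact le_top
    · simp only [C, ne_eq, ENNReal.ofReal_eq_zero, not_le]; positivity
  -- Transference: for each `y` the inequality of Hardy and Littlewood is applied to `t ↦ f (T t y)`
  -- and to the times `t` in the ball of radius `M` with `T t y ∈ Y N`. Integration over `y` turns
  -- both sides into volumes of balls, and their ratio tends to one as `M → ∞`.
  have hM : ∀ M : ℝ, volume (Metric.closedBall (0 : V) M) * (c * m (Y N)) ≤
      volume (Metric.closedBall (0 : V) (M + N)) * (C * ∫⁻ y, f y ∂m) := by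
    intro M
    have h1 := h.lintegral_orbit (measurable_one.indicator (hYm N)) (Metric.closedBall (0 : V) M)
    have h2 : ∀ y, ∫⁻ t in Metric.closedBall (0 : V) M, (Y N).indicator (1 : α → ℝ≥0∞) (T t y) =
        volume (Metric.closedBall (0 : V) M ∩ {t | T t y ∈ Y N}) := by
      intro y
      have hm : MeasurableSet {t : V | T t y ∈ Y N} := h.measurable_orbit y (hYm N)
      rw [Set.inter_comm, ← Measure.restrict_apply hm, ← lintegral_indicator_one hm]
      rfl
    simp_rw [h2] at h1
    rw [lintegral_indicator_one (hYm N)] at h1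
    rw [mul_left_comm, ← h1, ← lintegral_const_mul' _ _ hc, mul_left_comm, ← h.lintegral_orbit hf,
      ← lintegral_const_mul' _ _ ENNReal.ofReal_ne_top]
    refine lintegral_mono fun y => ?_
    refine mul_volume_le_of_forall_ball Set.inter_subset_left ?_
    rintro x ⟨-, n, ⟨hn, hnN⟩, hx⟩
    refine ⟨n, by exact_mod_cast hn, by exact_mod_cast hnN, ?_⟩
    rw [h.lintegral_ball_orbit] at hx
    rwa [Measure.addHaar_closedBall_center]
  have hr : ∀ M : ℝ, c * m (Y N) ≠ ∞ := fun _ => ENNReal.mul_ne_top hc (measure_ne_top _ _)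
  have hCI : C * ∫⁻ y, f y ∂m ≠ ∞ := ENNReal.mul_ne_top ENNReal.ofReal_ne_top hI
  rw [← ENNReal.toReal_le_toReal (hr 0) hCI]
  have hreal : ∀ᶠ M : ℝ in atTop, (c * m (Y N)).toReal ≤
      volume.real (Metric.closedBall (0 : V) (M + N)) / volume.real (Metric.closedBall (0 : V) M) *
        (C * ∫⁻ y, f y ∂m).toReal := by
    filter_upwards [eventually_gt_atTop 0] with M hM0
    have h1 := ENNReal.toReal_mono (ENNReal.mul_ne_top measure_closedBall_lt_top.ne hCI) (hM M)
    rw [ENNReal.toReal_mul, ENNReal.toReal_mul (a := volume _)] at h1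
    have h2 : 0 < volume.real (Metric.closedBall (0 : V) M) := by
      rw [volumeReal_closedBall _ hM0.le]
      exact mul_pos (pow_pos hM0 _) volumeReal_unitBall_pos
    rw [div_mul_eq_mul_div, le_div_iff₀ h2, mul_comm]
    exact h1
  have hlim := (tendsto_volumeReal_ball_div (V := V) N).mul_const (C * ∫⁻ y, f y ∂m).toReal
  rw [one_mul] at hlim
  exact ge_of_tendsto hlim hreal

end MeasurableFlow

end Maximal

/-! ### Wiener's pointwise ergodic theorem -/

section Wiener

variable {V : Type*} [NormedAddCommGroup V] [NormedSpace ℝ V] [FiniteDimensional ℝ V]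
  [MeasureSpace V] [BorelSpace V] [(volume : Measure V).IsAddHaarMeasure]
  {α : Type*} [MeasurableSpace α] {T : V → α → α} {m : Measure α} [IsProbabilityMeasure m]

/-- The average of `f` over the part of the orbit of `y` that is indexed by the ball of radius
`r`. -/
noncomputable def ballAverage (T : V → α → α) (f : α → ℝ) (r : ℝ) (y : α) : ℝ :=
  (volume.real (Metric.closedBall (0 : V) r))⁻¹ * ∫ t in Metric.closedBall (0 : V) r, f (T t y)

theorem volumeReal_closedBall_pos {r : ℝ} (hr : 0 < r) :
    0 < volume.real (Metric.closedBall (0 : V) r) := by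
  rw [volumeReal_closedBall _ hr.le]
  exact mul_pos (pow_pos hr _) volumeReal_unitBall_pos

namespace MeasurableFlow

theorem ae_integrableOn (h : MeasurableFlow T m) {f : α → ℝ} (hf : Measurable f)
    (hi : Integrable f m) :
    ∀ᵐ y ∂m, ∀ n : ℕ, IntegrableOn (fun t => f (T t y)) (Metric.closedBall (0 : V) n) := by
  rw [ae_all_iff]
  intro n
  have h1 := h.lintegral_orbit hf.enorm (Metric.closedBall (0 : V) n)
  have h2 : ∫⁻ y, (∫⁻ t in Metric.closedBall (0 : V) n, ‖f (T t y)‖ₑ) ∂m ≠ ∞ := by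
    rw [h1]
    exact ENNReal.mul_ne_top measure_closedBall_lt_top.ne hi.2.ne
  filter_upwards [ae_lt_top (h.measurable_lintegral_orbit hf.enorm _) h2] with y hy
  exact ⟨(hf.comp (h.measurable_orbit y)).aestronglyMeasurable, hy⟩

theorem ballAverage_congr (h : MeasurableFlow T m) {f g : α → ℝ} (hfg : f =ᵐ[m] g) :
    ∀ᵐ y ∂m, ∀ r, ballAverage T f r y = ballAverage T g r y := by
  filter_upwards [h.ae_ae hfg] with y hy r
  rw [ballAverage, ballAverage, integral_congr_ae (ae_restrict_of_ae hy)]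

theorem integrable_coe (f : Lp ℝ 2 m) : Integrable f m :=
  (Lp.memLp f).integrable (by norm_num)

theorem measurable_coe (f : Lp ℝ 2 m) : Measurable f :=
  (Lp.stronglyMeasurable f).measurable

theorem ballAverage_add (h : MeasurableFlow T m) (f g : Lp ℝ 2 m) : ∀ᵐ y ∂m, ∀ n : ℕ,
    ballAverage T (f + g : Lp ℝ 2 m) n y = ballAverage T f n y + ballAverage T g n y := by
  filter_upwards [h.ballAverage_congr (Lp.coeFn_add f g),
    h.ae_integrableOn (measurable_coe f) (integrable_coe f),
    h.ae_integrableOn (measurable_coe g) (integrable_coe g)] with y h1 h2 h3 n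
  rw [h1, ballAverage, ballAverage, ballAverage, ← mul_add, ← integral_add (h2 n) (h3 n)]
  rfl

theorem ballAverage_smul (h : MeasurableFlow T m) (c : ℝ) (f : Lp ℝ 2 m) : ∀ᵐ y ∂m, ∀ r,
    ballAverage T (c • f : Lp ℝ 2 m) r y = c * ballAverage T f r y := by
  filter_upwards [h.ballAverage_congr (Lp.coeFn_smul c f)] with y h1 r
  rw [h1, ballAverage, ballAverage, mul_left_comm]
  congr 1
  exact integral_const_mul c _

/-- The averages of a coboundary converge to `0`. -/
theorem tendsto_ballAverage_coboundary (h : MeasurableFlow T m) {A : Set α} (hA : MeasurableSet A)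
    (x : V) (y : α) : Tendsto (fun r => ballAverage T (fun z => A.indicator (fun _ => (1 : ℝ)) z -
      (T x ⁻¹' A).indicator (fun _ => (1 : ℝ)) z) r y) atTop (𝓝 0) := by
  set S : Set V := {t | T t y ∈ A} with hS
  have hSm : MeasurableSet S := h.measurable_orbit y hA
  have hfin : ∀ r, volume (Metric.closedBall (0 : V) r) ≠ ∞ := fun r => measure_closedBall_lt_top.ne
  have hB : ∀ r, MeasurableSet (Metric.closedBall (0 : V) r) := fun r =>
    Metric.isClosed_closedBall.measurableSet
  have h1 : ∀ r, ∫ t in Metric.closedBall (0 : V) r, (A.indicator (fun _ => (1 : ℝ)) (T t y) -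
      (T x ⁻¹' A).indicator (fun _ => (1 : ℝ)) (T t y)) =
      volume.real (S ∩ Metric.closedBall 0 r) - volume.real (S ∩ Metric.closedBall x r) := by
    intro r
    have e1 : ∀ t, A.indicator (fun _ => (1 : ℝ)) (T t y) = S.indicator (fun _ => (1 : ℝ)) t :=
      fun t => rfl
    have e2 : ∀ t, (T x ⁻¹' A).indicator (fun _ => (1 : ℝ)) (T t y) =
        ((fun t => x + t) ⁻¹' S).indicator (fun _ => (1 : ℝ)) t := by
      intro t
      have : T t y ∈ T x ⁻¹' A ↔ t ∈ (fun t => x + t) ⁻¹' S := by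
        simp only [Set.mem_preimage, hS, Set.mem_ofPred_eq, h.add_apply]
      by_cases ht : t ∈ (fun t => x + t) ⁻¹' S
      · rw [Set.indicator_of_mem ht, Set.indicator_of_mem (this.2 ht)]
      · rw [Set.indicator_of_notMem ht, Set.indicator_of_notMem (mt this.1 ht)]
    have hSm' : MeasurableSet ((fun t => x + t) ⁻¹' S) := (measurable_const_add x) hSm
    simp_rw [e1, e2]
    have : IsFiniteMeasure (volume.restrict (Metric.closedBall (0 : V) r)) :=
      ⟨by rw [Measure.restrict_apply_univ]; exact measure_closedBall_lt_top⟩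
    have hi : ∀ {S : Set V}, MeasurableSet S →
        IntegrableOn (S.indicator (fun _ => (1 : ℝ))) (Metric.closedBall (0 : V) r) := fun hS =>
      ((integrable_const (μ := volume.restrict (Metric.closedBall (0 : V) r)) (1 : ℝ)).indicator hS)
    have hone : ∀ {S : Set V}, MeasurableSet S → ∫ t in Metric.closedBall (0 : V) r,
        S.indicator (fun _ => (1 : ℝ)) t = (volume.restrict (Metric.closedBall (0 : V) r)).real S :=
      fun hS => integral_indicator_one hS
    rw [integral_sub (hi hSm) (hi hSm'), hone hSm, hone hSm',
      measureReal_restrict_apply hSm, measureReal_restrict_apply hSm']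
    congr 1
    have hpre : (fun t => x + t) ⁻¹' S ∩ Metric.closedBall 0 r =
        (fun t => x + t) ⁻¹' (S ∩ Metric.closedBall x r) := by
      rw [Set.preimage_inter, preimage_add_closedBall, sub_self]
    rw [hpre, measureReal_def, measureReal_def, measure_preimage_add]
  set a := ‖x‖ with ha
  -- The two volumes are those of `S` in balls of radius `r` about `0` and `x`. Both balls lie
  -- between the concentric balls of radii `r - ‖x‖` and `r + ‖x‖`, so the difference is at most the
  -- volume of the shell.
  have h2 : ∀ᶠ r in atTop, |ballAverage T (fun z => A.indicator (fun _ => (1 : ℝ)) z -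
      (T x ⁻¹' A).indicator (fun _ => (1 : ℝ)) z) r y| ≤
      volume.real (Metric.closedBall (0 : V) (r + a)) / volume.real (Metric.closedBall (0 : V) r) -
      volume.real (Metric.closedBall (0 : V) (r + -a)) / volume.real (Metric.closedBall (0 : V) r)
      := by
    filter_upwards [eventually_gt_atTop 0] with r hr
    have hpos := volumeReal_closedBall_pos (V := V) hr
    rw [ballAverage, h1, abs_mul, abs_inv, abs_of_pos hpos, ← sub_div, inv_mul_eq_div]
    refine div_le_div_of_nonneg_right ?_ hpos.le
    have s1 : Metric.closedBall (0 : V) r ⊆ Metric.closedBall 0 (r + a) :=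
      Metric.closedBall_subset_closedBall (by linarith [norm_nonneg x])
    have s2 : Metric.closedBall x r ⊆ Metric.closedBall (0 : V) (r + a) :=
      Metric.closedBall_subset_closedBall' (by rw [dist_zero_right])
    have s3 : Metric.closedBall (0 : V) (r + -a) ⊆ Metric.closedBall 0 r :=
      Metric.closedBall_subset_closedBall (by linarith [norm_nonneg x])
    have s4 : Metric.closedBall (0 : V) (r + -a) ⊆ Metric.closedBall x r :=
      Metric.closedBall_subset_closedBall' (by rw [dist_zero_left]; linarith)
    have hf : ∀ r, volume (S ∩ Metric.closedBall 0 r) ≠ ∞ := fun r =>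
      measure_ne_top_of_subset Set.inter_subset_right (hfin r)
    have key : ∀ B : Set V, MeasurableSet B → Metric.closedBall (0 : V) (r + -a) ⊆ B →
        B ⊆ Metric.closedBall (0 : V) (r + a) →
        volume.real (S ∩ Metric.closedBall 0 (r + -a)) ≤ volume.real (S ∩ B) ∧
        volume.real (S ∩ B) ≤ volume.real (S ∩ Metric.closedBall 0 (r + a)) := by
      intro B hB hB1 hB2
      exact ⟨measureReal_mono (Set.inter_subset_inter_right _ hB1)
        (measure_ne_top_of_subset (Set.inter_subset_inter_right _ hB2) (hf _)),
        measureReal_mono (Set.inter_subset_inter_right _ hB2) (hf _)⟩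
    have k0 := key _ (hB r) s3 s1
    have kx := key _ Metric.isClosed_closedBall.measurableSet s4 s2
    have k1 : volume.real (S ∩ Metric.closedBall 0 (r + a)) -
        volume.real (S ∩ Metric.closedBall 0 (r + -a)) ≤
        volume.real (Metric.closedBall (0 : V) (r + a)) -
        volume.real (Metric.closedBall (0 : V) (r + -a)) := by
      have hsub := s3.trans s1
      rw [← measureReal_sdiff hsub (hB _) (hfin _), ← measureReal_sdiff
        (Set.inter_subset_inter_right _ hsub) (hSm.inter (hB _)) (hf _)]
      refine measureReal_mono ?_ (measure_ne_top_of_subset Set.sdiff_subset (hfin _))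
      rintro t ⟨⟨t1, t2⟩, t3⟩
      exact ⟨t2, fun t4 => t3 ⟨t1, t4⟩⟩
    rw [abs_le]
    constructor <;> linarith [k0.1, k0.2, kx.1, kx.2]
  have h3 := (tendsto_volumeReal_ball_div (V := V) a).sub (tendsto_volumeReal_ball_div (V := V) (-a))
  rw [sub_self] at h3
  exact squeeze_zero_norm' h2 h3

/-- The functions whose averages converge to `0` are closed in `L²`. -/
theorem tendsto_ballAverage_of_mem_closure (h : MeasurableFlow T m) {g : Lp ℝ 2 m}
    (hg : ∀ ε > 0, ∃ k : Lp ℝ 2 m, ‖g - k‖ < ε ∧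
      ∀ᵐ y ∂m, Tendsto (fun n : ℕ => ballAverage T k n y) atTop (𝓝 0)) :
    ∀ᵐ y ∂m, Tendsto (fun n : ℕ => ballAverage T g n y) atTop (𝓝 0) := by
  have key : ∀ δ : ℝ, 0 < δ → ∀ᵐ y ∂m, ∀ᶠ n : ℕ in atTop, |ballAverage T g n y| ≤ 2 * δ := by
    intro δ hδ
    set D := {y | ¬ ∀ᶠ n : ℕ in atTop, |ballAverage T g n y| ≤ 2 * δ}
    set C : ℝ := 5 ^ Module.finrank ℝ V
    -- Outside the maximal set of `|g - k|` at level `δ`, the averages of `g` are within `δ` of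
    -- those of `k`, which tend to zero. The maximal inequality and `‖g - k‖₁ ≤ ‖g - k‖₂ < ε` bound
    -- the exceptional set, and `ε` is arbitrary.
    have hbound : ∀ ε : ℝ, 0 < ε → ENNReal.ofReal δ * m D ≤ ENNReal.ofReal (C * ε) := by
      intro ε hε
      obtain ⟨k, hk, hk0⟩ := hg ε hε
      set f : α → ℝ≥0∞ := fun y => ‖(g - k : Lp ℝ 2 m) y‖ₑ with hf
      have hfm : Measurable f := (measurable_coe _).enorm
      have hf1 : ∫⁻ y, f y ∂m ≤ ENNReal.ofReal ε := by
        have h1 : eLpNorm (g - k : Lp ℝ 2 m) 1 m ≤ eLpNorm (g - k : Lp ℝ 2 m) 2 m :=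
          eLpNorm_le_eLpNorm_of_exponent_le (by norm_num) (Lp.aestronglyMeasurable _)
        rw [eLpNorm_one_eq_lintegral_enorm] at h1
        refine h1.trans ?_
        rw [← ENNReal.ofReal_toReal (Lp.eLpNorm_ne_top (g - k)), ← Lp.norm_def]
        exact ENNReal.ofReal_le_ofReal hk.le
      have hmax := h.mul_measure_exists_le hfm (c := ENNReal.ofReal δ) ENNReal.ofReal_ne_top
      set Y := {y | ∃ n : ℕ, 0 < n ∧ ENNReal.ofReal δ * volume (Metric.closedBall (0 : V) n) ≤
        ∫⁻ t in Metric.closedBall (0 : V) n, f (T t y)}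
      have hDY : ∀ᵐ y ∂m, y ∈ D → y ∈ Y := by
        have hadd := h.ballAverage_add k (g - k)
        rw [add_sub_cancel] at hadd
        filter_upwards [hk0, hadd] with y h1 h2 hyD
        by_contra hyY
        refine hyD ?_
        filter_upwards [(Metric.tendsto_nhds.1 h1) δ hδ, eventually_gt_atTop 0] with n hn hn0
        rw [h2 n]
        have h3 : ∫⁻ t in Metric.closedBall (0 : V) n, f (T t y) <
            ENNReal.ofReal δ * volume (Metric.closedBall (0 : V) n) := by
          by_contra h4
          exact hyY ⟨n, hn0, not_lt.1 h4⟩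
        have hpos := volumeReal_closedBall_pos (V := V) (r := n) (by exact_mod_cast hn0)
        have h4 : |ballAverage T (g - k : Lp ℝ 2 m) n y| ≤ δ := by
          rw [ballAverage, abs_mul, abs_inv, abs_of_pos hpos, inv_mul_le_iff₀ hpos]
          rw [← Real.norm_eq_abs]
          refine (norm_integral_le_lintegral_norm
            (fun t => (g - k : Lp ℝ 2 m) (T t y))).trans ?_
          simp_rw [ofReal_norm]
          refine ENNReal.toReal_le_of_le_ofReal (mul_nonneg hpos.le hδ.le) (h3.le.trans ?_)
          rw [mul_comm, ENNReal.ofReal_mul hpos.le, ofReal_measureReal measure_closedBall_lt_top.ne]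
        rw [Real.dist_eq, sub_zero] at hn
        linarith [abs_add_le (ballAverage T k n y) (ballAverage T (g - k : Lp ℝ 2 m) n y)]
      calc ENNReal.ofReal δ * m D ≤ ENNReal.ofReal δ * m Y := by
            exact mul_le_mul' le_rfl (measure_mono_ae hDY)
        _ ≤ ENNReal.ofReal C * ∫⁻ y, f y ∂m := hmax
        _ ≤ ENNReal.ofReal C * ENNReal.ofReal ε := by gcongr
        _ = ENNReal.ofReal (C * ε) := (ENNReal.ofReal_mul (by positivity)).symm
    have hlim : Tendsto (fun ε : ℝ => ENNReal.ofReal (C * ε)) (𝓝[>] 0) (𝓝 0) := by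
      have : Tendsto (fun ε : ℝ => C * ε) (𝓝[>] 0) (𝓝 0) := by
        have := (continuous_const_mul C).tendsto (0 : ℝ)
        rw [mul_zero] at this
        exact this.mono_left nhdsWithin_le_nhds
      simpa using ENNReal.tendsto_ofReal this
    have h0 : ENNReal.ofReal δ * m D ≤ 0 := ge_of_tendsto hlim
      (by filter_upwards [self_mem_nhdsWithin] with ε hε using hbound ε hε)
    rw [nonpos_iff_eq_zero, mul_eq_zero, or_iff_right (by simpa using hδ)] at h0
    exact h0
  have hall := ae_all_iff.2 fun j : ℕ => key (1 / (2 * ((j : ℝ) + 1))) (by positivity)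
  filter_upwards [hall] with y hy
  rw [Metric.tendsto_nhds]
  intro ε hε
  obtain ⟨j, hj⟩ := exists_nat_one_div_lt hε
  filter_upwards [hy j] with n hn
  rw [Real.dist_eq, sub_zero]
  refine (hn.trans_eq ?_).trans_lt hj
  field_simp

/-- The span of the coboundaries of events. -/
noncomputable def coboundaries (h : MeasurableFlow T m) : Submodule ℝ (Lp ℝ 2 m) :=
  Submodule.span ℝ {f | ∃ (A : Set α) (hA : MeasurableSet A) (x : V),
    f = indicatorConstLp 2 hA (measure_ne_top m A) (1 : ℝ) -
      h.koopman x (indicatorConstLp 2 hA (measure_ne_top m A) (1 : ℝ))}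

theorem tendsto_ballAverage_of_mem_coboundaries (h : MeasurableFlow T m) {f : Lp ℝ 2 m}
    (hf : f ∈ h.coboundaries) :
    ∀ᵐ y ∂m, Tendsto (fun n : ℕ => ballAverage T f n y) atTop (𝓝 0) := by
  induction hf using Submodule.span_induction with
  | mem f hf =>
    obtain ⟨A, hA, x, rfl⟩ := hf
    rw [koopman_indicatorConstLp]
    have hae : (indicatorConstLp 2 hA (measure_ne_top m A) (1 : ℝ) - indicatorConstLp 2
        (h.measurable_map x hA) (measure_ne_top m _) (1 : ℝ) : Lp ℝ 2 m) =ᵐ[m]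
        fun z => A.indicator (fun _ => (1 : ℝ)) z - (T x ⁻¹' A).indicator (fun _ => (1 : ℝ)) z := by
      have e1 : indicatorConstLp 2 hA (measure_ne_top m A) (1 : ℝ) =ᵐ[m] _ := indicatorConstLp_coeFn
      have e2 : indicatorConstLp 2 (h.measurable_map x hA) (measure_ne_top m _) (1 : ℝ) =ᵐ[m] _ :=
        indicatorConstLp_coeFn
      filter_upwards [Lp.coeFn_sub (indicatorConstLp 2 hA (measure_ne_top m A) (1 : ℝ))
        (indicatorConstLp 2 (h.measurable_map x hA) (measure_ne_top m _) (1 : ℝ)), e1, e2]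
        with z h1 h2 h3
      rw [h1, Pi.sub_apply, h2, h3]
    filter_upwards [h.ballAverage_congr hae] with y hy
    simp_rw [hy]
    exact (h.tendsto_ballAverage_coboundary hA x y).comp tendsto_natCast_atTop_atTop
  | zero =>
    filter_upwards [h.ballAverage_congr (Lp.coeFn_zero ℝ 2 m)] with y hy
    simp_rw [hy]
    simp [ballAverage]
  | add f g _ _ hf hg =>
    filter_upwards [hf, hg, h.ballAverage_add f g] with y h1 h2 h3
    simp_rw [h3]
    simpa using h1.add h2
  | smul c f _ hf =>
    filter_upwards [hf, h.ballAverage_smul c f] with y h1 h2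
    simp_rw [h2]
    simpa using h1.const_mul c

/-- By duality: a vector `w` orthogonal to the coboundaries has the same integral as `koopman x w`
over every event, so it is invariant, hence constant by ergodicity, hence orthogonal to `g`. -/
theorem mem_closure_coboundaries (h : MeasurableFlow T m) (he : ErgodicUnder T m) {g : Lp ℝ 2 m}
    (hg : inner ℝ (oneLp m) g = 0) : g ∈ h.coboundaries.topologicalClosure := by
  rw [← Submodule.orthogonal_orthogonal_eq_closure, Submodule.mem_orthogonal]
  intro w hw
  rw [Submodule.mem_orthogonal] at hw
  have hinv : ∀ x, h.koopman x w = w := by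
    intro x
    have h1 : ∀ A : Set α, MeasurableSet A → ∫ y in A, h.koopman x w y ∂m = ∫ y in A, w y ∂m := by
      intro A hA
      -- The coboundary of `A` for `-x` is the right one: applying the isometry `koopman x` to both
      -- entries of the inner product moves the translation from the indicator to `w`.
      have h2 := hw _ (Submodule.subset_span ⟨A, hA, -x, rfl⟩)
      rw [inner_sub_left, sub_eq_zero, L2.inner_indicatorConstLp_one] at h2
      rw [h2, ← LinearIsometry.inner_map_map (h.koopman x), ← koopman_add, add_neg_cancel,
        koopman_zero, L2.inner_indicatorConstLp_one]
    refine Lp.ext (ae_eq_of_forall_setIntegral_eq_of_sigmaFinite ?_ ?_ fun A hA _ => h1 A hA)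
    · exact fun _ _ _ => (integrable_coe _).integrableOn
    · exact fun _ _ _ => (integrable_coe _).integrableOn
  have hoo : inner ℝ (oneLp m) (oneLp m) = 1 := by
    rw [inner_oneLp, integral_congr_ae oneLp_ae_eq]; simp
  have hmem : w - inner ℝ (oneLp m) w • oneLp m ∈ fixedVectors h.koopman (oneLp m) ⊤ := by
    refine ⟨?_, fun x _ => ?_⟩
    · rw [inner_sub_right, inner_smul_right, hoo, mul_one, sub_self]
    · rw [map_sub, map_smul, koopman_oneLp, hinv]
  rw [h.fixedVectors_top he, Submodule.mem_bot, sub_eq_zero] at hmem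
  rw [hmem, inner_smul_left, hg, mul_zero]

/-- **Wiener's pointwise ergodic theorem** for bounded functions and balls of integer radius. -/
theorem tendsto_ballAverage (h : MeasurableFlow T m) (he : ErgodicUnder T m) {f : α → ℝ}
    (hf : Measurable f) {c : ℝ} (hc : ∀ y, |f y| ≤ c) :
    ∀ᵐ y ∂m, Tendsto (fun n : ℕ => ballAverage T f n y) atTop (𝓝 (∫ y, f y ∂m)) := by
  set I := ∫ y, f y ∂m
  have hfi : Integrable f m := Integrable.of_bound hf.aestronglyMeasurable c (Eventually.of_forall hc)
  have hmem : MemLp (fun y => f y - I) 2 m :=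
    (MemLp.of_bound hf.aestronglyMeasurable c (Eventually.of_forall hc)).sub (memLp_const I)
  set g := hmem.toLp _ with hg
  have hgae : g =ᵐ[m] fun y => f y - I := hmem.coeFn_toLp
  have hg0 : inner ℝ (oneLp m) g = 0 := by
    rw [inner_oneLp, integral_congr_ae hgae, integral_sub hfi (integrable_const _)]
    simp [I]
  have hlim := h.tendsto_ballAverage_of_mem_closure (g := g) fun ε hε => by
    have := h.mem_closure_coboundaries he hg0
    rw [← SetLike.mem_coe, Submodule.topologicalClosure_coe, Metric.mem_closure_iff] at this
    obtain ⟨k, hk, hgk⟩ := this ε hε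
    exact ⟨k, by rwa [← dist_eq_norm], h.tendsto_ballAverage_of_mem_coboundaries hk⟩
  filter_upwards [hlim, h.ballAverage_congr hgae, h.ae_integrableOn hf hfi] with y h1 h2 h3
  have h4 : ∀ᶠ n : ℕ in atTop, ballAverage T g n y + I = ballAverage T f n y := by
    filter_upwards [eventually_gt_atTop 0] with n hn
    have hpos := volumeReal_closedBall_pos (V := V) (r := n) (by exact_mod_cast hn)
    have : IsFiniteMeasure (volume.restrict (Metric.closedBall (0 : V) n)) :=
      ⟨by rw [Measure.restrict_apply_univ]; exact measure_closedBall_lt_top⟩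
    rw [h2, ballAverage, ballAverage, integral_sub (h3 n) (integrable_const _), integral_const,
      measureReal_restrict_apply MeasurableSet.univ, Set.univ_inter, smul_eq_mul]
    field_simp
    ring
  simpa using (h1.add_const I).congr' h4

end MeasurableFlow

end Wiener

/-! ### Lebesgue measure along two complementary subspaces -/

section Splitting

variable {V : Type*} [NormedAddCommGroup V] [InnerProductSpace ℝ V] [FiniteDimensional ℝ V]
  [MeasurableSpace V] [BorelSpace V] {E F : Submodule ℝ V}

/-- The sum map `E × F → V`. -/
def sumMap (E F : Submodule ℝ V) (p : E × F) : V := (p.1 : V) + p.2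

theorem continuous_sumMap : Continuous (sumMap E F) :=
  (continuous_subtype_val.comp continuous_fst).add (continuous_subtype_val.comp continuous_snd)

theorem projectionOnto_sumMap (h : IsCompl E F) (p : E × F) :
    E.projectionOnto F h (sumMap E F p) = p.1 := by
  rw [sumMap, map_add, Submodule.projectionOnto_apply_left, Submodule.projectionOnto_apply_right,
    add_zero]

theorem projectionOnto_symm_sumMap (h : IsCompl E F) (p : E × F) :
    F.projectionOnto E h.symm (sumMap E F p) = p.2 := by
  rw [sumMap, map_add, Submodule.projectionOnto_apply_right, Submodule.projectionOnto_apply_left,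
    zero_add]

theorem sumMap_projectionOnto (h : IsCompl E F) (x : V) :
    sumMap E F (E.projectionOnto F h x, F.projectionOnto E h.symm x) = x :=
  Submodule.projection_add_projection_eq_self h x

theorem sumMap_injective (h : IsCompl E F) : Function.Injective (sumMap E F) := by
  intro p q hpq
  refine Prod.ext ?_ ?_
  · rw [← projectionOnto_sumMap h p, hpq, projectionOnto_sumMap h]
  · rw [← projectionOnto_symm_sumMap h p, hpq, projectionOnto_symm_sumMap h]

theorem preimage_sumMap (h : IsCompl E F) (A : Set E) (B : Set F) :
    sumMap E F ⁻¹' {x | E.projectionOnto F h x ∈ A ∧ F.projectionOnto E h.symm x ∈ B} = A ×ˢ B := by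
  ext p
  rw [Set.mem_preimage, Set.mem_ofPred_eq, projectionOnto_sumMap h, projectionOnto_symm_sumMap h]
  rfl

/-- The volume of the space in terms of the volumes of two complementary subspaces. -/
theorem exists_volume_eq_smul_map (h : IsCompl E F) : ∃ c : NNReal,
    (volume : Measure V) = (c : ℝ≥0∞) • (volume.prod volume).map (sumMap E F) := by
  let L : (E × F) ≃L[ℝ] V := (Submodule.prodEquivOfIsCompl E F h).toContinuousLinearEquiv
  have hL : ((volume : Measure E).prod (volume : Measure F)).map (sumMap E F) =
      ((volume : Measure E).prod (volume : Measure F)).map L := by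
    congr 1
  have := L.isAddHaarMeasure_map ((volume : Measure E).prod (volume : Measure F))
  rw [hL]
  exact ⟨_, Measure.isAddLeftInvariant_eq_smul (volume : Measure V)
    (((volume : Measure E).prod (volume : Measure F)).map L)⟩

theorem measurableSet_image_sumMap (h : IsCompl E F) {A : Set E} (hA : MeasurableSet A)
    {B : Set F} (hB : MeasurableSet B) :
    MeasurableSet {x | E.projectionOnto F h x ∈ A ∧ F.projectionOnto E h.symm x ∈ B} :=
  (measurable_projectionOnto h hA).inter (measurable_projectionOnto h.symm hB)

/-- The normalising factor is the volume of a sum of two sets of volume `1`. -/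
theorem volume_eq_smul_map (h : IsCompl E F) {A : Set E} (hA : MeasurableSet A)
    (hA1 : volume A = 1) {B : Set F} (hB : MeasurableSet B) (hB1 : volume B = 1) {α : ℝ≥0∞}
    (hα : α = volume (Set.image2 (fun (x : E) (y : F) => (x : V) + y) A B)) :
    α ≠ ∞ ∧ (volume : Measure V) = α • (volume.prod volume).map (sumMap E F) := by
  obtain ⟨c, hc⟩ := exists_volume_eq_smul_map h
  have h1 : Set.image2 (fun (x : E) (y : F) => (x : V) + y) A B =
      {x | E.projectionOnto F h x ∈ A ∧ F.projectionOnto E h.symm x ∈ B} := by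
    ext x
    constructor
    · rintro ⟨a, ha, b, hb, rfl⟩
      have h1 := projectionOnto_sumMap h (a, b)
      have h2 := projectionOnto_symm_sumMap h (a, b)
      exact ⟨h1.symm ▸ ha, h2.symm ▸ hb⟩
    · rintro ⟨ha, hb⟩
      exact ⟨_, ha, _, hb, sumMap_projectionOnto h x⟩
  have h2 : α = c := by
    rw [hα, h1, hc, Measure.smul_apply, Measure.map_apply continuous_sumMap.measurable
      (measurableSet_image_sumMap h hA hB), preimage_sumMap, Measure.prod_prod, hA1, hB1, mul_one,
      smul_eq_mul, mul_one]
  rw [h2]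
  exact ⟨ENNReal.coe_ne_top, hc⟩

theorem volume_projectionOnto_preimage (h : IsCompl E F) {α : ℝ≥0∞}
    (hα : (volume : Measure V) = α • (volume.prod volume).map (sumMap E F))
    {A : Set E} (hA : MeasurableSet A) {B : Set F} (hB : MeasurableSet B) :
    volume {x | E.projectionOnto F h x ∈ A ∧ F.projectionOnto E h.symm x ∈ B} =
      α * (volume A * volume B) := by
  rw [hα, Measure.smul_apply, Measure.map_apply continuous_sumMap.measurable
    (measurableSet_image_sumMap h hA hB), preimage_sumMap, Measure.prod_prod, smul_eq_mul]

end Splitting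

/-! ### The overlap function of the window -/

section Psi

variable {V : Type*} [NormedAddCommGroup V] [InnerProductSpace ℝ V] [FiniteDimensional ℝ V]
  [MeasurableSpace V] [BorelSpace V] {W : Set V}

theorem psi_eq (hW : MeasurableSet W) (y : V) :
    psi W y = volume.real (W ∩ {t | t - y ∈ W}) := by
  have h1 : MeasurableSet {t | t - y ∈ W} := (measurable_id.sub_const y) hW
  rw [psi, convolution, ← integral_indicator_one (hW.inter h1)]
  refine integral_congr_ae (Eventually.of_forall fun t => ?_)
  by_cases ht : t ∈ W <;> by_cases ht' : t - y ∈ W <;> simp [ht, ht', Set.indicator]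

theorem psi_nonneg (hW : MeasurableSet W) (y : V) : 0 ≤ psi W y := by
  rw [psi_eq hW]
  exact measureReal_nonneg

theorem ofReal_psi (hW : MeasurableSet W) (hWb : Bornology.IsBounded W) (y : V) :
    ENNReal.ofReal (psi W y) = volume (W ∩ {t | t - y ∈ W}) := by
  rw [psi_eq hW, ofReal_measureReal (hWb.subset Set.inter_subset_left).measure_lt_top.ne]

theorem ofReal_psi_eq (hW : MeasurableSet W) (hWb : Bornology.IsBounded W) (y : V) :
    ENNReal.ofReal (psi W y) = volume (W ∩ {t | t + y ∈ W}) := by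
  rw [ofReal_psi hW hWb, ← measure_preimage_add_right volume y]
  congr 1
  ext t
  simp [and_comm]

theorem psi_neg (hW : MeasurableSet W) (hWb : Bornology.IsBounded W) (y : V) :
    psi W (-y) = psi W y := by
  rw [← ENNReal.ofReal_eq_ofReal_iff (psi_nonneg hW _) (psi_nonneg hW _), ofReal_psi hW hWb,
    ofReal_psi_eq hW hWb]
  simp_rw [sub_neg_eq_add]

theorem psi_eq_zero (hW : MeasurableSet W) {y : V} (hy : ∀ t ∈ W, t + y ∉ W) : psi W y = 0 := by
  rw [psi_eq hW]
  have : W ∩ {t | t - y ∈ W} = ∅ := by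
    refine Set.eq_empty_of_forall_notMem fun t ht => ?_
    have := hy _ ht.2
    rw [sub_add_cancel] at this
    exact this ht.1
  rw [this, measureReal_empty]

theorem psi_eq_zero_of_lt (hW : MeasurableSet W) {R : ℝ} (hR : ∀ t ∈ W, ‖t‖ ≤ R) {y : V}
    (hy : 2 * R < ‖y‖) : psi W y = 0 := by
  refine psi_eq_zero hW fun t ht ht' => ?_
  have := norm_sub_le (t + y) t
  rw [add_sub_cancel_left] at this
  linarith [hR _ ht, hR _ ht']

end Psi

/-! ### Mean numbers of pairs in the suspension -/

section Campbell

theorem isBounded_unitCube {d : ℕ} : Bornology.IsBounded (unitCube d) := by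
  refine isBounded_iff_forall_norm_le.2 ⟨√d, fun x hx => ?_⟩
  rw [EuclideanSpace.norm_eq]
  refine Real.sqrt_le_sqrt ?_
  calc ∑ i, ‖x i‖ ^ 2 ≤ ∑ _i : Fin d, (1 : ℝ) := by
        refine Finset.sum_le_sum fun i _ => ?_
        rw [Real.norm_of_nonneg (hx i).1]
        exact pow_le_one₀ (hx i).1 (hx i).2.le
    _ = d := by simp

variable {d : ℕ} {ξ : Measure ((Fin d → ℤ) → Bool)} [IsProbabilityMeasure ξ]

theorem pairs_suspension (u : EuclideanSpace ℝ (Fin d)) (x : (Fin d → ℤ) → Bool) (k : Fin d → ℤ)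
    (D : Set (EuclideanSpace ℝ (Fin d))) :
    {z | z ∈ (suspension u x).1 ∧ z + latticePoint k ∈ (suspension u x).1 ∧ z ∈ D} =
      (fun j => u + latticePoint j) '' {j | x j = true ∧ x (j + k) = true ∧
        u + latticePoint j ∈ D} := by
  ext z
  constructor
  · rintro ⟨⟨j, hj, rfl⟩, ⟨l, hl, hl'⟩, hz⟩
    have : l = j + k := by
      refine suspension_injective u ?_
      simp only at hl' ⊢
      rw [hl', latticePoint_add, add_assoc]
    exact ⟨j, ⟨hj, this ▸ hl, hz⟩, rfl⟩
  · rintro ⟨j, ⟨h1, h2, h3⟩, rfl⟩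
    refine ⟨⟨j, h1, rfl⟩, ⟨j + k, h2, ?_⟩, h3⟩
    simp only [latticePoint_add, add_assoc]

theorem ncard_pairs_suspension_eq_tsum (u : EuclideanSpace ℝ (Fin d)) (x : (Fin d → ℤ) → Bool)
    (k : Fin d → ℤ) {D : Set (EuclideanSpace ℝ (Fin d))} (hDb : Bornology.IsBounded D) :
    ({z | z ∈ (suspension u x).1 ∧ z + latticePoint k ∈ (suspension u x).1 ∧ z ∈ D}.ncard : ℝ≥0∞) =
      ∑' j, D.indicator 1 (u + latticePoint j) *
        ENNReal.ofReal (siteValue j x * siteValue (j + k) x) := by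
  have hfin : {j : Fin d → ℤ | x j = true ∧ x (j + k) = true ∧ u + latticePoint j ∈ D}.Finite :=
    (finite_latticePoint_mem hDb u).subset fun j hj => hj.2.2
  rw [pairs_suspension, Set.ncard_image_of_injective _ (suspension_injective u),
    natCast_ncard_eq_tsum hfin]
  refine tsum_congr fun j => ?_
  by_cases h1 : u + latticePoint j ∈ D <;> cases h2 : x j <;> cases h3 : x (j + k) <;>
    simp [siteValue, Set.indicator, h1, h2, h3]

/-- The mean number of pairs of points with a given difference. -/
theorem lintegral_ncard_pairs (hs : StationaryUnder shift ξ) (k : Fin d → ℤ)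
    {D : Set (EuclideanSpace ℝ (Fin d))} (hD : MeasurableSet D) (hDb : Bornology.IsBounded D) :
    ∫⁻ φ, ({z | z ∈ φ.1 ∧ z + latticePoint k ∈ φ.1 ∧ z ∈ D}.ncard : ℝ≥0∞) ∂suspensionLaw ξ =
      volume D * ENNReal.ofReal (correlation ξ k) := by
  have hm : Measurable fun φ : LocFin (EuclideanSpace ℝ (Fin d)) =>
      ({z | z ∈ φ.1 ∧ z + latticePoint k ∈ φ.1 ∧ z ∈ D}.ncard : ℝ≥0∞) :=
    (Measurable.of_discrete (f := fun n : ℕ => (n : ℝ≥0∞))).comp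
      (measurable_ncard_inter_translate _ hD hDb)
  have hind : Measurable (D.indicator (1 : EuclideanSpace ℝ (Fin d) → ℝ≥0∞)) :=
    measurable_one.indicator hD
  have hsum : Measurable fun u : EuclideanSpace ℝ (Fin d) => ∑' j : Fin d → ℤ,
      D.indicator (1 : EuclideanSpace ℝ (Fin d) → ℝ≥0∞) (u + latticePoint j) :=
    Measurable.tsum fun j => hind.comp (measurable_id.add_const _)
  -- The volume of `D` is unfolded over the cube into a sum over sites. Each site contributes the
  -- same mean `E X_0 X_k` by stationarity, so the two sides agree term by term.
  rw [lintegral_suspensionLaw hm, ← lintegral_indicator_one hD, lintegral_eq_unitCube_tsum hind,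
    ← lintegral_mul_const _ hsum]
  refine lintegral_congr fun u => ?_
  simp_rw [ncard_pairs_suspension_eq_tsum u _ k hDb]
  have hsm : ∀ j, Measurable fun x : (Fin d → ℤ) → Bool =>
      ENNReal.ofReal (siteValue j x * siteValue (j + k) x) := fun j =>
    ((measurable_siteValue j).mul (measurable_siteValue (j + k))).ennreal_ofReal
  rw [lintegral_tsum fun j => ((hsm j).const_mul _).aemeasurable, ← ENNReal.tsum_mul_right]
  refine tsum_congr fun j => ?_
  rw [lintegral_const_mul _ (hsm j), ← ofReal_integral_eq_lintegral_ofReal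
    (integrable_siteValue_mul j (j + k)) (Eventually.of_forall fun x =>
      mul_nonneg (siteValue_nonneg _ _) (siteValue_nonneg _ _)), integral_siteValue_mul hs,
    add_sub_cancel_left]

/-- The numbers of points of a suspension in the translates of a bounded set are bounded. -/
theorem exists_ncard_suspension_le {D : Set (EuclideanSpace ℝ (Fin d))}
    (hDb : Bornology.IsBounded D) :
    ∃ N : ℕ, ∀ u x, ((suspension u x).1 ∩ D).ncard ≤ N := by
  obtain ⟨R, hR⟩ := hDb.exists_norm_le
  obtain ⟨R', hR'⟩ := isBounded_unitCube.exists_norm_le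
  have hfin := finite_latticePoint_mem
    (Metric.isBounded_closedBall (x := (0 : EuclideanSpace ℝ (Fin d))) (r := R + R')) 0
  refine ⟨{k : Fin d → ℤ | (0 : EuclideanSpace ℝ (Fin d)) + latticePoint k ∈
    Metric.closedBall 0 (R + R')}.ncard, fun u x => ?_⟩
  -- Subtracting the integer part of `u` puts the base point in the cube and only relabels the
  -- sites, so that the bound holds for every `u`.
  set j := floorVec u
  have hu := hR' _ ((sub_latticePoint_mem_unitCube u j).2 rfl)
  rw [← Set.ncard_image_of_injective _ (suspension_injective (u - latticePoint j))]
  refine Set.ncard_le_ncard ?_ (hfin.image _)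
  rintro _ ⟨⟨k, hk, rfl⟩, hkD⟩
  refine ⟨k + j, ?_, ?_⟩
  · rw [Set.mem_ofPred_eq, zero_add, mem_closedBall_zero_iff]
    have : latticePoint (k + j) = (u + latticePoint k) - (u - latticePoint j) := by
      rw [latticePoint_add]; abel
    rw [this]
    exact (norm_sub_le _ _).trans (add_le_add (hR _ hkD) hu)
  · simp only [latticePoint_add]
    abel

end Campbell

/-! ### From averaged local counts to asymptotic densities -/

section Counting

variable {V : Type*} [NormedAddCommGroup V] [NormedSpace ℝ V] [FiniteDimensional ℝ V]
  [MeasureSpace V] [BorelSpace V] [(volume : Measure V).IsAddHaarMeasure]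

theorem tendsto_volumeReal_div_of_le (n : ℝ → ℝ) (a : ℝ) (h1 : ∀ᶠ r in atTop, r - a ≤ n r)
    (h2 : ∀ᶠ r in atTop, n r ≤ r + a) :
    Tendsto (fun r => volume.real (Metric.closedBall (0 : V) (n r)) /
      volume.real (Metric.closedBall (0 : V) r)) atTop (𝓝 1) := by
  have hmono : ∀ {r s : ℝ}, r ≤ s → volume.real (Metric.closedBall (0 : V) r) ≤
      volume.real (Metric.closedBall (0 : V) s) := fun h =>
    measureReal_mono (Metric.closedBall_subset_closedBall h) measure_closedBall_lt_top.ne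
  refine tendsto_of_tendsto_of_tendsto_of_le_of_le' (tendsto_volumeReal_ball_div (V := V) (-a))
    (tendsto_volumeReal_ball_div (V := V) a) ?_ ?_
  · filter_upwards [h1] with r hr
    exact div_le_div_of_nonneg_right (hmono (by linarith)) measureReal_nonneg
  · filter_upwards [h2] with r hr
    exact div_le_div_of_nonneg_right (hmono hr) measureReal_nonneg

variable {X : Type*} {Q : Set X} {p : X → V}

/-- Exchanging sum and integral: a point contributes the volume of the set of centres that see it,
and points beyond radius `r + 1` are seen from nowhere in the ball. -/
theorem setIntegral_ncard_ball (hfin : ∀ r, {z | z ∈ Q ∧ p z ∈ Metric.closedBall 0 r}.Finite)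
    (r : ℝ) :
    ∫ t in Metric.closedBall (0 : V) r, ({z | z ∈ Q ∧ p z ∈ Metric.closedBall t 1}.ncard : ℝ) =
      ∑ z ∈ (hfin (r + 1)).toFinset,
        volume.real (Metric.closedBall (p z) 1 ∩ Metric.closedBall 0 r) := by
  have hfm : IsFiniteMeasure (volume.restrict (Metric.closedBall (0 : V) r)) :=
    ⟨by rw [Measure.restrict_apply_univ]; exact measure_closedBall_lt_top⟩
  have hB : ∀ x : V, MeasurableSet (Metric.closedBall x 1) := fun x =>
    Metric.isClosed_closedBall.measurableSet
  have h1 : ∀ t ∈ Metric.closedBall (0 : V) r,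
      ({z | z ∈ Q ∧ p z ∈ Metric.closedBall t 1}.ncard : ℝ) =
      ∑ z ∈ (hfin (r + 1)).toFinset, (Metric.closedBall (p z) 1).indicator (1 : V → ℝ) t := by
    classical
    intro t ht
    have h2 : {z | z ∈ Q ∧ p z ∈ Metric.closedBall t 1} =
        ((hfin (r + 1)).toFinset.filter fun z => p z ∈ Metric.closedBall t 1 : Finset X) := by
      ext z
      simp only [Finset.coe_filter, Set.Finite.mem_toFinset, Set.mem_ofPred_eq]
      refine ⟨fun hz => ⟨⟨hz.1, ?_⟩, hz.2⟩, fun hz => ⟨hz.1.1, hz.2⟩⟩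
      rw [Metric.mem_closedBall] at ht ⊢
      linarith [dist_triangle (p z) t 0, Metric.mem_closedBall.1 hz.2]
    rw [h2, Set.ncard_coe_finset, Finset.card_filter, Nat.cast_sum]
    refine Finset.sum_congr rfl fun z _ => ?_
    rw [Set.indicator_apply, Metric.mem_closedBall_comm]
    split_ifs <;> simp
  rw [setIntegral_congr_fun Metric.isClosed_closedBall.measurableSet h1, integral_finsetSum]
  · refine Finset.sum_congr rfl fun z _ => ?_
    rw [integral_indicator_one (hB _), measureReal_restrict_apply (hB _)]
  · exact fun z _ => (integrable_const (1 : ℝ)).indicator (hB _)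

/-- The asymptotic density of a locally finite family of points is given by the mean number of
points in the unit balls. -/
theorem tendsto_ncard_div_of_tendsto_average
    (hfin : ∀ r, {z | z ∈ Q ∧ p z ∈ Metric.closedBall 0 r}.Finite) {L : ℝ}
    (h : Tendsto (fun n : ℕ => (volume.real (Metric.closedBall (0 : V) n))⁻¹ *
      ∫ t in Metric.closedBall (0 : V) n, ({z | z ∈ Q ∧ p z ∈ Metric.closedBall t 1}.ncard : ℝ))
      atTop (𝓝 L)) :
    Tendsto (fun r : ℝ => ({z | z ∈ Q ∧ p z ∈ Metric.closedBall 0 r}.ncard : ℝ) /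
      volume.real (Metric.closedBall (0 : V) r)) atTop
      (𝓝 (L / volume.real (Metric.closedBall (0 : V) 1))) := by
  set N : ℝ → ℝ := fun r => ({z | z ∈ Q ∧ p z ∈ Metric.closedBall 0 r}.ncard : ℝ) with hN
  set v := volume.real (Metric.closedBall (0 : V) 1) with hv
  set B : ℝ → ℝ := fun r => volume.real (Metric.closedBall (0 : V) r) with hB
  set A : ℕ → ℝ := fun n => (B n)⁻¹ * ∫ t in Metric.closedBall (0 : V) n,
    ({z | z ∈ Q ∧ p z ∈ Metric.closedBall t 1}.ncard : ℝ) with hA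
  have hvpos : 0 < v := volumeReal_closedBall_pos one_pos
  have hBpos : ∀ {r : ℝ}, 0 < r → 0 < B r := fun hr => volumeReal_closedBall_pos hr
  have hmono : Monotone N := by
    intro r s hrs
    simp only [hN, Nat.cast_le]
    exact Set.ncard_le_ncard (fun z hz => ⟨hz.1, Metric.closedBall_subset_closedBall hrs hz.2⟩)
      (hfin s)
  have hball : ∀ x : V, volume.real (Metric.closedBall x 1) = v := by
    intro x
    rw [hv, volumeReal_closedBall x zero_le_one, volumeReal_closedBall 0 zero_le_one]
  have hcard : ∀ r, N r = ∑ _z ∈ (hfin r).toFinset, (1 : ℝ) := by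
    intro r
    rw [Finset.sum_const, nsmul_eq_mul, mul_one, ← Set.ncard_eq_toFinset_card _ (hfin r)]
  -- Every point contributes at most `v` to the integral, and exactly `v` when its unit ball lies in
  -- the ball of radius `n`, in particular when its norm is at most `n - 1`; this gives the two
  -- bounds.
  have hup : ∀ n : ℕ, 0 < n → B n * A n ≤ v * N (n + 1) := by
    intro n hn
    have hBn := hBpos (r := n) (by exact_mod_cast hn)
    rw [hA, mul_inv_cancel_left₀ hBn.ne', setIntegral_ncard_ball hfin, hcard, Finset.mul_sum]
    refine Finset.sum_le_sum fun z _ => ?_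
    rw [mul_one, ← hball (p z)]
    exact measureReal_mono Set.inter_subset_left measure_closedBall_lt_top.ne
  have hlow : ∀ n : ℕ, 0 < n → v * N (n - 1) ≤ B n * A n := by
    intro n hn
    have hBn := hBpos (r := n) (by exact_mod_cast hn)
    rw [hA, mul_inv_cancel_left₀ hBn.ne', setIntegral_ncard_ball hfin, hcard, Finset.mul_sum]
    refine (Finset.sum_le_sum fun z hz => ?_).trans (Finset.sum_le_sum_of_subset_of_nonneg
      (s := (hfin ((n : ℝ) - 1)).toFinset) ?_ fun _ _ _ => measureReal_nonneg)
    · rw [Set.Finite.mem_toFinset] at hz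
      rw [mul_one, ← hball (p z), Set.inter_eq_left.2]
      refine Metric.closedBall_subset_closedBall' ?_
      linarith [Metric.mem_closedBall.1 hz.2]
    · rw [Set.Finite.toFinset_subset_toFinset]
      exact fun z hz => ⟨hz.1, Metric.closedBall_subset_closedBall (by linarith) hz.2⟩
  -- The averages are known at integers only. For `n = ⌊r⌋₊ - 1` the upper bound involves `N (n + 1)
  -- ≤ N r`, and for `n = ⌈r⌉₊ + 1` the lower bound involves `N (n - 1) ≥ N r`.
  have t1 : Tendsto (fun r : ℝ => B (⌊r⌋₊ - 1 : ℕ) / B r * A (⌊r⌋₊ - 1) / v) atTop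
      (𝓝 (1 * L / v)) := by
    refine ((Tendsto.mul ?_ (h.comp ?_)).div_const v)
    · refine tendsto_volumeReal_div_of_le (fun r => ((⌊r⌋₊ - 1 : ℕ) : ℝ)) 2 ?_ ?_
      · filter_upwards [eventually_ge_atTop 1] with r hr
        rw [Nat.cast_sub (Nat.le_floor (by simpa using hr))]
        push_cast
        linarith [Nat.lt_floor_add_one r]
      · filter_upwards [eventually_ge_atTop 1] with r hr
        rw [Nat.cast_sub (Nat.le_floor (by simpa using hr))]
        push_cast
        linarith [Nat.floor_le (zero_le_one.trans hr)]
    · exact (tendsto_sub_atTop_nat 1).comp tendsto_nat_floor_atTop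
  have t2 : Tendsto (fun r : ℝ => B (⌈r⌉₊ + 1 : ℕ) / B r * A (⌈r⌉₊ + 1) / v) atTop
      (𝓝 (1 * L / v)) := by
    refine ((Tendsto.mul ?_ (h.comp ?_)).div_const v)
    · refine tendsto_volumeReal_div_of_le (fun r => ((⌈r⌉₊ + 1 : ℕ) : ℝ)) 2 ?_ ?_
      · filter_upwards with r
        push_cast
        linarith [Nat.le_ceil r]
      · filter_upwards [eventually_ge_atTop 0] with r hr
        push_cast
        linarith [Nat.ceil_lt_add_one hr]
    · exact (tendsto_add_atTop_nat 1).comp tendsto_nat_ceil_atTop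
  rw [one_mul] at t1 t2
  refine tendsto_of_tendsto_of_tendsto_of_le_of_le' t1 t2 ?_ ?_
  · filter_upwards [eventually_ge_atTop 2] with r hr
    have hfl : 2 ≤ ⌊r⌋₊ := Nat.le_floor (by simpa using hr)
    have h1 := hup (⌊r⌋₊ - 1) (by omega)
    have h2 : N ((⌊r⌋₊ - 1 : ℕ) + 1) ≤ N r := hmono (by
      rw [Nat.cast_sub (by omega)]
      push_cast
      linarith [Nat.floor_le (zero_le_two.trans hr)])
    have h3 := hBpos (zero_lt_two.trans_le hr)
    rw [div_mul_eq_mul_div, div_div, div_le_div_iff₀ (mul_pos h3 hvpos) h3]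
    calc B (⌊r⌋₊ - 1 : ℕ) * A (⌊r⌋₊ - 1) * B r ≤ v * N ((⌊r⌋₊ - 1 : ℕ) + 1) * B r := by gcongr
      _ ≤ v * N r * B r := by gcongr
      _ = N r * (B r * v) := by ring
  · filter_upwards [eventually_ge_atTop 2] with r hr
    have h1 := hlow (⌈r⌉₊ + 1) (by omega)
    have h2 : N r ≤ N ((⌈r⌉₊ + 1 : ℕ) - 1) := hmono (by
      push_cast
      linarith [Nat.le_ceil r])
    have h3 := hBpos (zero_lt_two.trans_le hr)
    rw [div_mul_eq_mul_div, div_div, div_le_div_iff₀ h3 (mul_pos h3 hvpos)]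
    calc N r * (B r * v) = v * N r * B r := by ring
      _ ≤ v * N ((⌈r⌉₊ + 1 : ℕ) - 1) * B r := by gcongr
      _ ≤ B (⌈r⌉₊ + 1 : ℕ) * A (⌈r⌉₊ + 1) * B r := by gcongr

end Counting

/-! ### Densities of pairs in the strip -/

section Pairs

variable {d : ℕ} {E F : Submodule ℝ (EuclideanSpace ℝ (Fin d))}

/-- The first points of the pairs of points of the strip with difference `k` whose first point
projects to `A`. -/
def stripPairs (h : IsCompl E F) (W : Set F) (φ : LocFin (EuclideanSpace ℝ (Fin d)))
    (k : EuclideanSpace ℝ (Fin d)) (A : Set E) : Set (EuclideanSpace ℝ (Fin d)) :=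
  {z | z ∈ φ.1 ∧ z + k ∈ φ.1 ∧ z ∈ {z | E.projectionOnto F h z ∈ A ∧
    F.projectionOnto E h.symm z ∈ W ∩ {y | y + F.projectionOnto E h.symm k ∈ W}}}

variable {h : IsCompl E F} {W : Set F}

theorem isBounded_stripPairs_band (hWb : Bornology.IsBounded W) (k : EuclideanSpace ℝ (Fin d))
    {A : Set E} (hA : Bornology.IsBounded A) : Bornology.IsBounded {z | E.projectionOnto F h z ∈ A ∧
      F.projectionOnto E h.symm z ∈ W ∩ {y | y + F.projectionOnto E h.symm k ∈ W}} :=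
  isBounded_projectionOnto_preimage h hA (hWb.subset Set.inter_subset_left)

theorem finite_stripPairs (hWb : Bornology.IsBounded W) (φ : LocFin (EuclideanSpace ℝ (Fin d)))
    (k : EuclideanSpace ℝ (Fin d)) {A : Set E} (hA : Bornology.IsBounded A) :
    (stripPairs h W φ k A).Finite :=
  (φ.2 _ (isBounded_stripPairs_band (h := h) hWb k hA)).subset fun _ hz => ⟨hz.1, hz.2.2⟩

theorem stripPairs_translate (φ : LocFin (EuclideanSpace ℝ (Fin d)))
    (k : EuclideanSpace ℝ (Fin d)) (t : E) :
    stripPairs h W (translate (t : EuclideanSpace ℝ (Fin d)) φ) k (Metric.closedBall 0 1) =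
      (fun z => z - (t : EuclideanSpace ℝ (Fin d))) ''
        stripPairs h W φ k (Metric.closedBall t 1) := by
  have h1 : ∀ y, y ∈ (translate (t : EuclideanSpace ℝ (Fin d)) φ).1 ↔ y + t ∈ φ.1 := by
    intro y
    constructor
    · rintro ⟨z, hz, rfl⟩
      simpa using hz
    · exact fun hy => ⟨y + t, hy, by simp⟩
  ext z
  have h2 : z ∈ (fun z => z - (t : EuclideanSpace ℝ (Fin d))) ''
      stripPairs h W φ k (Metric.closedBall t 1) ↔
      z + t ∈ stripPairs h W φ k (Metric.closedBall t 1) := by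
    constructor
    · rintro ⟨y, hy, rfl⟩
      simpa using hy
    · exact fun hy => ⟨z + t, hy, by simp⟩
  rw [h2]
  simp only [stripPairs, Set.mem_ofPred_eq, h1, map_add, Submodule.projectionOnto_apply_left,
    Submodule.projectionOnto_apply_right, add_zero, mem_closedBall_iff_norm, sub_zero,
    add_sub_cancel_right]
  rw [add_right_comm]

variable {ξ : Measure ((Fin d → ℤ) → Bool)} [IsProbabilityMeasure ξ]

/-- Invariance under all of `E` includes invariance along the single good line, which already makes
an event trivial. -/
theorem ergodicUnder_subspace {m : Measure (LocFin (EuclideanSpace ℝ (Fin d)))}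
    (hv : ∃ v : Metric.sphere (0 : EuclideanSpace ℝ (Fin d)) 1,
      (v : EuclideanSpace ℝ (Fin d)) ∈ E ∧ v ∉ exceptionalSet m) :
    ErgodicUnder (fun t : E => translate (t : EuclideanSpace ℝ (Fin d))) m := by
  obtain ⟨v, hvE, hv⟩ := hv
  intro A hA hinv
  exact not_not.1 hv A hA fun r => hinv ⟨r • (v : EuclideanSpace ℝ (Fin d)), E.smul_mem r hvE⟩

theorem measurableFlow_subspace (hs : StationaryUnder shift ξ) :
    MeasurableFlow (fun t : E => translate (t : EuclideanSpace ℝ (Fin d))) (suspensionLaw ξ) :=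
  (measurableFlow_translate (stationaryUnder_suspensionLaw hs)).comp_linear
    E.subtype.toAddMonoidHom measurable_subtype_coe

theorem ae_suspensionLaw {p : LocFin (EuclideanSpace ℝ (Fin d)) → Prop}
    (hp : MeasurableSet {φ | p φ}) (h : ∀ u x, p (suspension u x)) : ∀ᵐ φ ∂suspensionLaw ξ, p φ := by
  rw [suspensionLaw, ae_map_iff measurable_suspension.aemeasurable hp]
  exact Eventually.of_forall fun q => h q.1 q.2

/-- The asymptotic densities of the pairs of points of the strip with given differences. -/
theorem tendsto_ncard_stripPairs (hs : StationaryUnder shift ξ)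
    (he : ErgodicUnder (fun t : E => translate (t : EuclideanSpace ℝ (Fin d))) (suspensionLaw ξ))
    (hW : MeasurableSet W) (hWb : Bornology.IsBounded W) {α : ℝ≥0∞}
    (hα : (volume : Measure (EuclideanSpace ℝ (Fin d))) =
      α • (volume.prod volume).map (sumMap E F)) :
    ∀ᵐ φ ∂suspensionLaw ξ, ∀ k : Fin d → ℤ,
      Tendsto (fun r : ℝ => ((stripPairs h W φ (latticePoint k) (Metric.closedBall 0 r)).ncard : ℝ) /
        volume.real (Metric.closedBall (0 : E) r)) atTop (𝓝 (α.toReal *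
          (correlation ξ k * psi W (F.projectionOnto E h.symm (latticePoint k))))) := by
  rw [ae_all_iff]
  intro k
  set D := {z | E.projectionOnto F h z ∈ Metric.closedBall 0 1 ∧ F.projectionOnto E h.symm z ∈
    W ∩ {y | y + F.projectionOnto E h.symm (latticePoint k) ∈ W}} with hD
  have hDb : Bornology.IsBounded D :=
    isBounded_stripPairs_band hWb (latticePoint k) Metric.isBounded_closedBall
  have hWk : MeasurableSet
      (W ∩ {y | y + F.projectionOnto E h.symm (latticePoint k) ∈ W}) :=
    hW.inter ((measurable_id.add_const _) hW)
  have hDm : MeasurableSet D :=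
    measurableSet_image_sumMap h Metric.isClosed_closedBall.measurableSet hWk
  set g : LocFin (EuclideanSpace ℝ (Fin d)) → ℕ := fun φ =>
    (stripPairs h W φ (latticePoint k) (Metric.closedBall 0 1)).ncard with hg
  have hgm : Measurable g := measurable_ncard_inter_translate _ hDm hDb
  obtain ⟨M, hM⟩ := exists_ncard_suspension_le hDb
  have hgM : ∀ᵐ φ ∂suspensionLaw ξ, g φ ≤ M := by
    refine ae_suspensionLaw (measurableSet_le hgm measurable_const) fun u x => ?_
    refine (Set.ncard_le_ncard ?_ ((suspension u x).2 D hDb)).trans (hM u x)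
    exact fun z hz => ⟨hz.1, hz.2.2⟩
  -- The ergodic theorem is available for bounded functions. The count is bounded on suspensions,
  -- hence almost surely, and truncation changes it on a null set only.
  set f : LocFin (EuclideanSpace ℝ (Fin d)) → ℝ := fun φ => ((min (g φ) M : ℕ) : ℝ) with hf
  have hcast : Measurable fun n : ℕ => (n : ℝ) := Measurable.of_discrete
  have hfm : Measurable f := hcast.comp (hgm.min measurable_const)
  have hfg : f =ᵐ[suspensionLaw ξ] fun φ => (g φ : ℝ) := by
    filter_upwards [hgM] with φ hφ
    simp only [hf, min_eq_left hφ]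
  have hfM : ∀ φ, |f φ| ≤ M := by
    intro φ
    rw [hf, Nat.abs_cast, Nat.cast_le]
    exact min_le_right _ _
  have hI : ∫ φ, f φ ∂suspensionLaw ξ = α.toReal * (volume.real (Metric.closedBall (0 : E) 1) *
      psi W (F.projectionOnto E h.symm (latticePoint k))) * correlation ξ k := by
    have h1 := lintegral_ncard_pairs hs k hDm hDb
    rw [integral_congr_ae hfg, integral_eq_lintegral_of_nonneg_ae
      (Eventually.of_forall fun φ => Nat.cast_nonneg _) (hcast.comp hgm).aestronglyMeasurable]
    simp_rw [ENNReal.ofReal_natCast]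
    change (∫⁻ φ, ({z | z ∈ φ.1 ∧ z + latticePoint k ∈ φ.1 ∧ z ∈ D}.ncard : ℝ≥0∞)
      ∂suspensionLaw ξ).toReal = _
    rw [h1, hD, volume_projectionOnto_preimage h hα Metric.isClosed_closedBall.measurableSet hWk,
      ← ofReal_psi_eq hW hWb, ENNReal.toReal_mul, ENNReal.toReal_mul, ENNReal.toReal_mul,
      ENNReal.toReal_ofReal (correlation_nonneg k), ENNReal.toReal_ofReal (psi_nonneg hW _)]
    rfl
  have hflow := measurableFlow_subspace (E := E) hs
  filter_upwards [hflow.tendsto_ballAverage he hfm hfM, hflow.ballAverage_congr hfg] with φ h1 h2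
  simp_rw [h2] at h1
  have h3 : ∀ t : E, g (translate (t : EuclideanSpace ℝ (Fin d)) φ) =
      {z | z ∈ {z | z ∈ φ.1 ∧ z + latticePoint k ∈ φ.1 ∧ F.projectionOnto E h.symm z ∈
        W ∩ {y | y + F.projectionOnto E h.symm (latticePoint k) ∈ W}} ∧
        E.projectionOnto F h z ∈ Metric.closedBall t 1}.ncard := by
    intro t
    rw [hg]
    simp only
    rw [stripPairs_translate, Set.ncard_image_of_injective _ sub_left_injective]
    congr 1
    ext z
    simp only [stripPairs, Set.mem_ofPred_eq]
    tauto
  have h4 : ∀ r, stripPairs h W φ (latticePoint k) (Metric.closedBall 0 r) =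
      {z | z ∈ {z | z ∈ φ.1 ∧ z + latticePoint k ∈ φ.1 ∧ F.projectionOnto E h.symm z ∈
        W ∩ {y | y + F.projectionOnto E h.symm (latticePoint k) ∈ W}} ∧
        E.projectionOnto F h z ∈ Metric.closedBall 0 r} := by
    intro r
    ext z
    simp only [stripPairs, Set.mem_ofPred_eq]
    tauto
  simp_rw [ballAverage, h3] at h1
  have h5 := tendsto_ncard_div_of_tendsto_average (fun r => by
    rw [← h4 r]; exact finite_stripPairs hWb φ _ Metric.isBounded_closedBall) h1
  simp_rw [h4]
  convert h5 using 2
  rw [hI]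
  have := volumeReal_closedBall_pos (V := E) one_pos
  field_simp

end Pairs

/-! ### Weighted point measures on the projected lattice -/

section LatticeMeasure

variable {d : ℕ} {E F : Submodule ℝ (EuclideanSpace ℝ (Fin d))}

/-- The measure with mass `w k` at the projection of `k` on `E`. -/
noncomputable def latticeMeasure (h : IsCompl E F) (w : (Fin d → ℤ) → ℝ) : Measure E :=
  Measure.sum fun k => ENNReal.ofReal (w k) •
    Measure.dirac (E.projectionOnto F h (latticePoint k))

variable {h : IsCompl E F} {w : (Fin d → ℤ) → ℝ}

theorem latticeMeasure_apply {C : Set E} (hC : MeasurableSet C) :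
    latticeMeasure h w C = ∑' k, ENNReal.ofReal (w k) *
      C.indicator 1 (E.projectionOnto F h (latticePoint k)) := by
  rw [latticeMeasure, Measure.sum_apply _ hC]
  simp_rw [Measure.smul_apply, Measure.dirac_apply' _ hC, smul_eq_mul]

theorem finite_latticePoint_band (h : IsCompl E F) (r R : ℝ) :
    {k : Fin d → ℤ | ‖E.projectionOnto F h (latticePoint k)‖ ≤ r ∧
      ‖F.projectionOnto E h.symm (latticePoint k)‖ ≤ R}.Finite := by
  refine (finite_latticePoint_mem (isBounded_projectionOnto_preimage h
    (Metric.isBounded_closedBall (x := (0 : E)) (r := r))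
    (Metric.isBounded_closedBall (x := (0 : F)) (r := R))) 0).subset fun k hk => ?_
  simpa using hk

theorem isLocallyFiniteMeasure_latticeMeasure {R : ℝ}
    (hR : ∀ k, R < ‖F.projectionOnto E h.symm (latticePoint k)‖ → w k = 0) :
    IsLocallyFiniteMeasure (latticeMeasure h w) := by
  refine ⟨fun x => ⟨Metric.closedBall 0 (‖x‖ + 1), ?_, ?_⟩⟩
  · refine Filter.mem_of_superset (Metric.ball_mem_nhds x one_pos) fun y hy => ?_
    rw [mem_closedBall_zero_iff]
    have := norm_sub_norm_le y x
    have h2 := mem_ball_iff_norm.1 hy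
    linarith
  · rw [latticeMeasure_apply Metric.isClosed_closedBall.measurableSet,
      tsum_eq_sum (s := (finite_latticePoint_band h (‖x‖ + 1) R).toFinset)]
    · refine ENNReal.sum_lt_top.2 fun k _ => ENNReal.mul_lt_top ENNReal.ofReal_lt_top ?_
      exact (Set.indicator_le_self' (fun _ _ => zero_le) _).trans_lt ENNReal.one_lt_top
    · intro k hk
      rw [Set.Finite.mem_toFinset, Set.mem_ofPred_eq, not_and_or, not_le, not_le] at hk
      rcases hk with hk | hk
      · rw [Set.indicator_of_notMem, mul_zero]
        rw [mem_closedBall_zero_iff, not_le]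
        exact hk
      · rw [hR k hk, ENNReal.ofReal_zero, zero_mul]

theorem integral_latticeMeasure (hw : ∀ k, 0 ≤ w k) {f : E → ℝ}
    (hf : Integrable f (latticeMeasure h w)) {K : Finset (Fin d → ℤ)}
    (hK : ∀ k ∉ K, w k * f (E.projectionOnto F h (latticePoint k)) = 0) :
    ∫ x, f x ∂latticeMeasure h w =
      ∑ k ∈ K, w k * f (E.projectionOnto F h (latticePoint k)) := by
  have h1 := (hasSum_integral_measure hf).tsum_eq
  rw [latticeMeasure, ← h1]
  simp_rw [integral_smul_measure, integral_dirac, ENNReal.toReal_ofReal (hw _), smul_eq_mul]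
  exact tsum_eq_sum hK

end LatticeMeasure

/-! ### Convergence of the finite autocorrelations -/

section Autocorrelation

variable {d : ℕ} {E F : Submodule ℝ (EuclideanSpace ℝ (Fin d))} {h : IsCompl E F} {W : Set F}

theorem finite_strip (hWb : Bornology.IsBounded W) (φ : LocFin (EuclideanSpace ℝ (Fin d))) (R : ℝ) :
    {z | z ∈ strip h W φ ∧ E.projectionOnto F h z ∈ Metric.closedBall 0 R}.Finite :=
  (φ.2 _ (isBounded_projectionOnto_preimage h Metric.isBounded_closedBall hWb)).subset
    fun _ hz => ⟨hz.1.1, hz.2, hz.1.2⟩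

/-- Injectivity on the strip is used here: it lets sums over pairs of points of the projection be
lifted to sums over pairs of points of the strip, without multiplicities. -/
theorem integral_autocorrelationBall (hWb : Bornology.IsBounded W)
    {φ : LocFin (EuclideanSpace ℝ (Fin d))}
    (hinj : Set.InjOn (E.projectionOnto F h) (strip h W φ)) (f : E → ℝ) (R : ℝ) :
    ∫ x, f x ∂(autocorrelationBall (cutProject h W hWb φ) R) =
      (volume.real (Metric.closedBall (0 : E) R))⁻¹ * ∑ z ∈ (finite_strip (h := h) hWb φ R).toFinset,
        ∑ z' ∈ (finite_strip (h := h) hWb φ R).toFinset, f (E.projectionOnto F h (z' - z)) := by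
  classical
  set S := (finite_strip (h := h) hWb φ R).toFinset with hS
  have hSinj : Set.InjOn (E.projectionOnto F h) S := hinj.mono fun z hz => by
    rw [hS, Set.Finite.coe_toFinset] at hz
    exact hz.1
  have hmem : ∀ p : E × E, p ∈ (S.image (E.projectionOnto F h)) ×ˢ (S.image (E.projectionOnto F h)) ↔
      p ∈ (((cutProject h W hWb φ).1 ∩ Metric.closedBall 0 R) ×ˢ
        ((cutProject h W hWb φ).1 ∩ Metric.closedBall 0 R) : Set (E × E)) := by
    have h1 : ∀ x : E, x ∈ S.image (E.projectionOnto F h) ↔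
        x ∈ (cutProject h W hWb φ).1 ∩ Metric.closedBall 0 R := by
      intro x
      rw [Finset.mem_image]
      simp only [hS, Set.Finite.mem_toFinset]
      constructor
      · rintro ⟨z, ⟨hz, hzR⟩, rfl⟩
        exact ⟨⟨z, hz, rfl⟩, hzR⟩
      · rintro ⟨⟨z, hz, rfl⟩, hzR⟩
        exact ⟨z, ⟨hz, hzR⟩, rfl⟩
    intro p
    rw [Finset.mem_product, h1, h1]
    rfl
  have hfin : Fintype (((cutProject h W hWb φ).1 ∩ Metric.closedBall 0 R) ×ˢ
      ((cutProject h W hWb φ).1 ∩ Metric.closedBall 0 R) : Set (E × E)) := Fintype.subtype _ hmem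
  rw [autocorrelationBall, integral_smul_measure, Measure.sum_fintype,
    integral_finsetSum_measure (fun _ _ => integrable_dirac (by finiteness)), ENNReal.toReal_inv,
    smul_eq_mul, measureReal_def]
  simp_rw [integral_dirac]
  congr 1
  rw [← Finset.sum_subtype _ hmem (fun p : E × E => f (p.2 - p.1)), Finset.sum_product,
    Finset.sum_image hSinj]
  refine Finset.sum_congr rfl fun z _ => ?_
  rw [Finset.sum_image hSinj]
  simp_rw [map_sub]

/-- Pairs are grouped by their difference, a lattice vector `k`. The support of `f` bounds `k_E` and
the window bounds `k_F`, so finitely many `k` matter. The second point of a pair projects into the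
ball exactly when the first one projects into the ball about `-k_E`. -/
theorem sum_sum_eq_sum_card (hWb : Bornology.IsBounded W) {RW : ℝ} (hRW : ∀ t ∈ W, ‖t‖ ≤ RW)
    (u : EuclideanSpace ℝ (Fin d)) (x : (Fin d → ℤ) → Bool) {f : E → ℝ} {r : ℝ}
    (hf : ∀ y, r < ‖y‖ → f y = 0) (R : ℝ) :
    ∑ z ∈ (finite_strip (h := h) hWb (suspension u x) R).toFinset,
      ∑ z' ∈ (finite_strip (h := h) hWb (suspension u x) R).toFinset,
        f (E.projectionOnto F h (z' - z)) =
    ∑ k ∈ (finite_latticePoint_band h r (2 * RW)).toFinset,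
      f (E.projectionOnto F h (latticePoint k)) *
        (stripPairs h W (suspension u x) (latticePoint k) (Metric.closedBall 0 R ∩
          Metric.closedBall (-E.projectionOnto F h (latticePoint k)) R)).ncard := by
  classical
  set S := (finite_strip (h := h) hWb (suspension u x) R).toFinset with hS
  set K := (finite_latticePoint_band h r (2 * RW)).toFinset with hK
  have hmemS : ∀ z, z ∈ S ↔ z ∈ strip h W (suspension u x) ∧
      E.projectionOnto F h z ∈ Metric.closedBall 0 R := fun z => by
    rw [hS, Set.Finite.mem_toFinset]; rfl
  have h1 : ∀ z ∈ S, ∀ z' ∈ S, f (E.projectionOnto F h (z' - z)) =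
      ∑ k ∈ K, if z' = z + latticePoint k then f (E.projectionOnto F h (latticePoint k)) else 0 := by
    intro z hz z' hz'
    obtain ⟨⟨⟨j, hj, rfl⟩, hzW⟩, hzR⟩ := (hmemS z).1 hz
    obtain ⟨⟨⟨l, hl, rfl⟩, hzW'⟩, hzR'⟩ := (hmemS z').1 hz'
    have e1 : ∀ k, u + latticePoint l = u + latticePoint j + latticePoint k ↔ l - j = k := by
      intro k
      rw [add_assoc, add_right_inj, ← latticePoint_add, latticePoint_injective.eq_iff,
        sub_eq_iff_eq_add']
    have e2 : u + latticePoint l - (u + latticePoint j) = latticePoint (l - j) := by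
      rw [latticePoint_sub]; abel
    simp only at hzW hzW' ⊢
    rw [e2]
    simp only [e1, Finset.sum_ite_eq]
    split_ifs with hkK
    · rfl
    · rw [hK, Set.Finite.mem_toFinset, Set.mem_ofPred_eq, not_and_or, not_le, not_le] at hkK
      rcases hkK with hk | hk
      · exact hf _ hk
      · exfalso
        have h3 := norm_sub_le (F.projectionOnto E h.symm (u + latticePoint l))
          (F.projectionOnto E h.symm (u + latticePoint j))
        rw [← map_sub, e2] at h3
        linarith [hRW _ hzW, hRW _ hzW']
  rw [Finset.sum_congr rfl fun z hz => Finset.sum_congr rfl fun z' hz' => h1 z hz z' hz']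
  simp_rw [Finset.sum_comm (s := S) (t := K)]
  refine Finset.sum_congr rfl fun k _ => ?_
  simp_rw [Finset.sum_ite_eq' S]
  rw [← Finset.sum_filter, Finset.sum_const, nsmul_eq_mul, mul_comm]
  congr 2
  rw [← Set.ncard_coe_finset]
  congr 1
  ext z
  simp only [Finset.coe_filter, hmemS, Set.mem_ofPred_eq, stripPairs, strip, Set.mem_inter_iff,
    map_add, mem_closedBall_iff_norm, sub_zero, sub_neg_eq_add]
  tauto

/-- The autocorrelation of the projection of a strip, in terms of the densities of the pairs. -/
theorem isAutocorrelation_cutProject (hWb : Bornology.IsBounded W) {RW : ℝ}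
    (hRW : ∀ t ∈ W, ‖t‖ ≤ RW) {w : (Fin d → ℤ) → ℝ} (hw : ∀ k, 0 ≤ w k)
    (hwR : ∀ k, 2 * RW < ‖F.projectionOnto E h.symm (latticePoint k)‖ → w k = 0)
    (u : EuclideanSpace ℝ (Fin d)) (x : (Fin d → ℤ) → Bool)
    (hinj : Set.InjOn (E.projectionOnto F h) (strip h W (suspension u x)))
    (hlim : ∀ k : Fin d → ℤ, Tendsto (fun r : ℝ =>
      ((stripPairs h W (suspension u x) (latticePoint k) (Metric.closedBall 0 r)).ncard : ℝ) /
        volume.real (Metric.closedBall (0 : E) r)) atTop (𝓝 (w k))) :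
    IsAutocorrelation (cutProject h W hWb (suspension u x)) (latticeMeasure h w) := by
  have hlf := isLocallyFiniteMeasure_latticeMeasure (h := h) hwR
  refine ⟨hlf, fun f hfc hfs => ?_⟩
  obtain ⟨r, hr⟩ := hfs.isCompact.isBounded.exists_norm_le
  have hf0 : ∀ y, r < ‖y‖ → f y = 0 := fun y hy => by
    by_contra h0
    exact absurd (hr y (subset_tsupport f h0)) (not_le.2 hy)
  rw [integral_latticeMeasure hw (hfc.integrable_of_hasCompactSupport hfs)
    (K := (finite_latticePoint_band h r (2 * RW)).toFinset)]
  swap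
  · intro k hk
    rw [Set.Finite.mem_toFinset, Set.mem_ofPred_eq, not_and_or, not_le, not_le] at hk
    rcases hk with hk | hk
    · rw [hf0 _ hk, mul_zero]
    · rw [hwR k hk, zero_mul]
  simp_rw [integral_autocorrelationBall hWb hinj, sum_sum_eq_sum_card hWb hRW u x hf0,
    Finset.mul_sum]
  refine tendsto_finsetSum _ fun k _ => ?_
  set y := E.projectionOnto F h (latticePoint k)
  -- The intersection of the two balls lies between the balls of radii `R - ‖y‖` and `R`, which give
  -- the same density.
  have hmain : Tendsto (fun R : ℝ => ((stripPairs h W (suspension u x) (latticePoint k)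
      (Metric.closedBall 0 R ∩ Metric.closedBall (-y) R)).ncard : ℝ) /
        volume.real (Metric.closedBall (0 : E) R)) atTop (𝓝 (w k)) := by
    have hmono : ∀ {A B : Set E}, A ⊆ B → Bornology.IsBounded B →
        ((stripPairs h W (suspension u x) (latticePoint k) A).ncard : ℝ) ≤
        (stripPairs h W (suspension u x) (latticePoint k) B).ncard := by
      intro A B hAB hB
      rw [Nat.cast_le]
      exact Set.ncard_le_ncard (fun z hz => ⟨hz.1, hz.2.1, hAB hz.2.2.1, hz.2.2.2⟩)
        (finite_stripPairs hWb _ _ hB)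
    have t1 : Tendsto (fun R : ℝ => ((stripPairs h W (suspension u x) (latticePoint k)
        (Metric.closedBall 0 (R + -‖y‖))).ncard : ℝ) /
        volume.real (Metric.closedBall (0 : E) (R + -‖y‖)) *
        (volume.real (Metric.closedBall (0 : E) (R + -‖y‖)) /
        volume.real (Metric.closedBall (0 : E) R))) atTop (𝓝 (w k)) := by
      have := ((hlim k).comp (tendsto_atTop_add_const_right atTop (-‖y‖) tendsto_id)).mul
        (tendsto_volumeReal_ball_div (V := E) (-‖y‖))
      rwa [mul_one] at this
    refine tendsto_of_tendsto_of_tendsto_of_le_of_le' t1 (hlim k) ?_ ?_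
    · filter_upwards [eventually_gt_atTop ‖y‖] with R hR
      have hpos := volumeReal_closedBall_pos (V := E) (r := R + -‖y‖) (by linarith)
      rw [div_mul_div_cancel₀ hpos.ne']
      refine div_le_div_of_nonneg_right (hmono (Set.subset_inter ?_ ?_)
        (Metric.isBounded_closedBall.subset Set.inter_subset_left)) measureReal_nonneg
      · exact Metric.closedBall_subset_closedBall (by linarith [norm_nonneg y])
      · exact Metric.closedBall_subset_closedBall' (by simp)
    · filter_upwards with R
      exact div_le_div_of_nonneg_right (hmono Set.inter_subset_left Metric.isBounded_closedBall)
        measureReal_nonneg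
  have := hmain.mul_const (f y)
  refine this.congr fun R => ?_
  ring

end Autocorrelation

/-! ### Stationarity, ergodicity and integrability of the projection -/

section ProjectedStrip

variable {d : ℕ} {E F : Submodule ℝ (EuclideanSpace ℝ (Fin d))} {h : IsCompl E F} {W : Set F}
  {m : Measure (LocFin (EuclideanSpace ℝ (Fin d)))}

theorem stationaryUnder_map_cutProject (hW : MeasurableSet W) (hWb : Bornology.IsBounded W)
    (hs : StationaryUnder translate m) :
    StationaryUnder translate (m.map (cutProject h W hWb)) := by
  intro t
  have hm := measurable_cutProject h hW hWb
  have ht : Measurable (translate t : LocFin E → _) :=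
    measurable_translate.comp measurable_prodMk_left
  refine ⟨ht, ?_⟩
  rw [Measure.map_map ht hm]
  have : translate t ∘ cutProject h W hWb =
      cutProject h W hWb ∘ translate (t : EuclideanSpace ℝ (Fin d)) :=
    funext fun φ => (cutProject_translate h hWb t φ).symm
  rw [this, ← Measure.map_map hm (hs _).measurable, (hs _).map_eq]

theorem ergodicUnder_map_cutProject (hW : MeasurableSet W) (hWb : Bornology.IsBounded W)
    (he : ErgodicUnder (fun t : E => translate (t : EuclideanSpace ℝ (Fin d))) m) :
    ErgodicUnder translate (m.map (cutProject h W hWb)) := by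
  intro A hA hinv
  have hm := measurable_cutProject h hW hWb
  rw [Measure.map_apply hm hA, Measure.map_apply hm hA.compl]
  refine he _ (hm hA) fun t => ?_
  ext φ
  rw [Set.mem_preimage, Set.mem_preimage, cutProject_translate, ← Set.mem_preimage, hinv]
  rfl

theorem squareIntegrable_cutProject {Ω : Type*} [MeasurableSpace Ω] {P : Measure Ω}
    [IsProbabilityMeasure P] {U : Ω → EuclideanSpace ℝ (Fin d)} {X : Ω → (Fin d → ℤ) → Bool}
    (hWb : Bornology.IsBounded W)
    (hm : Measurable fun ω => cutProject h W hWb (suspension (U ω) (X ω))) :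
    SquareIntegrable P fun ω => cutProject h W hWb (suspension (U ω) (X ω)) := by
  intro K hK
  have hcast : Measurable fun n : ℕ => (n : ℝ) := Measurable.of_discrete
  have hD := isBounded_projectionOnto_preimage h hK.isBounded hWb
  obtain ⟨N, hN⟩ := exists_ncard_suspension_le hD
  refine MemLp.of_bound (hcast.comp ((measurable_count hK.measurableSet
    hK.isBounded).comp hm)).aestronglyMeasurable N (Eventually.of_forall fun ω => ?_)
  rw [Real.norm_natCast, Nat.cast_le]
  have hfin := (suspension (U ω) (X ω)).2 _ hD
  refine le_trans ?_ (hN (U ω) (X ω))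
  refine le_trans (Set.ncard_le_ncard ?_ (hfin.image (E.projectionOnto F h)))
    (Set.ncard_image_le hfin)
  rintro _ ⟨⟨z, hz, rfl⟩, hzK⟩
  exact ⟨z, ⟨hz.1, hzK, hz.2⟩, rfl⟩

end ProjectedStrip

theorem continuous_fourier {V : Type*} [NormedAddCommGroup V] [InnerProductSpace ℝ V]
    [FiniteDimensional ℝ V] [MeasurableSpace V] [BorelSpace V] {H : V → ℂ} (hH : Integrable H) :
    Continuous (𝓕 H) :=
  VectorFourier.fourierIntegral_continuous Real.continuous_fourierChar
    (by exact continuous_inner) hH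

/-! ### Lattice sums, Parseval's identity and the periodized measure -/

section Amalgam

variable {d : ℕ}

/-- The values of `H` on the translates of the unit cube are dominated by `M`. -/
def CubeBound (H : EuclideanSpace ℝ (Fin d) → ℂ) (M : (Fin d → ℤ) → ℝ) : Prop :=
  ∀ u ∈ unitCube d, ∀ j, ‖H (u + latticePoint j)‖ ≤ M j

variable {H H₁ H₂ : EuclideanSpace ℝ (Fin d) → ℂ} {M M₁ M₂ : (Fin d → ℤ) → ℝ}

theorem zero_mem_unitCube : (0 : EuclideanSpace ℝ (Fin d)) ∈ unitCube d := fun _ => by simp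

theorem CubeBound.nonneg (h : CubeBound H M) (j : Fin d → ℤ) : 0 ≤ M j :=
  (norm_nonneg _).trans (h 0 zero_mem_unitCube j)

theorem CubeBound.summable_norm (h : CubeBound H M) (hM : Summable M)
    {u : EuclideanSpace ℝ (Fin d)} (hu : u ∈ unitCube d) :
    Summable fun j => ‖H (u + latticePoint j)‖ :=
  hM.of_nonneg_of_le (fun _ => norm_nonneg _) (h u hu)

theorem CubeBound.integrable (h : CubeBound H M) (hM : Summable M) (hH : Measurable H) :
    Integrable H := by
  refine ⟨hH.aestronglyMeasurable, ?_⟩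
  rw [HasFiniteIntegral, lintegral_eq_unitCube_tsum hH.enorm]
  calc ∫⁻ u in unitCube d, ∑' j, ‖H (u + latticePoint j)‖ₑ
      ≤ ∫⁻ _u in unitCube d, ∑' j, ENNReal.ofReal (M j) := by
        refine setLIntegral_mono measurable_const fun u hu => ENNReal.tsum_le_tsum fun j => ?_
        rw [← ofReal_norm]
        exact ENNReal.ofReal_le_ofReal (h u hu j)
    _ = ∑' j, ENNReal.ofReal (M j) := by rw [lintegral_const, measure_univ, mul_one]
    _ = ENNReal.ofReal (∑' j, M j) := (ENNReal.ofReal_tsum_of_nonneg h.nonneg hM).symm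
    _ < ∞ := ENNReal.ofReal_lt_top

theorem volume_eq_sum_map : (volume : Measure (EuclideanSpace ℝ (Fin d))) =
    Measure.sum fun k : Fin d → ℤ =>
      (volume.restrict (unitCube d)).map fun u => u + latticePoint k := by
  have hm : ∀ k : Fin d → ℤ, Measurable fun u : EuclideanSpace ℝ (Fin d) => u + latticePoint k :=
    fun k => measurable_id.add_const _
  refine Measure.ext_of_lintegral _ fun f hf => ?_
  have hfk : ∀ k : Fin d → ℤ, AEMeasurable (fun u => f (u + latticePoint k))
      (volume.restrict (unitCube d)) := fun k => (hf.comp (hm k)).aemeasurable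
  rw [lintegral_sum_measure, lintegral_eq_unitCube_tsum hf, lintegral_tsum hfk]
  exact tsum_congr fun k => (lintegral_map hf (hm k)).symm

theorem hasSum_setIntegral_unitCube (hH : Measurable H) (hi : Integrable H) :
    HasSum (fun k : Fin d → ℤ => ∫ u in unitCube d, H (u + latticePoint k)) (∫ z, H z) := by
  have h1 := hi
  rw [volume_eq_sum_map] at h1
  have h2 := hasSum_integral_measure h1
  rw [← volume_eq_sum_map] at h2
  refine h2.congr_fun fun k => ?_
  exact (integral_map (measurable_id.add_const _).aemeasurable hH.aestronglyMeasurable).symm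

/-- The sum of `H` over the translates of the points by the lattice. -/
noncomputable def latticeSum (H : EuclideanSpace ℝ (Fin d) → ℂ) (u : EuclideanSpace ℝ (Fin d)) :
    ℂ := ∑' j : Fin d → ℤ, H (u + latticePoint j)

theorem CubeBound.norm_latticeSum_le (h : CubeBound H M) (hM : Summable M)
    {u : EuclideanSpace ℝ (Fin d)} (hu : u ∈ unitCube d) : ‖latticeSum H u‖ ≤ ∑' j, M j :=
  tsum_of_norm_bounded hM.hasSum (h u hu)

theorem CubeBound.aestronglyMeasurable (h : CubeBound H M) (hM : Summable M) (hH : Measurable H) :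
    AEStronglyMeasurable (latticeSum H) (volume.restrict (unitCube d)) := by
  refine (aemeasurable_of_tendsto_metrizable_ae (atTop : Filter (Finset (Fin d → ℤ)))
    (f := fun s u => ∑ j ∈ s, H (u + latticePoint j)) (fun s => ?_) ?_).aestronglyMeasurable
  · exact (Finset.measurable_fun_sum s fun j _ =>
      hH.comp (measurable_id.add_const _)).aemeasurable
  · filter_upwards [ae_restrict_mem measurableSet_unitCube] with u hu
    exact (h.summable_norm hM hu).of_norm.hasSum

theorem CubeBound.memLp (h : CubeBound H M) (hM : Summable M) (hH : Measurable H) (p : ℝ≥0∞) :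
    MemLp (latticeSum H) p (volume.restrict (unitCube d)) := by
  refine MemLp.of_bound (h.aestronglyMeasurable hM hH) (∑' j, M j) ?_
  filter_upwards [ae_restrict_mem measurableSet_unitCube] with u hu
  exact h.norm_latticeSum_le hM hu

theorem CubeBound.integral_latticeSum (h : CubeBound H M) (hM : Summable M) (hH : Measurable H) :
    ∫ u in unitCube d, latticeSum H u = ∫ z, H z := by
  rw [← (hasSum_setIntegral_unitCube hH (h.integrable hM hH)).tsum_eq]
  have hb : ∀ j : Fin d → ℤ, ∀ᵐ u ∂volume.restrict (unitCube d),
      ‖H (u + latticePoint j)‖ ≤ M j := fun j => by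
    filter_upwards [ae_restrict_mem measurableSet_unitCube] with u hu using h u hu j
  have hi : ∀ j : Fin d → ℤ, Integrable (fun u => H (u + latticePoint j))
      (volume.restrict (unitCube d)) := fun j =>
    Integrable.of_bound (hH.comp (measurable_id.add_const _)).aestronglyMeasurable (M j) (hb j)
  refine (integral_tsum_of_summable_integral_norm hi ?_).symm
  refine hM.of_nonneg_of_le (fun _ => integral_nonneg fun _ => norm_nonneg _) fun j => ?_
  calc ∫ u in unitCube d, ‖H (u + latticePoint j)‖ ≤ ∫ _u in unitCube d, M j :=
        integral_mono_ae (hi j).norm (integrable_const _) (hb j)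
    _ = M j := by simp

theorem CubeBound.norm_integral_le (h : CubeBound H M) (hM : Summable M) (hH : Measurable H) :
    ‖∫ z, H z‖ ≤ ∑' j, M j := by
  rw [← h.integral_latticeSum hM hH]
  have := norm_setIntegral_le_of_norm_le_const (μ := volume) (s := unitCube d)
    (C := ∑' j, M j) (by rw [volume_unitCube]; exact ENNReal.one_lt_top)
    (fun u hu => h.norm_latticeSum_le hM hu)
  rwa [measureReal_def, volume_unitCube, ENNReal.toReal_one, mul_one] at this

theorem CubeBound.latticeChar_mul (h : CubeBound H M) (k : Fin d → ℤ) :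
    CubeBound (fun z => latticeChar k z * H z) M := fun u hu j => by
  rw [norm_mul, norm_latticeChar, one_mul]
  exact h u hu j

/-- The mechanism of Poisson's formula: lattice characters are periodic, so they pass through the
lattice sum, and the integral over the cube unfolds to the whole space. -/
theorem CubeBound.cubeCoeff_latticeSum (h : CubeBound H M) (hM : Summable M) (hH : Measurable H)
    (k : Fin d → ℤ) : cubeCoeff (latticeSum H) k = ∫ z, latticeChar k z * H z := by
  rw [← (h.latticeChar_mul k).integral_latticeSum hM
    ((continuous_latticeChar k).measurable.mul hH), cubeCoeff]
  simp_rw [latticeSum, latticeChar_add_latticePoint, tsum_mul_left]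

theorem CubeBound.star_mul (h₁ : CubeBound H₁ M₁) (h₂ : CubeBound H₂ M₂) (n : Fin d → ℤ) :
    CubeBound (fun z => star (H₁ z) * H₂ (z + latticePoint n)) fun j => M₁ j * M₂ (j + n) := by
  intro u hu j
  rw [norm_mul, norm_star, add_assoc, ← latticePoint_add]
  exact mul_le_mul (h₁ u hu j) (h₂ u hu _) (norm_nonneg _) (h₁.nonneg j)

/-- The change of variables `(n, j) ↦ (j, j + n)`. -/
def shearEquiv (G : Type*) [AddCommGroup G] : G × G ≃ G × G where
  toFun p := (p.2, p.2 + p.1)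
  invFun p := (p.2 - p.1, p.1)
  left_inv p := by simp
  right_inv p := by simp

theorem summable_shear (h₁ : CubeBound H₁ M₁) (h₂ : CubeBound H₂ M₂) (hM₁ : Summable M₁)
    (hM₂ : Summable M₂) :
    Summable fun p : (Fin d → ℤ) × (Fin d → ℤ) => M₁ p.2 * M₂ (p.2 + p.1) :=
  (shearEquiv (Fin d → ℤ)).summable_iff.2
    (hM₁.mul_of_nonneg hM₂ (fun j => h₁.nonneg j) (fun j => h₂.nonneg j))

theorem summable_tsum_shear (h₁ : CubeBound H₁ M₁) (h₂ : CubeBound H₂ M₂) (hM₁ : Summable M₁)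
    (hM₂ : Summable M₂) : Summable fun n => ∑' j, M₁ j * M₂ (j + n) :=
  (summable_shear h₁ h₂ hM₁ hM₂).prod

theorem summable_mul_shift (h₁ : CubeBound H₁ M₁) (h₂ : CubeBound H₂ M₂) (hM₁ : Summable M₁)
    (hM₂ : Summable M₂) (n : Fin d → ℤ) : Summable fun j => M₁ j * M₂ (j + n) :=
  (summable_shear h₁ h₂ hM₁ hM₂).prod_factor n

theorem star_tsum_mul_tsum {G : Type*} [AddCommGroup G] {a b : G → ℂ}
    (ha : Summable fun j => ‖a j‖) (hb : Summable fun j => ‖b j‖) :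
    star (∑' j, a j) * ∑' j, b j = ∑' n, ∑' j, star (a j) * b (j + n) := by
  have s1 : Summable fun j => ‖star (a j)‖ := by simpa only [norm_star] using ha
  have h := summable_mul_of_summable_norm s1 hb
  rw [tsum_star, tsum_mul_tsum_of_summable_norm s1 hb]
  exact ((shearEquiv G).tsum_eq fun z : G × G => star (a z.1) * b z.2).symm.trans
    (Summable.tsum_prod ((shearEquiv G).summable_iff.2 h))

theorem star_latticeSum_mul (h₁ : CubeBound H₁ M₁) (h₂ : CubeBound H₂ M₂) (hM₁ : Summable M₁)
    (hM₂ : Summable M₂) {u : EuclideanSpace ℝ (Fin d)} (hu : u ∈ unitCube d) :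
    star (latticeSum H₁ u) * latticeSum H₂ u =
      ∑' n, latticeSum (fun z => star (H₁ z) * H₂ (z + latticePoint n)) u := by
  refine (star_tsum_mul_tsum (h₁.summable_norm hM₁ hu) (h₂.summable_norm hM₂ hu)).trans
    (tsum_congr fun n => tsum_congr fun j => ?_)
  rw [latticePoint_add, ← add_assoc]

/-- **Parseval's identity** for lattice sums. -/
theorem hasSum_fourier_latticeSum (h₁ : CubeBound H₁ M₁) (h₂ : CubeBound H₂ M₂) (hM₁ : Summable M₁)
    (hM₂ : Summable M₂) (hH₁ : Measurable H₁) (hH₂ : Measurable H₂) :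
    HasSum (fun k => star (∫ z, latticeChar k z * H₁ z) * ∫ z, latticeChar k z * H₂ z)
      (∑' n, ∫ z, star (H₁ z) * H₂ (z + latticePoint n)) := by
  have h := hasSum_cubeCoeff (h₁.memLp hM₁ hH₁ 2) (h₂.memLp hM₂ hH₂ 2)
  simp_rw [h₁.cubeCoeff_latticeSum hM₁ hH₁, h₂.cubeCoeff_latticeSum hM₂ hH₂] at h
  convert h using 1
  have hm : ∀ n, Measurable fun z => star (H₁ z) * H₂ (z + latticePoint n) := fun n =>
    (continuous_star.measurable.comp hH₁).mul (hH₂.comp (measurable_id.add_const _))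
  have hs := summable_mul_shift h₁ h₂ hM₁ hM₂
  -- A product of two lattice sums is regrouped by the difference `n` of the indices; for each `n`
  -- the result is again a lattice sum, whose integral over the cube unfolds.
  rw [setIntegral_congr_fun measurableSet_unitCube fun u hu =>
    star_latticeSum_mul h₁ h₂ hM₁ hM₂ hu, ← integral_tsum_of_summable_integral_norm]
  · refine tsum_congr fun n => ?_
    rw [(h₁.star_mul h₂ n).integral_latticeSum (hs n) (hm n)]
  · exact fun n => ((h₁.star_mul h₂ n).memLp (hs n) (hm n) 1).integrable le_rfl
  · refine (summable_tsum_shear h₁ h₂ hM₁ hM₂).of_nonneg_of_le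
      (fun _ => integral_nonneg fun _ => norm_nonneg _) fun n => ?_
    calc ∫ u in unitCube d, ‖latticeSum (fun z => star (H₁ z) * H₂ (z + latticePoint n)) u‖
        ≤ ∫ _u in unitCube d, ∑' j, M₁ j * M₂ (j + n) := by
          refine integral_mono_ae (((h₁.star_mul h₂ n).memLp (hs n) (hm n) 1).integrable le_rfl).norm
            (integrable_const _) ?_
          filter_upwards [ae_restrict_mem measurableSet_unitCube] with u hu
          exact (h₁.star_mul h₂ n).norm_latticeSum_le (hs n) hu
      _ = ∑' j, M₁ j * M₂ (j + n) := by simp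

/-- The autocorrelation coefficients of `H₁` and `H₂`. -/
noncomputable def shiftCoeff (H₁ H₂ : EuclideanSpace ℝ (Fin d) → ℂ) (n : Fin d → ℤ) : ℂ :=
  ∫ z, star (H₁ z) * H₂ (z + latticePoint n)

theorem norm_shiftCoeff_le (h₁ : CubeBound H₁ M₁) (h₂ : CubeBound H₂ M₂) (hM₁ : Summable M₁)
    (hM₂ : Summable M₂) (hH₁ : Measurable H₁) (hH₂ : Measurable H₂) (n : Fin d → ℤ) :
    ‖shiftCoeff H₁ H₂ n‖ ≤ ∑' j, M₁ j * M₂ (j + n) :=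
  (h₁.star_mul h₂ n).norm_integral_le (summable_mul_shift h₁ h₂ hM₁ hM₂ n)
    ((continuous_star.measurable.comp hH₁).mul (hH₂.comp (measurable_id.add_const _)))

theorem summable_norm_shiftCoeff (h₁ : CubeBound H₁ M₁) (h₂ : CubeBound H₂ M₂) (hM₁ : Summable M₁)
    (hM₂ : Summable M₂) (hH₁ : Measurable H₁) (hH₂ : Measurable H₂) :
    Summable fun n => ‖shiftCoeff H₁ H₂ n‖ :=
  (summable_tsum_shear h₁ h₂ hM₁ hM₂).of_nonneg_of_le (fun _ => norm_nonneg _)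
    (norm_shiftCoeff_le h₁ h₂ hM₁ hM₂ hH₁ hH₂)

theorem fourierChar_smul (z x : EuclideanSpace ℝ (Fin d)) (c : ℂ) :
    Real.fourierChar (-inner ℝ z x) • c =
      Complex.exp (-(2 * Real.pi * inner ℝ z x : ℝ) * Complex.I) * c := by
  rw [Circle.smul_def, smul_eq_mul, Real.fourierChar_apply]
  congr 2
  push_cast
  ring

theorem fourier_add_latticePoint (x : EuclideanSpace ℝ (Fin d)) (k : Fin d → ℤ) :
    𝓕 H (x + latticePoint k) =
      ∫ z, latticeChar k z * (Complex.exp (-(2 * Real.pi * inner ℝ z x : ℝ) * Complex.I) * H z) := by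
  rw [Real.fourier_eq]
  refine integral_congr_ae (Eventually.of_forall fun z => ?_)
  simp only
  rw [fourierChar_smul, latticeChar, ← mul_assoc, ← Complex.exp_add, inner_add_right,
    real_inner_comm z]
  congr 2
  push_cast
  ring

theorem latticeChar_comm (n : Fin d → ℤ) (x : EuclideanSpace ℝ (Fin d)) : latticeChar n x =
    Complex.exp (-(2 * Real.pi * inner ℝ (latticePoint n) x : ℝ) * Complex.I) := rfl

/-- **Parseval's identity** for the values of Fourier transforms on a translate of the lattice. -/
theorem hasSum_star_fourier_mul (h₁ : CubeBound H₁ M₁) (h₂ : CubeBound H₂ M₂) (hM₁ : Summable M₁)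
    (hM₂ : Summable M₂) (hH₁ : Measurable H₁) (hH₂ : Measurable H₂)
    (x : EuclideanSpace ℝ (Fin d)) :
    HasSum (fun k => star (𝓕 H₁ (x + latticePoint k)) * 𝓕 H₂ (x + latticePoint k))
      (∑' n, latticeChar n x * shiftCoeff H₁ H₂ n) := by
  -- Multiplication by this character translates Fourier transforms by `x` and keeps the bounds on
  -- cubes, so the case of the lattice itself suffices.
  set e : EuclideanSpace ℝ (Fin d) → ℂ := fun z =>
    Complex.exp (-(2 * Real.pi * inner ℝ z x : ℝ) * Complex.I) with he
  have hen : ∀ z, ‖e z‖ = 1 := fun z => by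
    rw [he]
    simp only
    rw [← Complex.ofReal_neg, Complex.norm_exp_ofReal_mul_I]
  have hem : Measurable e := by
    refine Continuous.measurable ?_
    fun_prop
  have hadd : ∀ z z', e (z + z') = e z * e z' := fun z z' => by
    simp only [he]
    rw [← Complex.exp_add, inner_add_left]
    congr 1
    push_cast
    ring
  have hstar : ∀ z, star (e z) * e z = 1 := fun z => by
    rw [mul_comm]
    change e z * (starRingEnd ℂ) (e z) = 1
    rw [Complex.mul_conj, Complex.normSq_eq_norm_sq, hen]
    simp
  have hb : ∀ {H : EuclideanSpace ℝ (Fin d) → ℂ} {M}, CubeBound H M →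
      CubeBound (fun z => e z * H z) M := fun h u hu j => by
    rw [norm_mul, hen, one_mul]
    exact h u hu j
  have key := hasSum_fourier_latticeSum (hb h₁) (hb h₂) hM₁ hM₂ (hem.mul hH₁) (hem.mul hH₂)
  simp_rw [fourier_add_latticePoint]
  convert key using 1
  refine tsum_congr fun n => ?_
  rw [shiftCoeff, ← integral_const_mul]
  refine integral_congr_ae (Eventually.of_forall fun z => ?_)
  simp only
  rw [hadd, star_mul, latticeChar_comm]
  change e (latticePoint n) * _ = _
  linear_combination (-(e (latticePoint n)) * star (H₁ z) * H₂ (z + latticePoint n)) * hstar z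

variable {μ : Measure (EuclideanSpace ℝ (Fin d))} [IsFiniteMeasure μ]

theorem lintegral_periodization {g : EuclideanSpace ℝ (Fin d) → ℝ≥0∞} (hg : Measurable g) :
    ∫⁻ x, g x ∂periodization μ = ∫⁻ x, ∑' k, g (x + latticePoint k) ∂μ := by
  have hgk : ∀ k : Fin d → ℤ, AEMeasurable (fun x => g (x + latticePoint k)) μ := fun k =>
    (hg.comp (measurable_id.add_const _)).aemeasurable
  rw [periodization, lintegral_sum_measure, lintegral_tsum hgk]
  exact tsum_congr fun k => lintegral_map hg (measurable_id.add_const _)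

/-- Parseval's identity with `H₁ = H₂ = H` bounds the sum of `|Ĥ|²` over `x + ℤ^d` by a constant
independent of `x`, which is then integrated against the finite measure `μ`. The constant depends on
the dominating family only. -/
theorem lintegral_norm_fourier_sq_le (h : CubeBound H M) (hM : Summable M) (hH : Measurable H) :
    ∫⁻ x, ENNReal.ofReal (‖𝓕 H x‖ ^ 2) ∂periodization μ ≤
      ENNReal.ofReal (∑' n, ∑' j, M j * M (j + n)) * μ Set.univ := by
  have hc := continuous_fourier (h.integrable hM hH)
  rw [lintegral_periodization (by fun_prop), ← lintegral_const]
  refine lintegral_mono fun x => ?_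
  have h1 := hasSum_star_fourier_mul h h hM hM hH hH x
  have h2 : ∀ k : Fin d → ℤ, star (𝓕 H (x + latticePoint k)) * 𝓕 H (x + latticePoint k) =
      ((‖𝓕 H (x + latticePoint k)‖ ^ 2 : ℝ) : ℂ) := fun k => by
    rw [mul_comm]
    change _ * (starRingEnd ℂ) _ = _
    rw [Complex.mul_conj, Complex.normSq_eq_norm_sq]
  simp_rw [h2] at h1
  have h3 : Summable fun k : Fin d → ℤ => ‖𝓕 H (x + latticePoint k)‖ ^ 2 :=
    Complex.summable_ofReal.1 h1.summable
  rw [← ENNReal.ofReal_tsum_of_nonneg (fun _ => by positivity) h3]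
  refine ENNReal.ofReal_le_ofReal ?_
  have h4 := h1.tsum_eq
  rw [← Complex.ofReal_tsum] at h4
  rw [← Real.norm_of_nonneg (tsum_nonneg fun k => by positivity :
    0 ≤ ∑' k, ‖𝓕 H (x + latticePoint k)‖ ^ 2), ← Complex.norm_real, h4]
  refine tsum_of_norm_bounded (summable_tsum_shear h h hM hM).hasSum fun n => ?_
  rw [norm_mul, norm_latticeChar, one_mul]
  exact norm_shiftCoeff_le h h hM hM hH hH n

theorem memLp_fourier_periodization (h : CubeBound H M) (hM : Summable M) (hH : Measurable H) :
    MemLp (𝓕 H) 2 (periodization μ) := by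
  have hc := continuous_fourier (h.integrable hM hH)
  rw [memLp_two_iff_integrable_sq_norm hc.aestronglyMeasurable]
  refine ⟨by fun_prop, ?_⟩
  rw [hasFiniteIntegral_iff_ofReal (Eventually.of_forall fun x => by positivity)]
  exact (lintegral_norm_fourier_sq_le h hM hH).trans_lt
    (ENNReal.mul_lt_top ENNReal.ofReal_lt_top (measure_lt_top _ _))

/-- The Fourier transform of the lattice measure with weights `μ̂(n)` is the periodization of `μ`,
tested against products of Fourier transforms. -/
theorem integral_star_fourier_mul (h₁ : CubeBound H₁ M₁) (h₂ : CubeBound H₂ M₂) (hM₁ : Summable M₁)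
    (hM₂ : Summable M₂) (hH₁ : Measurable H₁) (hH₂ : Measurable H₂) :
    Integrable (fun x => star (𝓕 H₁ x) * 𝓕 H₂ x) (periodization μ) ∧
    ∫ x, star (𝓕 H₁ x) * 𝓕 H₂ x ∂periodization μ =
      ∑' n, fourierCoef μ n * shiftCoeff H₁ H₂ n := by
  have hi : Integrable (fun x => star (𝓕 H₁ x) * 𝓕 H₂ x) (periodization μ) :=
    (memLp_fourier_periodization h₁ hM₁ hH₁).star.integrable_mul
      (memLp_fourier_periodization h₂ hM₂ hH₂)
  refine ⟨hi, ?_⟩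
  have hc : Continuous fun x => star (𝓕 H₁ x) * 𝓕 H₂ x :=
    (continuous_fourier (h₁.integrable hM₁ hH₁)).star.mul
      (continuous_fourier (h₂.integrable hM₂ hH₂))
  have hmap : ∀ k : Fin d → ℤ, Measurable fun x : EuclideanSpace ℝ (Fin d) => x + latticePoint k :=
    fun k => measurable_id.add_const _
  have h1 := (hasSum_integral_measure (show Integrable _ (Measure.sum fun k : Fin d → ℤ =>
    μ.map fun x => x + latticePoint k) from hi)).tsum_eq
  have hik : ∀ k : Fin d → ℤ, Integrable (fun x => star (𝓕 H₁ (x + latticePoint k)) *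
      𝓕 H₂ (x + latticePoint k)) μ := fun k =>
    (hi.mono_measure (Measure.le_sum _ k)).comp_measurable (hmap k)
  have hnorm : Summable fun k : Fin d → ℤ => ∫ x, ‖star (𝓕 H₁ (x + latticePoint k)) *
      𝓕 H₂ (x + latticePoint k)‖ ∂μ := by
    have := (hasSum_integral_measure (show Integrable _ (Measure.sum fun k : Fin d → ℤ =>
      μ.map fun x => x + latticePoint k) from hi.norm)).summable
    refine this.congr fun k => ?_
    rw [integral_map (hmap k).aemeasurable hc.norm.aestronglyMeasurable]
  rw [periodization, ← h1]
  -- The pointwise identity on `x + ℤ^d` is integrated in `μ(dx)`: the sum over `k` builds the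
  -- periodization, and the characters integrate to the Fourier coefficients.
  calc ∑' k : Fin d → ℤ, ∫ x, star (𝓕 H₁ x) * 𝓕 H₂ x ∂(μ.map fun x => x + latticePoint k)
      = ∑' k : Fin d → ℤ, ∫ x, star (𝓕 H₁ (x + latticePoint k)) *
          𝓕 H₂ (x + latticePoint k) ∂μ :=
        tsum_congr fun k => integral_map (hmap k).aemeasurable hc.aestronglyMeasurable
    _ = ∫ x, ∑' n, latticeChar n x * shiftCoeff H₁ H₂ n ∂μ := by
        rw [integral_tsum_of_summable_integral_norm hik hnorm]
        refine integral_congr_ae (Eventually.of_forall fun x => ?_)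
        exact (hasSum_star_fourier_mul h₁ h₂ hM₁ hM₂ hH₁ hH₂ x).tsum_eq
    _ = ∑' n, fourierCoef μ n * shiftCoeff H₁ H₂ n := by
        rw [← integral_tsum_of_summable_integral_norm]
        · exact tsum_congr fun n => integral_mul_const _ _
        · intro n
          refine Integrable.mul_const (Integrable.of_bound
            (continuous_latticeChar n).aestronglyMeasurable 1 (Eventually.of_forall fun x => ?_)) _
          rw [norm_latticeChar]
        · simp_rw [norm_mul, norm_latticeChar, one_mul, integral_const, smul_eq_mul]
          exact (summable_norm_shiftCoeff h₁ h₂ hM₁ hM₂ hH₁ hH₂).mul_left _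

end Amalgam

/-! ### Polynomial weights on the lattice -/

section Weight

variable {d : ℕ}

/-- The weight `(1 + ‖x‖)^{-n}`. -/
noncomputable def decay (n : ℕ) {V : Type*} [NormedAddCommGroup V] (x : V) : ℝ :=
  ((1 + ‖x‖) ^ n)⁻¹

theorem decay_pos (n : ℕ) {V : Type*} [NormedAddCommGroup V] (x : V) : 0 < decay n x := by
  unfold decay
  positivity

theorem continuous_decay (n : ℕ) {V : Type*} [NormedAddCommGroup V] :
    Continuous (decay n : V → ℝ) := by
  unfold decay
  exact Continuous.inv₀ (by fun_prop) fun x => by positivity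

theorem decay_eq_rpow (n : ℕ) {V : Type*} [NormedAddCommGroup V] (x : V) :
    decay n x = (1 + ‖x‖) ^ (-(n : ℝ)) := by
  rw [decay, Real.rpow_neg (by positivity), Real.rpow_natCast]

theorem decay_le_mul {V V' : Type*} [NormedAddCommGroup V] [NormedAddCommGroup V'] (n : ℕ)
    {x : V} {y : V'} {c : ℝ} (h : 1 + ‖y‖ ≤ c * (1 + ‖x‖)) :
    decay n x ≤ c ^ n * decay n y := by
  rw [decay, decay, inv_eq_one_div, ← div_eq_mul_inv, div_le_div_iff₀ (by positivity)
    (by positivity), one_mul, ← mul_pow]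
  exact pow_le_pow_left₀ (by positivity) h n

/-- A bound for the norms of the points of the unit cube. -/
theorem exists_norm_unitCube_le : ∃ D : ℝ, 0 ≤ D ∧ ∀ u ∈ unitCube d, ‖u‖ ≤ D := by
  obtain ⟨D, hD⟩ := (isBounded_unitCube (d := d)).exists_norm_le
  exact ⟨D, (norm_nonneg _).trans (hD 0 zero_mem_unitCube), hD⟩

/-- Comparison with an integral: the weight changes by at most a constant factor over a unit cube,
and the exponent `d + 1` makes it integrable on `ℝ^d`. -/
theorem summable_decay_latticePoint :
    Summable fun k : Fin d → ℤ => decay (d + 1) (latticePoint k) := by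
  obtain ⟨D, hD0, hD⟩ := exists_norm_unitCube_le (d := d)
  set H : EuclideanSpace ℝ (Fin d) → ℂ := fun z => (decay (d + 1) z : ℂ)
  have hint : Integrable (fun z : EuclideanSpace ℝ (Fin d) => decay (d + 1) z) := by
    simp_rw [decay_eq_rpow]
    exact integrable_one_add_norm (by simp)
  have hs := (hasSum_setIntegral_unitCube (H := H)
    (Complex.continuous_ofReal.comp (continuous_decay _)).measurable hint.ofReal).summable.norm
  have hc : 0 < ((1 + D) ^ (d + 1))⁻¹ := by positivity
  rw [← summable_mul_left_iff hc.ne']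
  refine hs.of_nonneg_of_le (fun k => by have := decay_pos (d + 1) (latticePoint k); positivity)
    fun k => ?_
  simp only [H]
  rw [integral_complex_ofReal, Complex.norm_real]
  refine le_trans ?_ (le_abs_self _)
  have hi : Integrable (fun u : EuclideanSpace ℝ (Fin d) => decay (d + 1) (u + latticePoint k))
      (volume.restrict (unitCube d)) := (hint.comp_add_right (latticePoint k)).integrableOn
  calc ((1 + D) ^ (d + 1))⁻¹ * decay (d + 1) (latticePoint k)
      = ∫ _u in unitCube d, ((1 + D) ^ (d + 1))⁻¹ * decay (d + 1) (latticePoint k) := by simp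
    _ ≤ ∫ u in unitCube d, decay (d + 1) (u + latticePoint k) := by
        refine setIntegral_mono_on (integrable_const _) hi measurableSet_unitCube fun u hu => ?_
        rw [inv_mul_le_iff₀ (by positivity)]
        refine decay_le_mul _ ?_
        have := norm_add_le u (latticePoint k)
        nlinarith [norm_nonneg (latticePoint k), hD u hu, norm_nonneg u,
          mul_nonneg hD0 (norm_nonneg (latticePoint k))]

end Weight

/-! ### Test functions on the strip -/

section Strip

variable {d : ℕ} {E F : Submodule ℝ (EuclideanSpace ℝ (Fin d))}

/-- The function `z ↦ b(z_E) 1_W(z_F)`. -/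
noncomputable def stripFun (h : IsCompl E F) (W : Set F) (b : E → ℂ)
    (z : EuclideanSpace ℝ (Fin d)) : ℂ :=
  b (E.projectionOnto F h z) * W.indicator 1 (F.projectionOnto E h.symm z)

variable {h : IsCompl E F} {W : Set F} {b c : E → ℂ}

theorem measurable_stripFun (hW : MeasurableSet W) (hb : Measurable b) :
    Measurable (stripFun h W b) :=
  (hb.comp (measurable_projectionOnto h)).mul
    ((measurable_one.indicator hW).comp (measurable_projectionOnto h.symm))

theorem norm_le_of_mem_strip {R : ℝ} (hR : ∀ t ∈ W, ‖t‖ ≤ R) {z : EuclideanSpace ℝ (Fin d)}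
    (hz : F.projectionOnto E h.symm z ∈ W) : ‖z‖ ≤ ‖E.projectionOnto F h z‖ + R := by
  nth_rewrite 1 [← Submodule.projection_add_projection_eq_self h z]
  exact (norm_add_le _ _).trans (add_le_add le_rfl (hR _ hz))

/-- The functions `b(z_E) 1_W(z_F)` with a decaying `b` are dominated by a summable family. -/
theorem exists_cubeBound_stripFun (h : IsCompl E F) (hWb : Bornology.IsBounded W) : ∃ K : ℝ, 0 ≤ K ∧
    ∀ (C : ℝ) (b : E → ℂ), (∀ y, ‖b y‖ ≤ C * decay (d + 1) y) →
      CubeBound (stripFun h W b) fun j => C * (K * decay (d + 1) (latticePoint j)) := by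
  obtain ⟨R', hR'⟩ := hWb.exists_norm_le
  obtain ⟨D, hD0, hD⟩ := exists_norm_unitCube_le (d := d)
  set R := max R' 0
  have hR : ∀ t ∈ W, ‖t‖ ≤ R := fun t ht => (hR' t ht).trans (le_max_left _ _)
  have hR0 : 0 ≤ R := le_max_right _ _
  refine ⟨(1 + R + D) ^ (d + 1), by positivity, fun C b hb u hu j => ?_⟩
  have hC : 0 ≤ C := by
    have := (norm_nonneg _).trans (hb 0)
    exact (mul_nonneg_iff_of_pos_right (decay_pos _ _)).1 this
  have hdp := decay_pos (d + 1) (latticePoint j)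
  rw [stripFun, norm_mul]
  by_cases hz : F.projectionOnto E h.symm (u + latticePoint j) ∈ W
  · rw [Set.indicator_of_mem hz, Pi.one_apply, norm_one, mul_one]
    refine (hb _).trans (mul_le_mul_of_nonneg_left (decay_le_mul _ ?_) hC)
    have h1 := norm_le_of_mem_strip (h := h) hR hz
    have h2 := norm_sub_le (u + latticePoint j) u
    rw [add_sub_cancel_left] at h2
    set e := ‖E.projectionOnto F h (u + latticePoint j)‖
    have he : 0 ≤ e := norm_nonneg _
    nlinarith [hD u hu, mul_nonneg hR0 he, mul_nonneg hD0 he]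
  · rw [Set.indicator_of_notMem hz, norm_zero, mul_zero]
    positivity

theorem integral_eq_mul_integral_prod {α : ℝ≥0∞}
    (hα : (volume : Measure (EuclideanSpace ℝ (Fin d))) =
      α • (volume.prod volume).map (sumMap E F)) (h : IsCompl E F)
    (G : EuclideanSpace ℝ (Fin d) → ℂ) :
    ∫ z, G z = α.toReal * ∫ p : E × F, G (sumMap E F p) ∂volume.prod volume := by
  have hemb : MeasurableEmbedding (sumMap E F) :=
    continuous_sumMap.measurableEmbedding (sumMap_injective h)
  rw [hα, integral_smul_measure, hemb.integral_map, Complex.real_smul]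

/-- The oblique splitting of `z` becomes orthogonal projection of the frequency: `⟨z_E + z_F, x⟩ =
⟨z_E, x_E^⊥⟩ + ⟨z_F, x_F^⊥⟩`. The factor `α` is the Jacobian of the splitting. -/
theorem fourier_stripFun {α : ℝ≥0∞} (hα : (volume : Measure (EuclideanSpace ℝ (Fin d))) =
      α • (volume.prod volume).map (sumMap E F)) (x : EuclideanSpace ℝ (Fin d)) :
    𝓕 (stripFun h W b) x = α.toReal * (𝓕 b (E.orthogonalProjectionOnto x) *
      𝓕 (W.indicator (1 : F → ℂ)) (F.orthogonalProjectionOnto x)) := by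
  rw [Real.fourier_eq, integral_eq_mul_integral_prod hα h, Real.fourier_eq, Real.fourier_eq,
    ← integral_prod_mul]
  congr 1
  refine integral_congr_ae (Eventually.of_forall fun p => ?_)
  simp only
  have h1 : inner ℝ (sumMap E F p) x = inner ℝ p.1 (E.orthogonalProjectionOnto x) +
      inner ℝ p.2 (F.orthogonalProjectionOnto x) := by
    rw [sumMap, inner_add_left, Submodule.inner_orthogonalProjectionOnto_eq_of_mem_left,
      Submodule.inner_orthogonalProjectionOnto_eq_of_mem_left]
  rw [h1, stripFun, projectionOnto_sumMap h, projectionOnto_symm_sumMap h, neg_add,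
    AddChar.map_add_eq_mul, Circle.smul_def, Circle.smul_def, Circle.smul_def, Circle.coe_mul]
  simp only [smul_eq_mul]
  ring

/-- The integral factors along `E` and `F`. The factor on `F` measures the overlap of `W` with a
translate of itself, which is where `ψ` enters, through its evenness. -/
theorem shiftCoeff_stripFun {α : ℝ≥0∞} (hα : (volume : Measure (EuclideanSpace ℝ (Fin d))) =
      α • (volume.prod volume).map (sumMap E F)) (hW : MeasurableSet W)
    (hWb : Bornology.IsBounded W) (n : Fin d → ℤ) :
    shiftCoeff (stripFun h W b) (stripFun h W c) n =
      α.toReal * psi W (F.projectionOnto E h.symm (latticePoint n)) *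
        ∫ y, star (b y) * c (y + E.projectionOnto F h (latticePoint n)) := by
  rw [shiftCoeff, integral_eq_mul_integral_prod hα h, mul_assoc]
  congr 1
  set v := F.projectionOnto E h.symm (latticePoint n)
  have h1 : ((psi W v : ℝ) : ℂ) = ∫ t, W.indicator (1 : F → ℂ) t * W.indicator 1 (t + v) := by
    have hm : MeasurableSet (W ∩ {t | t + v ∈ W}) := hW.inter ((measurable_id.add_const _) hW)
    have h2 : ∀ t, W.indicator (1 : F → ℂ) t * W.indicator 1 (t + v) =
        (((W ∩ {t | t + v ∈ W}).indicator 1 t : ℝ) : ℂ) := fun t => by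
      by_cases ht : t ∈ W <;> by_cases ht' : t + v ∈ W <;> simp [ht, ht', Set.indicator]
    simp_rw [h2]
    rw [integral_complex_ofReal, integral_indicator_one hm, ← psi_neg hW hWb, psi_eq hW]
    simp_rw [sub_neg_eq_add]
  rw [h1, mul_comm, ← integral_prod_mul]
  refine integral_congr_ae (Eventually.of_forall fun p => ?_)
  simp only
  rw [stripFun, stripFun, map_add, map_add, projectionOnto_sumMap h, projectionOnto_symm_sumMap h]
  have h3 : star (W.indicator (1 : F → ℂ) p.2) = W.indicator (1 : F → ℂ) p.2 := by
    by_cases hp : p.2 ∈ W <;> simp [hp]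
  rw [star_mul, h3]
  ring

end Strip

/-! ### Positivity of the Fourier transform of `ψ` -/

section PsiHat

variable {V : Type*} [NormedAddCommGroup V] [InnerProductSpace ℝ V] [FiniteDimensional ℝ V]
  [MeasurableSpace V] [BorelSpace V] {W : Set V}

theorem integrable_indicator_one (hW : MeasurableSet W) (hWb : Bornology.IsBounded W) :
    Integrable (W.indicator (1 : V → ℂ)) := by
  rw [integrable_indicator_iff hW]
  exact integrableOn_const hWb.measure_lt_top.ne (by finiteness)

theorem fourier_comp_neg (f : V → ℂ) (ξ : V) : 𝓕 (fun x => f (-x)) ξ = 𝓕 f (-ξ) := by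
  rw [Real.fourier_eq, Real.fourier_eq, ← integral_neg_eq_self]
  simp_rw [neg_neg, inner_neg_left, inner_neg_right]

theorem fourier_star (f : V → ℂ) (ξ : V) : 𝓕 (fun x => star (f x)) ξ = star (𝓕 f (-ξ)) := by
  rw [Real.fourier_eq, Real.fourier_eq]
  change _ = (starRingEnd ℂ) _
  rw [← integral_conj]
  refine integral_congr_ae (Eventually.of_forall fun x => ?_)
  simp only [Circle.smul_def, smul_eq_mul, map_mul, inner_neg_right, neg_neg]
  rw [← Circle.coe_inv_eq_conj, ← AddChar.map_neg_eq_inv]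
  rfl

/-- The transform of `1_{-W}` is the conjugate of that of `1_W`, so the convolution theorem yields a
squared modulus. -/
theorem psiHat_eq (hW : MeasurableSet W) (hWb : Bornology.IsBounded W) (ξ : V) :
    psiHat W ξ = ((‖𝓕 (W.indicator (1 : V → ℂ)) ξ‖ ^ 2 : ℝ) : ℂ) := by
  have hW' : MeasurableSet {x : V | -x ∈ W} := measurable_neg hW
  have hWb' : Bornology.IsBounded {x : V | -x ∈ W} := by
    obtain ⟨R, hR⟩ := hWb.exists_norm_le
    exact isBounded_iff_forall_norm_le.2 ⟨R, fun x hx => norm_neg x ▸ hR _ hx⟩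
  have h1 : (fun x : V => (psi W x : ℂ)) = convolution (W.indicator (1 : V → ℂ))
      ({x | -x ∈ W}.indicator (1 : V → ℂ)) (ContinuousLinearMap.mul ℂ ℂ) volume := by
    funext x
    rw [psi, convolution, convolution, ← integral_complex_ofReal]
    refine integral_congr_ae (Eventually.of_forall fun t => ?_)
    by_cases ht : t ∈ W <;> by_cases ht' : t - x ∈ W <;> simp [ht, ht', Set.indicator]
  have h2 : ({x | -x ∈ W}.indicator (1 : V → ℂ)) = fun x => star (W.indicator (1 : V → ℂ) (-x)) := by
    funext x
    by_cases hx : -x ∈ W <;> simp [hx, Set.indicator]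
  rw [psiHat, h1, Real.fourier_mul_convolution_eq (integrable_indicator_one hW hWb)
    (integrable_indicator_one hW' hWb'), h2,
    fourier_comp_neg (fun x => star (W.indicator (1 : V → ℂ) x)), fourier_star, neg_neg]
  change _ * (starRingEnd ℂ) _ = _
  rw [Complex.mul_conj, Complex.normSq_eq_norm_sq]

theorem psiHat_re (hW : MeasurableSet W) (hWb : Bornology.IsBounded W) (ξ : V) :
    (psiHat W ξ).re = ‖𝓕 (W.indicator (1 : V → ℂ)) ξ‖ ^ 2 := by
  rw [psiHat_eq hW hWb, Complex.ofReal_re]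

theorem continuous_fourier_indicator (hW : MeasurableSet W) (hWb : Bornology.IsBounded W) :
    Continuous (𝓕 (W.indicator (1 : V → ℂ))) :=
  continuous_fourier (integrable_indicator_one hW hWb)

end PsiHat

/-! ### The diffraction measure and its duality with the autocorrelation -/

section DiffractionMeasure

variable {d : ℕ} {E F : Submodule ℝ (EuclideanSpace ℝ (Fin d))}

/-- The measure `C ↦ α² ∫ ψ̂(x_F^⊥) 1_C(x_E^⊥) μ_p(dx)`. -/
noncomputable def diffractionMeasure (E : Submodule ℝ (EuclideanSpace ℝ (Fin d))) (W : Set F)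
    (α : ℝ≥0∞) (μ : Measure (EuclideanSpace ℝ (Fin d))) : Measure E :=
  ((periodization μ).withDensity fun x =>
    α ^ 2 * ENNReal.ofReal (psiHat W (F.orthogonalProjectionOnto x)).re).map
      E.orthogonalProjectionOnto

variable {h : IsCompl E F} {W : Set F} {α : ℝ≥0∞} {μ : Measure (EuclideanSpace ℝ (Fin d))}

theorem measurable_psiHat_density (hW : MeasurableSet W) (hWb : Bornology.IsBounded W) :
    Measurable fun x : EuclideanSpace ℝ (Fin d) =>
      α ^ 2 * ENNReal.ofReal (psiHat W (F.orthogonalProjectionOnto x)).re := by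
  simp_rw [psiHat_re hW hWb]
  have := (continuous_fourier_indicator hW hWb).comp (F.orthogonalProjectionOnto.continuous)
  exact ((this.norm.pow 2).measurable.ennreal_ofReal).const_mul _

theorem lintegral_diffractionMeasure (hW : MeasurableSet W) (hWb : Bornology.IsBounded W)
    {g : E → ℝ≥0∞} (hg : Measurable g) :
    ∫⁻ y, g y ∂diffractionMeasure E W α μ = ∫⁻ x, α ^ 2 *
      ENNReal.ofReal (psiHat W (F.orthogonalProjectionOnto x)).re *
        g (E.orthogonalProjectionOnto x) ∂periodization μ := by
  have hq : Measurable (E.orthogonalProjectionOnto : EuclideanSpace ℝ (Fin d) → E) :=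
    E.orthogonalProjectionOnto.continuous.measurable
  rw [diffractionMeasure, lintegral_map hg hq]
  exact lintegral_withDensity_eq_lintegral_mul _ (measurable_psiHat_density hW hWb) (hg.comp hq)

theorem diffractionMeasure_apply (hα : α ≠ ∞) (hW : MeasurableSet W)
    (hWb : Bornology.IsBounded W) {C : Set E} (hC : MeasurableSet C) :
    diffractionMeasure E W α μ C = α ^ 2 * ∫⁻ x,
      ENNReal.ofReal (psiHat W (F.orthogonalProjectionOnto x)).re *
        C.indicator 1 (E.orthogonalProjectionOnto x) ∂periodization μ := by
  rw [← lintegral_indicator_one hC, lintegral_diffractionMeasure hW hWb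
    (measurable_one.indicator hC), ← lintegral_const_mul' _ _ (ENNReal.pow_ne_top hα)]
  simp_rw [mul_assoc]

variable [IsFiniteMeasure μ]

instance : SFinite (periodization μ) := by
  unfold periodization
  infer_instance

/-- This is what Tonelli's theorem requires in `hasTemperateGrowth_diffractionMeasure`, before any
finiteness on balls is known. -/
instance : SFinite (diffractionMeasure E W α μ) := by
  unfold diffractionMeasure
  infer_instance

theorem toReal_density (hW : MeasurableSet W) (hWb : Bornology.IsBounded W)
    (x : EuclideanSpace ℝ (Fin d)) :
    (α ^ 2 * ENNReal.ofReal (psiHat W (F.orthogonalProjectionOnto x)).re).toReal =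
      α.toReal ^ 2 * ‖𝓕 (W.indicator (1 : F → ℂ)) (F.orthogonalProjectionOnto x)‖ ^ 2 := by
  rw [psiHat_re hW hWb, ENNReal.toReal_mul, ENNReal.toReal_pow, ENNReal.toReal_ofReal (by positivity)]

theorem density_lt_top (hα : α ≠ ∞) : ∀ᵐ x ∂periodization μ,
    α ^ 2 * ENNReal.ofReal (psiHat W (F.orthogonalProjectionOnto x)).re < ∞ :=
  Eventually.of_forall fun _ => ENNReal.mul_lt_top (ENNReal.pow_lt_top hα.lt_top)
    ENNReal.ofReal_lt_top

theorem integral_diffractionMeasure (hα : α ≠ ∞) (hW : MeasurableSet W)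
    (hWb : Bornology.IsBounded W) {g : E → ℂ} (hg : Continuous g) :
    (Integrable g (diffractionMeasure E W α μ) ↔ Integrable (fun x => ((α.toReal ^ 2 *
      ‖𝓕 (W.indicator (1 : F → ℂ)) (F.orthogonalProjectionOnto x)‖ ^ 2 : ℝ) : ℂ) *
        g (E.orthogonalProjectionOnto x)) (periodization μ)) ∧
    ∫ y, g y ∂diffractionMeasure E W α μ = ∫ x, ((α.toReal ^ 2 *
      ‖𝓕 (W.indicator (1 : F → ℂ)) (F.orthogonalProjectionOnto x)‖ ^ 2 : ℝ) : ℂ) *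
        g (E.orthogonalProjectionOnto x) ∂periodization μ := by
  have hq : Measurable (E.orthogonalProjectionOnto : EuclideanSpace ℝ (Fin d) → E) :=
    E.orthogonalProjectionOnto.continuous.measurable
  have hd := measurable_psiHat_density (α := α) hW hWb
  constructor
  · rw [diffractionMeasure, integrable_map_measure hg.aestronglyMeasurable hq.aemeasurable,
      integrable_withDensity_iff_integrable_smul' hd (density_lt_top hα)]
    simp_rw [toReal_density hW hWb, Complex.real_smul]
    rfl
  · rw [diffractionMeasure, integral_map hq.aemeasurable hg.aestronglyMeasurable,
      integral_withDensity_eq_integral_toReal_smul hd (density_lt_top hα)]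
    simp_rw [toReal_density hW hWb, Complex.real_smul]

/-- The window factors of the two transforms combine into `α² ψ̂`, the density of the diffraction
measure, so pairings with `μ_p` descend to `E`. -/
theorem star_fourier_stripFun_mul (hα : (volume : Measure (EuclideanSpace ℝ (Fin d))) =
      α • (volume.prod volume).map (sumMap E F)) (b c : E → ℂ) (x : EuclideanSpace ℝ (Fin d)) :
    star (𝓕 (stripFun h W b) x) * 𝓕 (stripFun h W c) x = ((α.toReal ^ 2 *
      ‖𝓕 (W.indicator (1 : F → ℂ)) (F.orthogonalProjectionOnto x)‖ ^ 2 : ℝ) : ℂ) *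
        (star (𝓕 b (E.orthogonalProjectionOnto x)) * 𝓕 c (E.orthogonalProjectionOnto x)) := by
  rw [fourier_stripFun hα, fourier_stripFun hα]
  set w := 𝓕 (W.indicator (1 : F → ℂ)) (F.orthogonalProjectionOnto x)
  have h1 : star w * w = ((‖w‖ ^ 2 : ℝ) : ℂ) := by
    rw [mul_comm]
    change w * (starRingEnd ℂ) w = _
    rw [Complex.mul_conj, Complex.normSq_eq_norm_sq]
  have h2 : star (α.toReal : ℂ) = α.toReal := Complex.conj_ofReal _
  rw [star_mul, star_mul, h2, Complex.ofReal_mul, ← h1]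
  push_cast
  ring

theorem integrable_of_le_decay {b : E → ℂ} {C : ℝ} (hb : Measurable b)
    (hbC : ∀ y, ‖b y‖ ≤ C * decay (d + 1) y) : Integrable b := by
  have : Integrable (fun y : E => decay (d + 1) y) := by
    simp_rw [decay_eq_rpow]
    refine integrable_one_add_norm ?_
    have := Submodule.finrank_le E
    rw [finrank_euclideanSpace_fin] at this
    push_cast
    have : (Module.finrank ℝ E : ℝ) ≤ d := by exact_mod_cast this
    linarith
  exact (this.const_mul C).mono' hb.aestronglyMeasurable (Eventually.of_forall hbC)

theorem continuous_fourier_of_le_decay {b : E → ℂ} {C : ℝ} (hb : Measurable b)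
    (hbC : ∀ y, ‖b y‖ ≤ C * decay (d + 1) y) : Continuous (𝓕 b) :=
  continuous_fourier (integrable_of_le_decay hb hbC)

/-- The diffraction measure and the autocorrelation, tested against products of Fourier
transforms. -/
theorem integral_star_fourier_mul_diffractionMeasure (h : IsCompl E F) (hαt : α ≠ ∞)
    (hα : (volume : Measure (EuclideanSpace ℝ (Fin d))) =
      α • (volume.prod volume).map (sumMap E F)) (hW : MeasurableSet W)
    (hWb : Bornology.IsBounded W) {b c : E → ℂ} {Cb Cc : ℝ} (hb : Measurable b)
    (hbC : ∀ y, ‖b y‖ ≤ Cb * decay (d + 1) y) (hc : Measurable c)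
    (hcC : ∀ y, ‖c y‖ ≤ Cc * decay (d + 1) y) :
    Integrable (fun y => star (𝓕 b y) * 𝓕 c y) (diffractionMeasure E W α μ) ∧
    ∫ y, star (𝓕 b y) * 𝓕 c y ∂diffractionMeasure E W α μ =
      ∑' n, fourierCoef μ n * (α.toReal * psi W (F.projectionOnto E h.symm (latticePoint n)) *
        ∫ y, star (b y) * c (y + E.projectionOnto F h (latticePoint n))) := by
  obtain ⟨K, hK, hbound⟩ := exists_cubeBound_stripFun h hWb
  have hs : ∀ C : ℝ, Summable fun j : Fin d → ℤ => C * (K * decay (d + 1) (latticePoint j)) :=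
    fun C => (summable_decay_latticePoint.mul_left K).mul_left C
  have key := integral_star_fourier_mul (μ := μ) (hbound Cb b hbC) (hbound Cc c hcC) (hs _) (hs _)
    (measurable_stripFun hW hb) (measurable_stripFun hW hc)
  simp_rw [star_fourier_stripFun_mul hα, shiftCoeff_stripFun hα hW hWb] at key
  have hcont : Continuous fun y => star (𝓕 b y) * 𝓕 c y :=
    (continuous_fourier_of_le_decay hb hbC).star.mul (continuous_fourier_of_le_decay hc hcC)
  obtain ⟨h1, h2⟩ := integral_diffractionMeasure (μ := μ) hαt hW hWb hcont
  exact ⟨h1.2 key.1, h2.trans key.2⟩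

/-- The `L²` norms of Fourier transforms are controlled by the decay of the functions. -/
theorem exists_lintegral_norm_fourier_sq_le (h : IsCompl E F)
    (hα : (volume : Measure (EuclideanSpace ℝ (Fin d))) =
      α • (volume.prod volume).map (sumMap E F)) (hαt : α ≠ ∞) (hW : MeasurableSet W)
    (hWb : Bornology.IsBounded W) (C : ℝ) : ∃ K : ℝ≥0∞, K ≠ ∞ ∧ ∀ b : E → ℂ, Measurable b →
      (∀ y, ‖b y‖ ≤ C * decay (d + 1) y) →
      ∫⁻ y, ENNReal.ofReal (‖𝓕 b y‖ ^ 2) ∂diffractionMeasure E W α μ ≤ K := by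
  obtain ⟨K, hK, hbound⟩ := exists_cubeBound_stripFun h hWb
  set M : (Fin d → ℤ) → ℝ := fun j => C * (K * decay (d + 1) (latticePoint j))
  have hs : Summable M := (summable_decay_latticePoint.mul_left K).mul_left C
  refine ⟨ENNReal.ofReal (∑' n, ∑' j, M j * M (j + n)) * μ Set.univ,
    ENNReal.mul_ne_top ENNReal.ofReal_ne_top (measure_ne_top _ _), fun b hb hbC => ?_⟩
  have hcont : Continuous fun y => ‖𝓕 b y‖ ^ 2 :=
    (continuous_fourier_of_le_decay hb hbC).norm.pow 2
  rw [lintegral_diffractionMeasure hW hWb hcont.measurable.ennreal_ofReal]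
  refine le_trans (le_of_eq ?_) (lintegral_norm_fourier_sq_le (hbound C b hbC) hs
    (measurable_stripFun hW hb))
  refine lintegral_congr fun x => ?_
  rw [psiHat_re hW hWb, fourier_stripFun hα, norm_mul, norm_mul, mul_pow, mul_pow,
    Complex.norm_real, Real.norm_of_nonneg ENNReal.toReal_nonneg,
    ENNReal.ofReal_mul (by positivity), ENNReal.ofReal_mul (by positivity),
    ENNReal.ofReal_pow ENNReal.toReal_nonneg, ENNReal.ofReal_toReal hαt]
  ring

end DiffractionMeasure

/-! ### Modulated Gaussian functions -/

section Gaussian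

variable {V : Type*} [NormedAddCommGroup V] [InnerProductSpace ℝ V] [FiniteDimensional ℝ V]
  [MeasurableSpace V] [BorelSpace V]

/-- The modulated Gaussian function whose Fourier transform is a translated Gaussian function. -/
noncomputable def modulatedGaussian (a : V) (y : V) : ℂ :=
  Complex.exp (-(Real.pi : ℂ) * ‖y‖ ^ 2 + 2 * Real.pi * Complex.I * inner ℝ a y)

theorem fourier_modulatedGaussian (a ξ : V) :
    𝓕 (modulatedGaussian a) ξ = ((Real.exp (-Real.pi * ‖a - ξ‖ ^ 2) : ℝ) : ℂ) := by
  have hpi : (Real.pi : ℂ) ≠ 0 := Complex.ofReal_ne_zero.2 Real.pi_ne_zero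
  have := fourier_gaussian_innerProductSpace' (V := V) (b := (Real.pi : ℂ))
    (by simpa using Real.pi_pos) a ξ
  unfold modulatedGaussian
  rw [this, div_self hpi, Complex.one_cpow, one_mul]
  push_cast
  congr 1
  field_simp

theorem measurable_modulatedGaussian (a : V) : Measurable (modulatedGaussian a) := by
  unfold modulatedGaussian
  refine Continuous.measurable ?_
  fun_prop

/-- Modulation has modulus one, so the bound is uniform in `a`; this gives control of the
diffraction measure that is uniform in the location. -/
theorem norm_modulatedGaussian_le (n : ℕ) (a y : V) :
    ‖modulatedGaussian a y‖ ≤ Real.exp (n ^ 2) * decay n y := by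
  have h1 : ‖modulatedGaussian a y‖ = Real.exp (-Real.pi * ‖y‖ ^ 2) := by
    rw [modulatedGaussian, Complex.norm_exp]
    congr 1
    have : (-(Real.pi : ℂ) * ‖y‖ ^ 2 + 2 * Real.pi * Complex.I * (inner ℝ a y : ℝ)) =
        ((-Real.pi * ‖y‖ ^ 2 : ℝ) : ℂ) + ((2 * Real.pi * inner ℝ a y : ℝ) : ℂ) * Complex.I := by
      push_cast
      ring
    rw [this, Complex.add_re, Complex.ofReal_re, Complex.re_ofReal_mul, Complex.I_re, mul_zero,
      add_zero]
  rw [h1, decay, ← div_eq_mul_inv, le_div_iff₀ (by positivity)]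
  -- The constant `e^{n²}` comes from `n ‖y‖ ≤ n² + π ‖y‖²`.
  have h2 : (1 + ‖y‖) ^ n ≤ Real.exp (n * ‖y‖) := by
    rw [Real.exp_nat_mul]
    exact pow_le_pow_left₀ (by positivity) (by linarith [Real.add_one_le_exp ‖y‖]) n
  refine (mul_le_mul_of_nonneg_left h2 (Real.exp_pos _).le).trans ?_
  rw [← Real.exp_add, Real.exp_le_exp]
  nlinarith [Real.pi_gt_three, sq_nonneg ((n : ℝ) - ‖y‖ ), sq_nonneg ‖y‖, sq_nonneg (n : ℝ)]

end Gaussian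

/-! ### Temperate growth of both measures -/

section TemperateGrowth

variable {d : ℕ} {E F : Submodule ℝ (EuclideanSpace ℝ (Fin d))}
  {W : Set F} {α : ℝ≥0∞} {μ : Measure (EuclideanSpace ℝ (Fin d))}
  [IsFiniteMeasure μ]

/-- Squared Gaussians centred at `a` are squared transforms of functions with a common decay, so
their integrals are bounded uniformly in `a`. Integrating this bound against an integrable weight in
`a` and exchanging the integrals bounds the integral of the weight itself. -/
theorem hasTemperateGrowth_diffractionMeasure (h : IsCompl E F)
    (hα : (volume : Measure (EuclideanSpace ℝ (Fin d))) =
      α • (volume.prod volume).map (sumMap E F)) (hαt : α ≠ ∞) (hW : MeasurableSet W)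
    (hWb : Bornology.IsBounded W) : (diffractionMeasure E W α μ).HasTemperateGrowth := by
  set ν := diffractionMeasure E W α μ
  obtain ⟨K, hK, hKb⟩ := exists_lintegral_norm_fourier_sq_le (μ := μ) h hα hαt hW hWb
    (Real.exp ((d + 1 : ℕ) ^ 2))
  have h1 : ∀ a : E, ∫⁻ y, ENNReal.ofReal (Real.exp (-Real.pi * ‖a - y‖ ^ 2) ^ 2) ∂ν ≤ K := by
    intro a
    refine le_trans (le_of_eq ?_) (hKb _ (measurable_modulatedGaussian a)
      (norm_modulatedGaussian_le (d + 1) a))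
    refine lintegral_congr fun y => ?_
    rw [fourier_modulatedGaussian, Complex.norm_real, Real.norm_of_nonneg (Real.exp_pos _).le]
  set f : E → E → ℝ≥0∞ := fun a y => ENNReal.ofReal (Real.exp (-Real.pi * ‖a - y‖ ^ 2) ^ 2) *
    ENNReal.ofReal (decay (d + 1) a) with hf
  have hdm : Measurable fun a : E => ENNReal.ofReal (decay (d + 1) a) :=
    (continuous_decay _).measurable.ennreal_ofReal
  have hfm : Measurable (Function.uncurry f) := by
    refine Measurable.mul ?_ (hdm.comp measurable_fst)
    refine Measurable.ennreal_ofReal (Continuous.measurable ?_)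
    fun_prop
  have hdecay : Integrable (fun a : E => decay (d + 1) a) := by
    simpa using (integrable_of_le_decay (d := d) (E := E) (C := 1)
      (b := fun a => ((decay (d + 1) a : ℝ) : ℂ))
      (Complex.continuous_ofReal.comp (continuous_decay _)).measurable fun y => by
        rw [Complex.norm_real, Real.norm_of_nonneg (decay_pos _ _).le, one_mul]).re
  have h2 : ∫⁻ a, ∫⁻ y, f a y ∂ν ≠ ∞ := by
    refine ne_top_of_le_ne_top (ENNReal.mul_ne_top hK hdecay.lintegral_lt_top.ne)
      (le_trans (lintegral_mono fun a => ?_) (lintegral_const_mul K hdm).le)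
    rw [hf]
    simp only
    rw [lintegral_mul_const' _ _ ENNReal.ofReal_ne_top]
    exact mul_le_mul' (h1 a) le_rfl
  set v := volume (Metric.closedBall (0 : E) 1)
  have hv0 : v ≠ 0 := (Metric.measure_closedBall_pos volume _ one_pos).ne'
  -- For `‖a - y‖ ≤ 1` the Gaussian is at least `e^{-π}`, and the weight at `a` is at least `2^{-(d
  -- + 1)}` times the weight at `y`.
  set c : ℝ := Real.exp (-Real.pi) ^ 2 * (2 ^ (d + 1))⁻¹ with hcdef
  have hc : 0 < c := by positivity
  have h3 : ∀ y, ENNReal.ofReal c * v * ENNReal.ofReal (decay (d + 1) y) ≤ ∫⁻ a, f a y := by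
    intro y
    have hball : volume (Metric.closedBall y 1) = v := Measure.addHaar_closedBall_center _ _ _
    refine le_trans ?_ (setLIntegral_le_lintegral (Metric.closedBall y 1) _)
    calc ENNReal.ofReal c * v * ENNReal.ofReal (decay (d + 1) y)
        = ∫⁻ _a in Metric.closedBall y 1, ENNReal.ofReal (c * decay (d + 1) y) := by
          rw [lintegral_const, Measure.restrict_apply_univ, hball, ENNReal.ofReal_mul hc.le]
          ring
      _ ≤ ∫⁻ a in Metric.closedBall y 1, f a y := by
          refine setLIntegral_mono' Metric.isClosed_closedBall.measurableSet fun a ha => ?_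
          rw [hf]
          simp only
          rw [← ENNReal.ofReal_mul (by positivity)]
          refine ENNReal.ofReal_le_ofReal ?_
          rw [hcdef, mul_assoc]
          have ha' : ‖a - y‖ ≤ 1 := mem_closedBall_iff_norm.1 ha
          refine mul_le_mul ?_ ?_ (by have := decay_pos (d + 1) y; positivity) (by positivity)
          · refine pow_le_pow_left₀ (Real.exp_pos _).le (Real.exp_le_exp.2 ?_) 2
            nlinarith [Real.pi_pos, norm_nonneg (a - y), pow_le_one₀ (n := 2) (norm_nonneg (a - y)) ha']
          · rw [inv_mul_le_iff₀ (by positivity)]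
            refine decay_le_mul _ ?_
            have := norm_add_le (a - y) y
            rw [sub_add_cancel] at this
            linarith [norm_nonneg y]
  have h4 : ∫⁻ y, ENNReal.ofReal (decay (d + 1) y) ∂ν ≠ ∞ := by
    rw [lintegral_lintegral_swap hfm.aemeasurable] at h2
    have h5 : ENNReal.ofReal c * v * ∫⁻ y, ENNReal.ofReal (decay (d + 1) y) ∂ν ≠ ∞ := by
      rw [← lintegral_const_mul _ hdm]
      exact ne_top_of_le_ne_top h2 (lintegral_mono h3)
    intro h6
    rw [h6, ENNReal.mul_top (mul_ne_zero (by simpa using hc) hv0)] at h5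
    exact h5 rfl
  refine ⟨⟨d + 1, ?_⟩⟩
  simp_rw [← decay_eq_rpow]
  refine ⟨(continuous_decay _).aestronglyMeasurable, ?_⟩
  rw [hasFiniteIntegral_iff_ofReal (Eventually.of_forall fun y => (decay_pos _ _).le)]
  exact h4.lt_top

variable {h : IsCompl E F} {w : (Fin d → ℤ) → ℝ}

/-- On the band `‖k_F‖ ≤ R` that carries the weights, `1 + ‖k‖` is at most `(1 + |R|) (1 + ‖k_E‖)`,
which reduces the sum to one over the lattice in `ℝ^d`. -/
theorem summable_mul_decay {R C : ℝ} (hw : ∀ k, 0 ≤ w k) (hC : ∀ k, w k ≤ C)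
    (hR : ∀ k, R < ‖F.projectionOnto E h.symm (latticePoint k)‖ → w k = 0) :
    Summable fun k => w k * decay (d + 1) (E.projectionOnto F h (latticePoint k)) := by
  have hC0 : 0 ≤ C := (hw 0).trans (hC 0)
  have hs := (summable_decay_latticePoint (d := d)).mul_left (C * (1 + |R|) ^ (d + 1))
  refine hs.of_nonneg_of_le (fun k => mul_nonneg (hw k) (decay_pos _ _).le) fun k => ?_
  by_cases hk : R < ‖F.projectionOnto E h.symm (latticePoint k)‖
  · rw [hR k hk, zero_mul]
    have := decay_pos (d + 1) (latticePoint k)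
    positivity
  · rw [mul_assoc]
    refine mul_le_mul (hC k) (decay_le_mul _ ?_) (decay_pos _ _).le hC0
    have h1 : ‖latticePoint k‖ ≤ ‖E.projectionOnto F h (latticePoint k)‖ +
        ‖F.projectionOnto E h.symm (latticePoint k)‖ := by
      nth_rewrite 1 [← Submodule.projection_add_projection_eq_self h (latticePoint k)]
      exact norm_add_le _ _
    have h2 := (not_lt.1 hk).trans (le_abs_self R)
    nlinarith [norm_nonneg (E.projectionOnto F h (latticePoint k)), abs_nonneg R,
      mul_nonneg (abs_nonneg R) (norm_nonneg (E.projectionOnto F h (latticePoint k)))]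

theorem hasTemperateGrowth_latticeMeasure {R C : ℝ} (hw : ∀ k, 0 ≤ w k) (hC : ∀ k, w k ≤ C)
    (hR : ∀ k, R < ‖F.projectionOnto E h.symm (latticePoint k)‖ → w k = 0) :
    (latticeMeasure h w).HasTemperateGrowth := by
  refine ⟨⟨d + 1, ?_⟩⟩
  simp_rw [← decay_eq_rpow]
  refine ⟨(continuous_decay _).aestronglyMeasurable, ?_⟩
  rw [hasFiniteIntegral_iff_ofReal (Eventually.of_forall fun y => (decay_pos _ _).le),
    latticeMeasure, lintegral_sum_measure]
  have hm : Measurable fun y : E => ENNReal.ofReal (decay (d + 1) y) :=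
    (continuous_decay _).measurable.ennreal_ofReal
  simp_rw [lintegral_smul_measure, lintegral_dirac' _ hm, smul_eq_mul]
  simp_rw [← ENNReal.ofReal_mul (hw _)]
  rw [← ENNReal.ofReal_tsum_of_nonneg (fun k => mul_nonneg (hw k) (decay_pos _ _).le)
    (summable_mul_decay (h := h) hw hC hR)]
  exact ENNReal.ofReal_lt_top

end TemperateGrowth

/-! ### An approximate identity and its Fourier transforms -/

section ApproximateIdentity

variable {V : Type*} [NormedAddCommGroup V] [InnerProductSpace ℝ V] [FiniteDimensional ℝ V]
  [MeasurableSpace V] [BorelSpace V]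

/-- Bump functions whose supports shrink to the origin. -/
noncomputable def shrinkingBump (V : Type*) [NormedAddCommGroup V] (n : ℕ) :
    ContDiffBump (0 : V) where
  rIn := ((n : ℝ) + 2)⁻¹
  rOut := ((n : ℝ) + 1)⁻¹
  rIn_pos := by positivity
  rIn_lt_rOut := inv_strictAnti₀ (by positivity) (by linarith)

theorem tendsto_rOut_shrinkingBump :
    Tendsto (fun n => (shrinkingBump V n).rOut) atTop (𝓝 0) := by
  simpa only [one_div, shrinkingBump] using tendsto_one_div_add_atTop_nhds_zero_nat (𝕜 := ℝ)

/-- An approximate identity. -/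
noncomputable def approxIdentity (n : ℕ) (y : V) : ℝ := (shrinkingBump V n).normed volume y

theorem approxIdentity_nonneg (n : ℕ) (y : V) : 0 ≤ approxIdentity n y :=
  (shrinkingBump V n).nonneg_normed y

theorem continuous_approxIdentity (n : ℕ) : Continuous (approxIdentity n : V → ℝ) :=
  (shrinkingBump V n).continuous_normed

theorem integral_approxIdentity (n : ℕ) : ∫ y : V, approxIdentity n y = 1 :=
  (shrinkingBump V n).integral_normed

theorem integrable_approxIdentity (n : ℕ) : Integrable (approxIdentity n : V → ℝ) :=
  (shrinkingBump V n).integrable_normed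

theorem approxIdentity_eq_zero (n : ℕ) {y : V} (hy : 1 < ‖y‖) : approxIdentity n y = 0 := by
  by_contra h
  have h1 : y ∈ Function.support ((shrinkingBump V n).normed volume) := h
  rw [ContDiffBump.support_normed_eq, mem_ball_zero_iff] at h1
  have h2 : (shrinkingBump V n).rOut ≤ 1 := by
    simp only [shrinkingBump]
    exact inv_le_one_of_one_le₀ (by linarith [(Nat.cast_nonneg n : (0 : ℝ) ≤ n)])
  linarith

theorem exists_approxIdentity_le_decay (m n : ℕ) :
    ∃ C, ∀ y : V, ‖((approxIdentity n y : ℝ) : ℂ)‖ ≤ C * decay m y := by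
  set C := 1 / volume.real (Metric.closedBall (0 : V) (shrinkingBump V n).rIn)
  have hC0 : 0 ≤ C := by positivity
  refine ⟨C * 2 ^ m, fun y => ?_⟩
  rw [Complex.norm_real, Real.norm_of_nonneg (approxIdentity_nonneg n y)]
  have hd := decay_pos m y
  by_cases hy : 1 < ‖y‖
  · rw [approxIdentity_eq_zero n hy]
    positivity
  · have h1 : approxIdentity n y ≤ C :=
      ContDiffBump.normed_le_div_measure_closedBall_rIn _ _ y
    have h2 : decay m (0 : V) ≤ 2 ^ m * decay m y := by
      refine decay_le_mul m ?_
      rw [norm_zero]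
      linarith
    have h3 : decay m (0 : V) = 1 := by simp [decay]
    rw [h3] at h2
    calc approxIdentity n y ≤ C * 1 := by rwa [mul_one]
      _ ≤ C * (2 ^ m * decay m y) := mul_le_mul_of_nonneg_left h2 hC0
      _ = C * 2 ^ m * decay m y := by ring

/-- The bumps are even, so the integral is a convolution evaluated at `-v`. -/
theorem tendsto_integral_mul_approxIdentity {g : V → ℂ} (hg : Continuous g) (v : V) :
    Tendsto (fun n => ∫ y, g y * ((approxIdentity n (y + v) : ℝ) : ℂ)) atTop (𝓝 (g (-v))) := by
  refine (ContDiffBump.convolution_tendsto_right_of_continuous (μ := volume)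
    (tendsto_rOut_shrinkingBump (V := V)) hg (-v)).congr fun n => ?_
  rw [convolution]
  refine Eq.trans ?_ (integral_sub_left_eq_self
    (fun y => g y * ((approxIdentity n (y + v) : ℝ) : ℂ)) volume (-v))
  refine integral_congr_ae (Eventually.of_forall fun t => ?_)
  simp only [ContinuousLinearMap.lsmul_apply, Complex.real_smul]
  have : -v - t + v = -t := by abel
  rw [this]
  unfold approxIdentity
  rw [ContDiffBump.normed_neg, mul_comm]

theorem fourier_approxIdentity_eq (n : ℕ) (ξ : V) :
    𝓕 (fun y : V => ((approxIdentity n y : ℝ) : ℂ)) ξ =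
      ∫ y : V, ((Real.fourierChar (-inner ℝ y ξ) : Circle) : ℂ) *
        ((approxIdentity n (y + 0) : ℝ) : ℂ) := by
  rw [Real.fourier_eq]
  simp_rw [add_zero, Circle.smul_def, smul_eq_mul]

theorem tendsto_fourier_approxIdentity (ξ : V) :
    Tendsto (fun n => 𝓕 (fun y : V => ((approxIdentity n y : ℝ) : ℂ)) ξ) atTop (𝓝 1) := by
  simp_rw [fourier_approxIdentity_eq]
  have hc : Continuous fun y : V => ((Real.fourierChar (-inner ℝ y ξ) : Circle) : ℂ) :=
    continuous_subtype_val.comp (Real.continuous_fourierChar.comp (by fun_prop))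
  have := tendsto_integral_mul_approxIdentity hc 0
  simpa using this

theorem norm_fourier_approxIdentity_le (n : ℕ) (ξ : V) :
    ‖𝓕 (fun y : V => ((approxIdentity n y : ℝ) : ℂ)) ξ‖ ≤ 1 := by
  rw [Real.fourier_eq, ← integral_approxIdentity (V := V) n]
  refine norm_integral_le_of_norm_le (integrable_approxIdentity n) (Eventually.of_forall fun y => ?_)
  rw [Circle.norm_smul, Complex.norm_real, Real.norm_of_nonneg (approxIdentity_nonneg n y)]

/-- All bumps live in the unit ball and have mass one, so the bound is uniform in `n`; it provides
the dominating series for the sum over the lattice. -/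
theorem norm_integral_mul_approxIdentity_le {m : ℕ} {C : ℝ} {g : V → ℂ}
    (hg : ∀ y, ‖g y‖ ≤ C * decay m y) (n : ℕ) (v : V) :
    ‖∫ y, g y * ((approxIdentity n (y + v) : ℝ) : ℂ)‖ ≤ C * 2 ^ m * decay m v := by
  have hC : 0 ≤ C :=
    (mul_nonneg_iff_of_pos_right (decay_pos m _)).1 ((norm_nonneg _).trans (hg 0))
  have h1 : ∫ y : V, C * 2 ^ m * decay m v * approxIdentity n (y + v) = C * 2 ^ m * decay m v := by
    rw [integral_const_mul, integral_add_right_eq_self, integral_approxIdentity, mul_one]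
  rw [← h1]
  refine norm_integral_le_of_norm_le
    (((integrable_approxIdentity n).comp_add_right v).const_mul _) (Eventually.of_forall fun y => ?_)
  rw [norm_mul, Complex.norm_real, Real.norm_of_nonneg (approxIdentity_nonneg n _)]
  by_cases hy : 1 < ‖y + v‖
  · rw [approxIdentity_eq_zero n hy, mul_zero, mul_zero]
  · refine mul_le_mul_of_nonneg_right ((hg y).trans ?_) (approxIdentity_nonneg n _)
    rw [mul_assoc]
    refine mul_le_mul_of_nonneg_left (decay_le_mul m ?_) hC
    have h2 := norm_sub_le (y + v) y
    rw [add_sub_cancel_left] at h2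
    linarith [norm_nonneg y]

theorem exists_norm_schwartz_le_decay (f : SchwartzMap V ℂ) (m : ℕ) :
    ∃ C, ∀ y, ‖f y‖ ≤ C * decay m y := by
  refine ⟨2 ^ m * (Finset.Iic (m, 0)).sup (fun p => SchwartzMap.seminorm ℝ p.1 p.2) f,
    fun y => ?_⟩
  have := SchwartzMap.one_add_le_sup_seminorm_apply (𝕜 := ℝ) (m := (m, 0)) le_rfl le_rfl f y
  rw [norm_iteratedFDeriv_zero, mul_comm] at this
  rw [decay, ← div_eq_mul_inv, le_div_iff₀ (by positivity)]
  exact this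

end ApproximateIdentity

/-! ### The Fourier transform of the autocorrelation -/

section FourierTransform

variable {d : ℕ} {E F : Submodule ℝ (EuclideanSpace ℝ (Fin d))}
  {W : Set F} {α : ℝ≥0∞} {μ : Measure (EuclideanSpace ℝ (Fin d))} [IsFiniteMeasure μ]
  {κ : (Fin d → ℤ) → ℝ}

/-- The weights of the autocorrelation. -/
noncomputable def pairWeight (h : IsCompl E F) (W : Set F) (α : ℝ≥0∞) (κ : (Fin d → ℤ) → ℝ)
    (k : Fin d → ℤ) : ℝ :=
  α.toReal * (κ k * psi W (F.projectionOnto E h.symm (latticePoint k)))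

theorem pairWeight_nonneg (h : IsCompl E F) (hW : MeasurableSet W) (hκ : ∀ k, 0 ≤ κ k)
    (k : Fin d → ℤ) : 0 ≤ pairWeight h W α κ k :=
  mul_nonneg ENNReal.toReal_nonneg (mul_nonneg (hκ k) (psi_nonneg hW _))

theorem pairWeight_le (h : IsCompl E F) (hW : MeasurableSet W) (hWb : Bornology.IsBounded W)
    (hκ : ∀ k, 0 ≤ κ k) (hκ0 : ∀ k, κ k ≤ κ 0) (k : Fin d → ℤ) :
    pairWeight h W α κ k ≤ α.toReal * (κ 0 * volume.real W) := by
  refine mul_le_mul_of_nonneg_left (mul_le_mul (hκ0 k) ?_ (psi_nonneg hW _) (hκ 0))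
    ENNReal.toReal_nonneg
  rw [psi_eq hW]
  exact measureReal_mono Set.inter_subset_left hWb.measure_lt_top.ne

theorem pairWeight_neg (h : IsCompl E F) (hW : MeasurableSet W) (hWb : Bornology.IsBounded W)
    (hκn : ∀ k, κ (-k) = κ k) (k : Fin d → ℤ) : pairWeight h W α κ (-k) = pairWeight h W α κ k := by
  rw [pairWeight, pairWeight, hκn, latticePoint_neg, map_neg, psi_neg hW hWb]

theorem pairWeight_eq_zero (h : IsCompl E F) (hW : MeasurableSet W) {R : ℝ}
    (hR : ∀ t ∈ W, ‖t‖ ≤ R) (k : Fin d → ℤ)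
    (hk : 2 * R < ‖F.projectionOnto E h.symm (latticePoint k)‖) : pairWeight h W α κ k = 0 := by
  rw [pairWeight, psi_eq_zero_of_lt hW hR hk, mul_zero, mul_zero]

/-- The Fourier transform of the autocorrelation is the diffraction measure. -/
theorem isFourierTransform_latticeMeasure (h : IsCompl E F) (hαt : α ≠ ∞)
    (hα : (volume : Measure (EuclideanSpace ℝ (Fin d))) =
      α • (volume.prod volume).map (sumMap E F)) (hW : MeasurableSet W)
    (hWb : Bornology.IsBounded W) (hκ : ∀ k, 0 ≤ κ k) (hκ0 : ∀ k, κ k ≤ κ 0)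
    (hκn : ∀ k, κ (-k) = κ k) (hμ : ∀ k, fourierCoef μ k = κ k) :
    IsFourierTransform (latticeMeasure h (pairWeight h W α κ)) (diffractionMeasure E W α μ) := by
  obtain ⟨R, hR⟩ := hWb.exists_norm_le
  set w := pairWeight h W α κ with hwdef
  set ν := diffractionMeasure E W α μ
  have hw0 := pairWeight_nonneg (α := α) h hW hκ
  have hwR := pairWeight_eq_zero (α := α) (κ := κ) h hW hR
  have hwC := pairWeight_le (α := α) h hW hWb hκ hκ0
  have hγ : (latticeMeasure h w).HasTemperateGrowth :=
    hasTemperateGrowth_latticeMeasure (h := h) hw0 hwC hwR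
  have hν : ν.HasTemperateGrowth := hasTemperateGrowth_diffractionMeasure h hα hαt hW hWb
  refine ⟨hγ, hν, ?_⟩
  ext f
  rw [TemperedDistribution.fourier_apply]
  refine (Measure.toTemperedDistribution_apply _ _).trans
    (Eq.trans ?_ (Measure.toTemperedDistribution_apply _ _).symm)
  have hwdecay := summable_mul_decay (h := h) hw0 hwC hwR
  obtain ⟨C, hC⟩ := exists_norm_schwartz_le_decay (𝓕 f) (d + 1)
  -- The weights are even. Replacing `k` by `-k` yields values at `-k_E`, the form in which the
  -- approximate identity delivers them.
  have hleft : ∫ x, 𝓕 f x ∂latticeMeasure h w =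
      ∑' k, (w k : ℂ) * 𝓕 f (-E.projectionOnto F h (latticePoint k)) := by
    have h1 := (𝓕 f).integrable (μ := latticeMeasure h w)
    have h2 := (hasSum_integral_measure h1).tsum_eq
    rw [latticeMeasure, ← h2, ← (Equiv.neg (Fin d → ℤ)).tsum_eq]
    refine tsum_congr fun k => ?_
    rw [integral_smul_measure, integral_dirac, Equiv.neg_apply, ENNReal.toReal_ofReal (hw0 _),
      pairWeight_neg h hW hWb hκn, latticePoint_neg, map_neg, Complex.real_smul]
  -- By Fourier inversion `star (𝓕 b) = f`, so the product tested below is `f` times a factor `𝓕 (c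
  -- n)` that tends to one.
  set b : E → ℂ := fun y => star (𝓕 f y) with hb
  have hbm : Measurable b := ((𝓕 f).continuous.star).measurable
  have hbC : ∀ y, ‖b y‖ ≤ C * decay (d + 1) y := fun y => by
    rw [hb, norm_star]
    exact hC y
  have hFb : ∀ ξ, star (𝓕 b ξ) = f ξ := fun ξ => by
    rw [hb, fourier_star, star_star, ← Real.fourierInv_eq_fourier_neg, ← SchwartzMap.fourierInv_coe,
      FourierTransform.fourierInv_fourier_eq]
  set c : ℕ → E → ℂ := fun n y => ((approxIdentity n y : ℝ) : ℂ) with hc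
  have hcm : ∀ n, Measurable (c n) := fun n =>
    (Complex.continuous_ofReal.comp (continuous_approxIdentity n)).measurable
  have key : ∀ n, ∫ y, f y * 𝓕 (c n) y ∂ν = ∑' k, (w k : ℂ) *
      ∫ y, 𝓕 f y * ((approxIdentity n (y + E.projectionOnto F h (latticePoint k)) : ℝ) : ℂ) := by
    intro n
    obtain ⟨C', hC'⟩ := exists_approxIdentity_le_decay (V := E) (d + 1) n
    have := (integral_star_fourier_mul_diffractionMeasure (μ := μ) h hαt hα hW hWb hbm hbC
      (hcm n) hC').2
    simp_rw [hFb] at this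
    rw [this]
    refine tsum_congr fun k => ?_
    rw [hμ, hwdef, pairWeight]
    simp only [hb, hc, star_star]
    push_cast
    ring
  have lim1 : Tendsto (fun n => ∫ y, f y * 𝓕 (c n) y ∂ν) atTop (𝓝 (∫ y, f y ∂ν)) := by
    refine tendsto_integral_of_dominated_convergence (fun y => ‖f y‖) (fun n => ?_) f.integrable.norm
      (fun n => Eventually.of_forall fun y => ?_) (Eventually.of_forall fun y => ?_)
    · refine (f.continuous.mul (continuous_fourier ?_)).aestronglyMeasurable
      exact (integrable_approxIdentity n).ofReal
    · rw [norm_mul]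
      exact mul_le_of_le_one_right (norm_nonneg _) (norm_fourier_approxIdentity_le n y)
    · simpa using (tendsto_fourier_approxIdentity y).const_mul (f y)
  have lim2 : Tendsto (fun n => ∑' k, (w k : ℂ) * ∫ y, 𝓕 f y *
      ((approxIdentity n (y + E.projectionOnto F h (latticePoint k)) : ℝ) : ℂ)) atTop
      (𝓝 (∑' k, (w k : ℂ) * 𝓕 f (-E.projectionOnto F h (latticePoint k)))) := by
    refine tendsto_tsum_of_dominated_convergence (hwdecay.mul_left (C * 2 ^ (d + 1)))
      (fun k => (tendsto_integral_mul_approxIdentity (𝓕 f).continuous _).const_mul _)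
      (Eventually.of_forall fun n k => ?_)
    rw [norm_mul, Complex.norm_real, Real.norm_of_nonneg (hw0 k), mul_left_comm]
    exact mul_le_mul_of_nonneg_left (norm_integral_mul_approxIdentity_le hC n _) (hw0 k)
  rw [hleft]
  simp_rw [key] at lim1
  exact tendsto_nhds_unique lim2 lim1

end FourierTransform

/-! ### The spectral measure of the constant process -/

section FullLattice

variable {d : ℕ} {μ : Measure (EuclideanSpace ℝ (Fin d))} [IsFiniteMeasure μ]

theorem re_latticeChar (k : Fin d → ℤ) (x : EuclideanSpace ℝ (Fin d)) :
    (latticeChar k x).re = Real.cos (2 * Real.pi * inner ℝ (latticePoint k) x) := by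
  rw [latticeChar, ← Complex.ofReal_neg, Complex.exp_ofReal_mul_I_re, Real.cos_neg]

/-- The mass is one and `1 - Re e^{-2πi⟨k, x⟩}` is nonnegative with integral zero, so `⟨k, x⟩` is
almost surely an integer; the unit vectors `k` suffice to make every coordinate of `x` an integer.
-/
theorem ae_eq_latticePoint_of_fourierCoef_eq_one (hμ : ∀ k, fourierCoef μ k = 1) :
    ∀ᵐ x ∂μ, x = latticePoint (floorVec x) := by
  have hint : ∀ k : Fin d → ℤ, Integrable (latticeChar k) μ := fun k =>
    Integrable.of_bound (continuous_latticeChar k).aestronglyMeasurable 1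
      (Eventually.of_forall fun x => (norm_latticeChar k x).le)
  have h0 : μ.real Set.univ = 1 := by
    have h1 : ∫ x, latticeChar 0 x ∂μ = 1 := hμ 0
    simp_rw [latticeChar_zero] at h1
    rw [integral_const, Complex.real_smul, mul_one] at h1
    exact_mod_cast h1
  have h1 : ∀ k : Fin d → ℤ, ∀ᵐ x ∂μ, (latticeChar k x).re = 1 := by
    intro k
    have hre : Integrable (fun x => (latticeChar k x).re) μ := (hint k).re
    have h2 : ∫ x, (1 - (latticeChar k x).re) ∂μ = 0 := by
      have h3 : ∫ x, (latticeChar k x).re ∂μ = (∫ x, latticeChar k x ∂μ).re :=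
        integral_re (hint k)
      have h4 : ∫ x, latticeChar k x ∂μ = 1 := hμ k
      rw [integral_sub (integrable_const _) hre, integral_const, h0, h3, h4]
      simp
    have hnn : ∀ x, 0 ≤ 1 - (latticeChar k x).re := fun x => by
      rw [sub_nonneg, re_latticeChar]
      exact Real.cos_le_one _
    have h5 := (integral_eq_zero_iff_of_nonneg hnn ((integrable_const _).sub hre)).1 h2
    filter_upwards [h5] with x hx
    simp only [Pi.zero_apply] at hx
    linarith
  filter_upwards [ae_all_iff.2 fun i : Fin d => h1 (Pi.single i 1)] with x hx
  ext i
  have h2 := hx i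
  rw [re_latticeChar, Real.cos_eq_one_iff, inner_latticePoint] at h2
  obtain ⟨n, hn⟩ := h2
  have h3 : ∑ j, ((Pi.single i 1 : Fin d → ℤ) j : ℝ) * x j = x i := by
    rw [Finset.sum_eq_single i]
    · simp
    · intro j _ hj
      simp [Pi.single_eq_of_ne hj]
    · simp
  rw [h3, mul_comm] at hn
  have h4 : x i = n := (mul_left_cancel₀ Real.two_pi_pos.ne' hn).symm
  change x i = ((⌊x i⌋ : ℤ) : ℝ)
  rw [h4, Int.floor_intCast]

/-- The periodization of the spectral measure of the constant process is the counting measure of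
the lattice. -/
theorem lintegral_periodization_of_fourierCoef_eq_one (hμ : ∀ k, fourierCoef μ k = 1)
    {g : EuclideanSpace ℝ (Fin d) → ℝ≥0∞} (hg : Measurable g) :
    ∫⁻ x, g x ∂periodization μ = ∑' k, g (latticePoint k) := by
  have h0 : μ Set.univ = 1 := by
    have h1 : ∫ x, latticeChar 0 x ∂μ = 1 := hμ 0
    simp_rw [latticeChar_zero] at h1
    rw [integral_const, Complex.real_smul, mul_one] at h1
    have h2 : μ.real Set.univ = 1 := by exact_mod_cast h1
    rw [← ofReal_measureReal, h2, ENNReal.ofReal_one]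
  rw [lintegral_periodization hg]
  calc ∫⁻ x, ∑' k, g (x + latticePoint k) ∂μ = ∫⁻ _x, ∑' k, g (latticePoint k) ∂μ := by
        refine lintegral_congr_ae ?_
        filter_upwards [ae_eq_latticePoint_of_fourierCoef_eq_one hμ] with x hx
        refine Eq.trans (tsum_congr fun k => ?_)
          ((Equiv.addLeft (floorVec x)).tsum_eq fun k => g (latticePoint k))
        rw [Equiv.coe_addLeft, latticePoint_add, ← hx]
    _ = ∑' k, g (latticePoint k) := by rw [lintegral_const, h0, mul_one]

theorem diffractionMeasure_apply_of_fourierCoef_eq_one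
    {E F : Submodule ℝ (EuclideanSpace ℝ (Fin d))} {W : Set F} {α : ℝ≥0∞} (hα : α ≠ ∞)
    (hW : MeasurableSet W) (hWb : Bornology.IsBounded W) (hμ : ∀ k, fourierCoef μ k = 1)
    {C : Set E} (hC : MeasurableSet C) :
    diffractionMeasure E W α μ C = α ^ 2 * ∑' k : Fin d → ℤ,
      ENNReal.ofReal (psiHat W (F.orthogonalProjectionOnto (latticePoint k))).re *
        C.indicator 1 (E.orthogonalProjectionOnto (latticePoint k)) := by
  have hm : Measurable fun x : EuclideanSpace ℝ (Fin d) =>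
      ENNReal.ofReal (psiHat W (F.orthogonalProjectionOnto x)).re *
        C.indicator 1 (E.orthogonalProjectionOnto x) := by
    refine Measurable.mul ?_ ((measurable_one.indicator hC).comp
      E.orthogonalProjectionOnto.continuous.measurable)
    simpa using measurable_psiHat_density (α := 1) hW hWb
  rw [diffractionMeasure_apply hα hW hWb hC, lintegral_periodization_of_fourierCoef_eq_one hμ hm]

end FullLattice

/-! ### Correlations in terms of `X` -/

section SpectralMeasure

variable {d : ℕ} {Ω : Type*} [MeasurableSpace Ω] {P : Measure Ω} [IsProbabilityMeasure P]
  {X : Ω → (Fin d → ℤ) → Bool}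

theorem correlation_map (hX : Measurable X) (k : Fin d → ℤ) : correlation (P.map X) k =
    ∫ ω, ((X ω 0).toNat : ℝ) * ((X ω k).toNat : ℝ) ∂P :=
  integral_map hX.aemeasurable
    ((measurable_siteValue 0).mul (measurable_siteValue k)).aestronglyMeasurable

theorem correlation_eq_one (hX : Measurable X) (h : ∀ᵐ ω ∂P, ∀ k, X ω k = true)
    (k : Fin d → ℤ) : correlation (P.map X) k = 1 := by
  rw [correlation_map hX]
  calc ∫ ω, ((X ω 0).toNat : ℝ) * ((X ω k).toNat : ℝ) ∂P = ∫ _ω, (1 : ℝ) ∂P := by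
        refine integral_congr_ae ?_
        filter_upwards [h] with ω hω
        simp [hω]
    _ = 1 := by simp

end SpectralMeasure

end PointProc

theorem theorem5 {d : ℕ} {Ω : Type*} [MeasurableSpace Ω] (P : Measure Ω) [IsProbabilityMeasure P]
    -- the stationary ergodic process `X` with values in `{0,1}`
    (X : Ω → (Fin d → ℤ) → Bool) (hX : Measurable X)
    (hXstat : PointProc.StationaryUnder PointProc.shift (P.map X))
    (hXerg : PointProc.ErgodicUnder PointProc.shift (P.map X))
    -- the uniform variable `U`, independent of `X`
    (U : Ω → EuclideanSpace ℝ (Fin d)) (hU : Measurable U)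
    (hUunif : pdf.IsUniform U (PointProc.unitCube d) P volume)
    (hUX : IndepFun U X P)
    -- the point process `φ = s(U, X)`
    (φ : Ω → PointProc.LocFin (EuclideanSpace ℝ (Fin d)))
    (hφ : φ = fun ω => PointProc.suspension (U ω) (X ω)) :
    -- the exceptional set
    (volume : Measure (EuclideanSpace ℝ (Fin d))).toSphere
        (PointProc.exceptionalSet (P.map φ)) = 0 ∧
    (d = 2 → (PointProc.exceptionalSet (P.map φ)).Countable) ∧
    ((∀ᵐ ω ∂P, ∀ k, X ω k = true) → PointProc.exceptionalSet (P.map φ) ⊆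
      {v | ¬ LinearIndependent ℚ fun i => (v : EuclideanSpace ℝ (Fin d)) i}) ∧
    -- the spectral measure exists
    (∃ μ, PointProc.IsSpectralMeasure P X μ) ∧
    -- the cut-and-project process
    ∀ (E F : Submodule ℝ (EuclideanSpace ℝ (Fin d))) (hEF : IsCompl E F)
      (W : Set F) (_ : MeasurableSet W) (hWb : Bornology.IsBounded W),
      (∃ v : Metric.sphere (0 : EuclideanSpace ℝ (Fin d)) 1,
        (v : EuclideanSpace ℝ (Fin d)) ∈ E ∧ v ∉ PointProc.exceptionalSet (P.map φ)) →
      (∀ᵐ ω ∂P, Set.InjOn (E.projectionOnto F hEF) (PointProc.strip hEF W (φ ω))) →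
      ∀ χ : Ω → PointProc.LocFin E, χ = (fun ω => PointProc.cutProject hEF W hWb (φ ω)) →
      Measurable χ ∧
      PointProc.StationaryUnder PointProc.translate (P.map χ) ∧
      PointProc.ErgodicUnder PointProc.translate (P.map χ) ∧
      PointProc.SquareIntegrable P χ ∧
      ∀ (CE : Set E) (CF : Set F) (α : ℝ≥0∞),
        MeasurableSet CE → volume CE = 1 → MeasurableSet CF → volume CF = 1 →
        α = volume (Set.image2
          (fun (x : E) (y : F) => (x : EuclideanSpace ℝ (Fin d)) + y) CE CF) →
      ∀ μ : Measure (EuclideanSpace ℝ (Fin d)), PointProc.IsSpectralMeasure P X μ →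
      -- `μ̂` and `ψ̂` are real and nonnegative, so `ENNReal.ofReal` and `re` below lose nothing
      (∀ k, (PointProc.fourierCoef μ k).im = 0 ∧ 0 ≤ (PointProc.fourierCoef μ k).re) ∧
      (∀ ξ : F, (PointProc.psiHat W ξ).im = 0 ∧ 0 ≤ (PointProc.psiHat W ξ).re) ∧
      ∃ γ ν : Measure E,
        (∀ᵐ ω ∂P, PointProc.IsAutocorrelation (χ ω) γ) ∧
        (∀ C : Set E, MeasurableSet C → γ C = α * ∑' k : Fin d → ℤ,
          ENNReal.ofReal (PointProc.fourierCoef μ k).re *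
          ENNReal.ofReal (PointProc.psi W (F.projectionOnto E hEF.symm (PointProc.latticePoint k))) *
          C.indicator 1 (E.projectionOnto F hEF (PointProc.latticePoint k))) ∧
        (∀ᵐ ω ∂P, PointProc.IsDiffraction (χ ω) ν) ∧
        (∀ C : Set E, MeasurableSet C → ν C = α ^ 2 * ∫⁻ x,
          ENNReal.ofReal (PointProc.psiHat W (F.orthogonalProjectionOnto x)).re *
          C.indicator 1 (E.orthogonalProjectionOnto x) ∂(PointProc.periodization μ)) ∧
        -- the model set case `X ≡ 1`
        ((∀ᵐ ω ∂P, ∀ k, X ω k = true) → ∀ C : Set E, MeasurableSet C →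
          γ C = α * ∑' k : Fin d → ℤ,
            ENNReal.ofReal
              (PointProc.psi W (F.projectionOnto E hEF.symm (PointProc.latticePoint k))) *
            C.indicator 1 (E.projectionOnto F hEF (PointProc.latticePoint k)) ∧
          ν C = α ^ 2 * ∑' k : Fin d → ℤ,
            ENNReal.ofReal
              (PointProc.psiHat W (F.orthogonalProjectionOnto (PointProc.latticePoint k))).re *
            C.indicator 1 (E.orthogonalProjectionOnto (PointProc.latticePoint k))) := by
  have hξ : IsProbabilityMeasure (P.map X) := Measure.isProbabilityMeasure_map hX.aemeasurable
  have hlaw : P.map φ = PointProc.suspensionLaw (P.map X) := by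
    rw [hφ]
    exact PointProc.map_suspension_eq hX hU hUunif hUX
  have hφm : Measurable φ := by
    rw [hφ]
    exact PointProc.measurable_suspension.comp (hU.prodMk hX)
  have hcoef : ∀ μ, PointProc.IsSpectralMeasure P X μ → ∀ k,
      PointProc.fourierCoef μ k = PointProc.correlation (P.map X) k := fun μ hμ k => by
    rw [hμ.2, PointProc.correlation_map hX]
  refine ⟨?_, fun hd => ?_, fun h1 => ?_, ?_, ?_⟩
  · rw [hlaw]
    exact PointProc.toSphere_exceptionalSet hXstat hXerg
  · rw [hlaw]
    exact PointProc.countable_exceptionalSet hXstat hXerg hd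
  · rw [hlaw]
    refine PointProc.exceptionalSet_subset_of_ae_eq_true ?_
    refine (ae_map_iff hX.aemeasurable (p := fun x => x = fun _ => true)
      (measurableSet_singleton _)).2 ?_
    filter_upwards [h1] with ω hω using funext hω
  · obtain ⟨μ, hμ, hμk⟩ := PointProc.exists_spectral_measure hXstat
    exact ⟨μ, hμ, fun k => by rw [hμk, PointProc.correlation_map hX]⟩
  intro E F hEF W hW hWb hv hinj χ hχ
  rw [hlaw] at hv
  have he := PointProc.ergodicUnder_subspace hv
  have hχm : Measurable χ := by
    rw [hχ]
    exact (PointProc.measurable_cutProject hEF hW hWb).comp hφm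
  have hχlaw : P.map χ =
      (PointProc.suspensionLaw (P.map X)).map (PointProc.cutProject hEF W hWb) := by
    rw [← hlaw, Measure.map_map (PointProc.measurable_cutProject hEF hW hWb) hφm, hχ]
    rfl
  refine ⟨hχm, ?_, ?_, ?_, ?_⟩
  · rw [hχlaw]
    exact PointProc.stationaryUnder_map_cutProject hW hWb
      (PointProc.stationaryUnder_suspensionLaw hXstat)
  · rw [hχlaw]
    exact PointProc.ergodicUnder_map_cutProject hW hWb he
  · subst hφ hχ
    exact PointProc.squareIntegrable_cutProject hWb hχm
  intro CE CF α hCE hCE1 hCF hCF1 hα μ hμ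
  have := hμ.1
  obtain ⟨hαt, hvol⟩ := PointProc.volume_eq_smul_map hEF hCE hCE1 hCF hCF1 hα
  set κ := PointProc.correlation (P.map X) with hκdef
  have hκ : ∀ k, PointProc.fourierCoef μ k = κ k := hcoef μ hμ
  have hκ0 : ∀ k, 0 ≤ κ k := PointProc.correlation_nonneg
  obtain ⟨R, hR⟩ := hWb.exists_norm_le
  set γ := PointProc.latticeMeasure hEF (PointProc.pairWeight hEF W α κ)
  have hauto : ∀ᵐ ω ∂P, PointProc.IsAutocorrelation (χ ω) γ := by
    have h1 := PointProc.tendsto_ncard_stripPairs (h := hEF) hXstat he hW hWb hvol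
    rw [← hlaw] at h1
    -- The pair densities hold for almost every configuration and are pulled back through the law of
    -- `φ`. They are deterministic, so one `γ` serves almost every `ω`.
    filter_upwards [ae_of_ae_map hφm.aemeasurable h1, hinj] with ω h2 h3
    subst hφ hχ
    exact PointProc.isAutocorrelation_cutProject hWb hR
      (PointProc.pairWeight_nonneg hEF hW hκ0) (PointProc.pairWeight_eq_zero hEF hW hR)
      (U ω) (X ω) h3 h2
  have hfourier : PointProc.IsFourierTransform γ (PointProc.diffractionMeasure E W α μ) :=
    PointProc.isFourierTransform_latticeMeasure hEF hαt hvol hW hWb hκ0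
      PointProc.correlation_le (PointProc.correlation_neg hXstat) hκ
  have hγ : ∀ C : Set E, MeasurableSet C → γ C = α * ∑' k : Fin d → ℤ,
      ENNReal.ofReal (PointProc.fourierCoef μ k).re *
      ENNReal.ofReal (PointProc.psi W (F.projectionOnto E hEF.symm (PointProc.latticePoint k))) *
      C.indicator 1 (E.projectionOnto F hEF (PointProc.latticePoint k)) := by
    intro C hC
    rw [PointProc.latticeMeasure_apply hC, ← ENNReal.tsum_mul_left]
    refine tsum_congr fun k => ?_
    rw [PointProc.pairWeight, ENNReal.ofReal_mul ENNReal.toReal_nonneg,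
      ENNReal.ofReal_mul (hκ0 k), ENNReal.ofReal_toReal hαt, hκ, Complex.ofReal_re, mul_assoc]
  refine ⟨fun k => ?_, fun ξ => ?_, γ, PointProc.diffractionMeasure E W α μ, hauto, hγ, ?_, ?_, ?_⟩
  · rw [hκ, Complex.ofReal_im, Complex.ofReal_re]
    exact ⟨rfl, hκ0 k⟩
  · rw [PointProc.psiHat_eq hW hWb, Complex.ofReal_im, Complex.ofReal_re]
    exact ⟨rfl, by positivity⟩
  · filter_upwards [hauto] with ω hω using ⟨γ, hω, hfourier⟩
  · exact fun C hC => PointProc.diffractionMeasure_apply hαt hW hWb hC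
  · intro h1 C hC
    have hone : ∀ k, PointProc.fourierCoef μ k = 1 := fun k => by
      rw [hκ, hκdef, PointProc.correlation_eq_one hX h1 k, Complex.ofReal_one]
    refine ⟨?_, PointProc.diffractionMeasure_apply_of_fourierCoef_eq_one hαt hW hWb hone hC⟩
    rw [hγ C hC]
    simp_rw [hone, Complex.one_re, ENNReal.ofReal_one, one_mul]
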